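/- **Setting.** Let $u_1=(0,0)$, $u_2=(1,0)$, $u_3=\frac12(1,\sqrt3)$, $\psi_i(x)=\frac12(x-u_i)+u_i$ and $\psi_w=\psi_{w_1}\circ\dots\circ\psi_{w_n}$ for $w\in\{1,2,3\}^n$. Let $G_0$ be the complete graph on $VG_0=\{u_1,u_2,u_3\}$, and let $G_{n+1}=\psi_1(G_n)\cup\psi_2(G_n)\cup\psi_3(G_n)$ be the Sierpiński graphs, with vertex sets $VG_n$; the Sierpiński gasket is $K=\overline{\bigcup_n VG_n}$. The sets $\psi_w(K)$, $w\in\{1,2,3\}^n$, are the $n$-parts of $K$. *Traces.* Let $\mathcal T_n$ be the set of spanning trees of $G_n$. The trace of a spanning tree $f$ of $G_1$ is the spanning tree of $G_0$ consisting of the two edges at $u_i$, where $i$ is the unique index such that for both $j\ne i$ the path in $f$ from $u_i$ to $u_j$ stays in $\psi_i(G_0)\cup\psi_j(G_0)$. The trace of a spanning forest of $G_1$ with two components, one containing $u_i$ and the other one containing the two other corners, is the edge of $G_0$ opposite to $u_i$. The trace of a spanning forest of $G_1$ with three components, each containing one corner, has no edges. For $f\in\mathcal T_{n+1}$, the trace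 $\mathsf{Tr} f\in\mathcal T_n$ is obtained by replacing the restriction of $f$ to each of the $3^n$ copies $\psi_w(G_1)$, $w\in\{1,2,3\}^n$, of $G_1$ in $G_{n+1}$ by its (scaled) trace in $\psi_w(G_0)$. Let $\mathcal T_\infty=\varprojlim\mathcal T_n$ be the projective limit along the traces, with the $\sigma$-algebra generated by the projections. *Curves.* Let $C$ be the set of continuous curves $\gamma\colon[0,\infty]\to K$ with $\gamma(0)=u_1$, $\gamma(\infty)=u_2$, and put $\mathsf h(\gamma)=\inf\{t:\gamma(s)=u_2\text{ for all }s\ge t\}$. The curve $\gamma$ is self-avoiding if $\gamma(s)\neq\gamma(t)$ for $0\le s<t\le\mathsf h(\gamma)$. The decomposition of $\gamma$ at level $n$ (unique if it exists) consists of an integer $m\ge1$, times $0=t_0<\dots<t_m=\mathsf h(\gamma)$ and words $w_1,\dots,w_m\in\{1,2,3\}^n$ such that $\gamma([t_{j-1},t_j])\subseteq\psi_{w_j}(K)$ and $\gamma([t_{j-1},t_j])\cap\psi_{w_j}(K\setminus VG_0)\ne\emptyset$ for $1\le j\le m$, and $t_j=\inf\{s>t_{j-1}:\gamma(s)\notin\psi_{w_j}(K)\}$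 for $1\le j\le m-1$. Write $\Delta_n(\gamma)=m$, $\mathsf t_{j,n}(\gamma)=t_j$, $\mathsf s_{j,n}(\gamma)=t_j-t_{j-1}$. The curve $\gamma$ has a peak of type $i$ in $\psi_w(K)$ if there are $t_1<t_2$ with $\gamma([t_1,t_2])\subseteq\psi_w(K)$, $\gamma(t_1)\ne\gamma(t_2)$, $\gamma(t_1),\gamma(t_2)\in\psi_w(VG_0\setminus\{u_i\})$ and $\gamma((t_1,t_2))\cap\psi_w(VG_0)=\{\psi_w(u_i)\}$. *Random objects.* Let $T_\infty=(T_n)_{n\ge0}$ be a random element of $\mathcal T_\infty$, on some probability space $(\Omega,\mathbb P)$, such that $T_n$ is a uniform spanning tree of $G_n$ for every $n$. Let $\bar\alpha=\frac43+\frac1{15}\sqrt{205}$, and let $X_n$ be the linear interpolation of the path from $u_1$ to $u_2$ in $T_n$ (a loop-erased random walk), traversed at $\bar\alpha^n$ edges per unit of time and staying at $u_2$ after its arrival. Let $\Omega'$ be the event that $\mathsf S_{j,n}=\lim_{m\to\infty}\mathsf s_{j,n}(X_m)$ exists in $(0,\infty)$ for all $n\ge0$ and $1\le j\le\Delta_n(X_n)$.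 On $\Omega'$ put $\mathsf T_{j,n}=\lim_{m\to\infty}\mathsf t_{j,n}(X_m)$ for $0\le j\le\Delta_n(X_n)$ and $X=\lim_{n\to\infty}X_n$. Let $\Omega''\subseteq\Omega'$ be the event on which moreover - $X$ has no peaks; - for all $n\ge 0$, $X([0,\infty])\cap VG_n=\{X(\mathsf T_{j,n}):0\le j\le\Delta_n(X_n)\}$, $X(\mathsf T_{0,n})=u_1$ and $X(\mathsf T_{\Delta_n(X_n),n})=u_2$; - $X([\mathsf T_{i-1,n},\mathsf T_{i,n}])\cap X([\mathsf T_{j-1,n},\mathsf T_{j,n}])=\emptyset$ for all $n\ge0$ and all $i,j\in\{1,\dots,\Delta_n(X_n)\}$ with $i<j-1$; - $|X([0,\infty])\cap\psi_w(VG_0)|\le2$ for all words $w$; - $\max\{\mathsf S_{j,n}:1\le j\le\Delta_n(X_n)\}\to0$ as $n\to\infty$. **Theorem.** There is a probability measure on $\mathcal T_\infty$ all of whose projections to the sets $\mathcal T_n$ are uniform, and for every random element $T_\infty$ as above almost every $\omega\in\Omega$ lies in $\Omega''$. On $\Omega''$, the curves $X_n$ converge uniformly to $X\in C$, and the following holds: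 - The limit curve $X$ is self-avoiding. - For any $n\ge0$, $X$ has a decomposition at level $n$ with $\Delta_n(X)=\Delta_n(X_n)$, the limits $\mathsf T_{j,n}$ exist, and for any $1\le j\le\Delta_n(X_n)$, $$\mathsf T_{j,n}=\mathsf t_{j,n}(X)=\inf\{t>\mathsf t_{j-1,n}(X): X(t)\in VG_n\}.$$ -/

import Mathlib

open Filter Topology MeasureTheory ProbabilityTheory
open scoped ENNReal

noncomputable section

namespace SierpinskiLERW

/-! ### The Sierpinski gasket and the Sierpinski graphs -/

/-- The Euclidean plane. -/
abbrev Plane : Type := EuclideanSpace ℝ (Fin 2)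

/-- The corners `u₁ = (0,0)`, `u₂ = (1,0)`, `u₃ = (1,√3)/2`; the letters `1, 2, 3` are
represented by `0, 1, 2 : Fin 3`. -/
def u : Fin 3 → Plane :=
  ![!₂[0, 0], !₂[1, 0], !₂[1 / 2, Real.sqrt 3 / 2]]

/-- The similitudes `ψᵢ(x) = (x - uᵢ)/2 + uᵢ`. -/
def psi (i : Fin 3) (x : Plane) : Plane := (1 / 2 : ℝ) • (x - u i) + u i

/-- `ψ_w = ψ_{w₁} ∘ ⋯ ∘ ψ_{wₙ}` for a word `w = w₁⋯wₙ`. -/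
def psiWord : List (Fin 3) → Plane → Plane
  | [], x => x
  | i :: w, x => psi i (psiWord w x)

/-- The vertex set of `Gₙ`. -/
def VG : ℕ → Set Plane
  | 0 => Set.range u
  | n + 1 => ⋃ i : Fin 3, psi i '' VG n

/-- The edge set of `Gₙ`. -/
def EG : ℕ → Set (Sym2 Plane)
  | 0 => {e | ∃ i j : Fin 3, i ≠ j ∧ e = s(u i, u j)}
  | n + 1 => ⋃ i : Fin 3, Sym2.map (psi i) '' EG n

/-- The Sierpinski gasket `K`, the closure of the union of all vertex sets. -/
def gasket : Set Plane := closure (⋃ n, VG n)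

/-- The gasket is a non-empty compact set with `K = ψ₁(K) ∪ ψ₂(K) ∪ ψ₃(K)`. -/
theorem gasket_spec : gasket.Nonempty ∧ IsCompact gasket ∧
    gasket = ⋃ i : Fin 3, psi i '' gasket := by
  have hu : ∀ i, ‖u i‖ ≤ 1 := by
    intro i
    fin_cases i <;> simp [u, EuclideanSpace.norm_eq, Fin.sum_univ_two]
    rw [div_pow, Real.sq_sqrt (by norm_num)]
    norm_num
  have hb : ∀ n, VG n ⊆ Metric.closedBall 0 1 := by
    intro n
    induction n with
    | zero => rintro _ ⟨i, rfl⟩; simpa using hu i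
    | succ n ih =>
      intro x hx
      obtain ⟨i, y, hy, rfl⟩ := Set.mem_iUnion.1 hx
      have h1 : ‖y‖ ≤ 1 := by simpa using ih hy
      have : psi i y = (1 / 2 : ℝ) • y + (1 / 2 : ℝ) • u i := by
        unfold psi
        module
      rw [mem_closedBall_zero_iff, this]
      calc _ ≤ ‖(1 / 2 : ℝ) • y‖ + ‖(1 / 2 : ℝ) • u i‖ := norm_add_le _ _
        _ ≤ 1 := by
          rw [norm_smul, norm_smul]
          have := hu i
          norm_num
          linarith
  have hcomp : IsCompact gasket :=
    (isCompact_closedBall (0 : Plane) 1).of_isClosed_subset isClosed_closure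
      (closure_minimal (Set.iUnion_subset hb) Metric.isClosed_closedBall)
  have hcont : ∀ i, Continuous (psi i) := by
    intro i
    unfold psi
    fun_prop
  have hmono : ∀ n, VG n ⊆ VG (n + 1) := by
    intro n
    induction n with
    | zero =>
      rintro _ ⟨i, rfl⟩
      exact Set.mem_iUnion.2 ⟨i, u i, ⟨i, rfl⟩, by simp [psi]⟩
    | succ n ih =>
      exact Set.iUnion_mono fun i => Set.image_mono ih
  refine ⟨⟨u 0, subset_closure (Set.mem_iUnion.2 ⟨0, 0, rfl⟩)⟩, hcomp, ?_⟩
  apply Set.Subset.antisymm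
  · refine closure_minimal (Set.iUnion_subset fun n => ?_)
      (isClosed_iUnion_of_finite fun i => (hcomp.image (hcont i)).isClosed)
    refine (hmono n).trans (Set.iUnion_mono fun i => Set.image_mono ?_)
    exact (Set.subset_iUnion VG n).trans subset_closure
  · refine Set.iUnion_subset fun i => ?_
    refine (image_closure_subset_closure_image (hcont i)).trans (closure_mono ?_)
    rw [Set.image_iUnion]
    refine Set.iUnion_subset fun n => ?_
    exact (Set.subset_iUnion (fun i => psi i '' VG n) i).trans (Set.subset_iUnion VG (n + 1))

/-! ### Spanning trees, spanning forests and traces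

A spanning subgraph of `Gₙ` is given by its edge set `f ⊆ EG n`.  The graph with edge set `f` is
regarded as a graph on the whole plane, in which all points outside `VG n` are isolated. -/

/-- The graph with edge set `f`. -/
abbrev gr (f : Set (Sym2 Plane)) : SimpleGraph Plane := SimpleGraph.fromEdgeSet f

/-- `f` is (the edge set of) a spanning forest of `Gₙ`. -/
def IsSpanningForest (n : ℕ) (f : Set (Sym2 Plane)) : Prop :=
  f ⊆ EG n ∧ (gr f).IsAcyclic

/-- `f` is (the edge set of) a spanning tree of `Gₙ`. -/
def IsSpanningTree (n : ℕ) (f : Set (Sym2 Plane)) : Prop :=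
  IsSpanningForest n f ∧ ∀ x ∈ VG n, ∀ y ∈ VG n, (gr f).Reachable x y

/-- The class `𝒮ₙⁱ`: spanning forests of `Gₙ` with two components, one of which contains `uᵢ` and
the other one contains the two other corners. -/
def IsTwoForest (n : ℕ) (i : Fin 3) (f : Set (Sym2 Plane)) : Prop :=
  IsSpanningForest n f ∧
    (∀ j, j ≠ i → ¬ (gr f).Reachable (u i) (u j)) ∧
    (∀ j k, j ≠ i → k ≠ i → (gr f).Reachable (u j) (u k)) ∧
    ∀ x ∈ VG n, (gr f).Reachable x (u i) ∨ ∃ j, j ≠ i ∧ (gr f).Reachable x (u j)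

/-- The class `𝒯ⁱ` on `G_{n+1}`: spanning trees such that the path from `uᵢ` to any other corner
`uⱼ` is contained in `ψᵢ(Gₙ) ∪ ψⱼ(Gₙ)`. -/
def IsTreeOfType (n : ℕ) (i : Fin 3) (f : Set (Sym2 Plane)) : Prop :=
  IsSpanningTree (n + 1) f ∧
    ∀ j, j ≠ i → ∀ p : (gr f).Walk (u i) (u j), p.IsPath →
      ∀ e ∈ p.edges, e ∈ Sym2.map (psi i) '' EG n ∪ Sym2.map (psi j) '' EG n

/-- The trace of a spanning forest of `G₁`: forests of class `𝒯₁ⁱ` are mapped to the tree of `G₀`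
which consists of the two edges at `uᵢ`, those of class `𝒮₁ⁱ` to the single edge of `G₀` opposite
to `uᵢ`, and all others to the forest without edges. -/
def traceOne (f : Set (Sym2 Plane)) : Set (Sym2 Plane) :=
  {e | ∃ i, IsTreeOfType 0 i f ∧ ∃ j, j ≠ i ∧ e = s(u i, u j)} ∪
  {e | ∃ i, IsTwoForest 1 i f ∧ ∃ j k, j ≠ i ∧ k ≠ i ∧ j ≠ k ∧ e = s(u j, u k)}

/-- The restriction `π_w(f)` of a spanning forest `f` of `G_{|w|+k}`, a subgraph of `G_k`. -/
def restrict (k : ℕ) (w : List (Fin 3)) (f : Set (Sym2 Plane)) : Set (Sym2 Plane) :=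
  {e | e ∈ EG k ∧ Sym2.map (psiWord w) e ∈ f}

/-- The trace of a spanning forest of `G_{n+1}`, a spanning forest of `Gₙ`. -/
def trace (n : ℕ) (f : Set (Sym2 Plane)) : Set (Sym2 Plane) :=
  ⋃ w ∈ {w : List (Fin 3) | w.length = n},
    Sym2.map (psiWord w) '' traceOne (restrict 1 w f)

/-- The finite set `𝒯ₙ` of all spanning trees of `Gₙ`, with the discrete `σ`-algebra. -/
def SpanTree (n : ℕ) : Type := {f : Set (Sym2 Plane) // IsSpanningTree n f}

instance (n : ℕ) : MeasurableSpace (SpanTree n) := ⊤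

/-- The projective limit `𝒯_∞` of the sets `𝒯ₙ` along the traces. -/
def LimitTree : Type :=
  {t : ∀ n, SpanTree n // ∀ n, trace n (t (n + 1)).1 = (t n).1}

/-- The canonical projection from `𝒯_∞` to `𝒯ₙ`. -/
def LimitTree.proj (t : LimitTree) (n : ℕ) : SpanTree n := t.1 n

/-- The `σ`-algebra on `𝒯_∞` generated by the projections. -/
instance : MeasurableSpace LimitTree :=
  ⨆ n, MeasurableSpace.comap (fun t : LimitTree => t.proj n) inferInstance

/-- `T` is a random element of `𝒯_∞` such that, for all `n`, its projection to `𝒯ₙ` is a uniform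
spanning tree of `Gₙ`. -/
def IsUniformLimitTree {Ω : Type*} [MeasurableSpace Ω] (P : Measure Ω) (T : Ω → LimitTree) :
    Prop :=
  Measurable T ∧ ∀ n, P.map (fun ω => (T ω).proj n) = uniformOn (Set.univ : Set (SpanTree n))

/-! ### Curves in the gasket -/

/-- The set `C` of continuous curves `[0,∞] → K` from `u₁` to `u₂`. -/
structure IsCurve (γ : ℝ≥0∞ → Plane) : Prop where
  continuous : Continuous γ
  mem_gasket : ∀ t, γ t ∈ gasket
  start : γ 0 = u 0
  finish : γ ∞ = u 1

/-- `h(γ)`, the first time from which on `γ` stays at `u₂`. -/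
def endTime (γ : ℝ≥0∞ → Plane) : ℝ≥0∞ := sInf {t | ∀ s, t ≤ s → γ s = u 1}

/-- Self-avoiding curves. -/
def SelfAvoiding (γ : ℝ≥0∞ → Plane) : Prop :=
  ∀ s t, s < t → t ≤ endTime γ → γ s ≠ γ t

/-- `γ` traverses exactly `m` `n`-parts: `w j` (for `j < m`) is the word of the `(j+1)`-st
`n`-part traversed, `γ` stays in this part from time `t j` to time `t (j+1)`, and `t (j+1)` is the
exit time from this part (respectively the time `h(γ)` if the part is the last one). -/
structure IsPartDecomp (n : ℕ) (γ : ℝ≥0∞ → Plane) (m : ℕ) (t : ℕ → ℝ≥0∞)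
    (w : ℕ → List (Fin 3)) : Prop where
  one_le : 1 ≤ m
  time_zero : t 0 = 0
  time_last : t m = endTime γ
  time_lt : ∀ j < m, t j < t (j + 1)
  length_word : ∀ j < m, (w j).length = n
  subset_part : ∀ j < m, γ '' Set.Icc (t j) (t (j + 1)) ⊆ psiWord (w j) '' gasket
  hits_inner : ∀ j < m,
    (γ '' Set.Icc (t j) (t (j + 1)) ∩ psiWord (w j) '' (gasket \ VG 0)).Nonempty
  exit_time : ∀ j, j + 1 < m →
    t (j + 1) = sInf {s | t j < s ∧ γ s ∉ psiWord (w j) '' gasket}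

open Classical in
/-- The decomposition of `γ` into its crossings of `n`-parts (a default value if there is none). -/
def partDecomp (n : ℕ) (γ : ℝ≥0∞ → Plane) : ℕ × (ℕ → ℝ≥0∞) × (ℕ → List (Fin 3)) :=
  if h : ∃ d : ℕ × (ℕ → ℝ≥0∞) × (ℕ → List (Fin 3)), IsPartDecomp n γ d.1 d.2.1 d.2.2 then
    h.choose
  else (0, fun _ => 0, fun _ => [])

/-- `Δₙ(γ)`, the number of `n`-parts traversed by `γ`. -/
def numParts (n : ℕ) (γ : ℝ≥0∞ → Plane) : ℕ := (partDecomp n γ).1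

/-- The times `t_{j,n}(γ)`, for `0 ≤ j ≤ Δₙ(γ)`. -/
def partTime (j n : ℕ) (γ : ℝ≥0∞ → Plane) : ℝ≥0∞ := (partDecomp n γ).2.1 j

/-- The words of the `n`-parts traversed by `γ`, indexed by `0, …, Δₙ(γ) - 1`. -/
def partWord (j n : ℕ) (γ : ℝ≥0∞ → Plane) : List (Fin 3) := (partDecomp n γ).2.2 j

/-- `s_{j,n}(γ) = t_{j,n}(γ) - t_{j-1,n}(γ)`, for `1 ≤ j ≤ Δₙ(γ)`. -/
def partDuration (j n : ℕ) (γ : ℝ≥0∞ → Plane) : ℝ≥0∞ := partTime j n γ - partTime (j - 1) n γ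

/-- `γ` has a peak of type `i` in the part `ψ_w(K)`. -/
def HasPeak (γ : ℝ≥0∞ → Plane) (w : List (Fin 3)) (i : Fin 3) : Prop :=
  ∃ t₁ t₂ : ℝ≥0∞, t₁ < t₂ ∧
    γ '' Set.Icc t₁ t₂ ⊆ psiWord w '' gasket ∧
    γ t₁ ≠ γ t₂ ∧
    γ t₁ ∈ psiWord w '' (VG 0 \ {u i}) ∧ γ t₂ ∈ psiWord w '' (VG 0 \ {u i}) ∧
    γ '' Set.Ioo t₁ t₂ ∩ psiWord w '' VG 0 = {psiWord w (u i)}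

/-- Linear interpolation and constant extension of a finite sequence `x₀, …, x_r`. -/
def interpolate (r : ℕ) (x : ℕ → Plane) (t : ℝ≥0∞) : Plane :=
  if t < r then
    ((⌊t.toReal⌋₊ : ℝ) + 1 - t.toReal) • x ⌊t.toReal⌋₊
      + (t.toReal - (⌊t.toReal⌋₊ : ℝ)) • x (⌊t.toReal⌋₊ + 1)
  else x r

/-! ### Rescaled loop-erased walks and their limit -/

/-- `ᾱ = 4/3 + √205/15`. -/
def alpha : ℝ := 4 / 3 + Real.sqrt 205 / 15

theorem u_mem_VG (i : Fin 3) (n : ℕ) : u i ∈ VG n := by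
  induction n with
  | zero => exact ⟨i, rfl⟩
  | succ n ih => exact Set.mem_iUnion.2 ⟨i, u i, ih, by simp [psi]⟩

/-- The path `u₁ t u₂` from `u₁` to `u₂` in the spanning tree `t` of `Gₙ`. -/
def treePath {n : ℕ} (t : SpanTree n) : (gr t.1).Walk (u 0) (u 1) :=
  (t.2.2 _ (u_mem_VG 0 n) _ (u_mem_VG 1 n)).exists_isPath.choose

/-- The curve `Xₙ`: the path from `u₁` to `u₂` in the tree `Tₙ`, linearly interpolated and run at
speed `ᾱⁿ`. -/
def X (T : LimitTree) (n : ℕ) (t : ℝ≥0∞) : Plane :=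
  interpolate (treePath (T.proj n)).length (treePath (T.proj n)).getVert
    (ENNReal.ofReal (alpha ^ n) * t)

/-- The limit curve. -/
def Xlim (T : LimitTree) (t : ℝ≥0∞) : Plane := limUnder atTop fun n => X T n t

/-- The limiting durations `S_{j,n}`. -/
def Slim (T : LimitTree) (j n : ℕ) : ℝ≥0∞ := limUnder atTop fun m => partDuration j n (X T m)

/-- The limiting times `T_{j,n}`. -/
def Tlim (T : LimitTree) (j n : ℕ) : ℝ≥0∞ := limUnder atTop fun m => partTime j n (X T m)

/-- The event `Ω'` that all durations converge to limits in `(0,∞)`. -/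
def DurationsConverge (T : LimitTree) : Prop :=
  ∀ n j, 1 ≤ j → j ≤ numParts n (X T n) →
    ∃ S : ℝ≥0∞, 0 < S ∧ S < ∞ ∧ Tendsto (fun m => partDuration j n (X T m)) atTop (𝓝 S)

/-- The event `Ω''`: on `Ω'`, the limit curve has no peaks, visits in `VG n` exactly the points
`X(T_{j,n})`, its pieces in non-consecutive `n`-parts are disjoint, it visits at most two corners of
every part, and the maximal duration tends to `0`. -/
structure GoodEvent (T : LimitTree) : Prop where
  durations : DurationsConverge T
  no_peak : ∀ w i, ¬ HasPeak (Xlim T) w i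
  start : ∀ n, Xlim T (Tlim T 0 n) = u 0
  finish : ∀ n, Xlim T (Tlim T (numParts n (X T n)) n) = u 1
  range_inter : ∀ n, Set.range (Xlim T) ∩ VG n =
    {x | ∃ j, j ≤ numParts n (X T n) ∧ x = Xlim T (Tlim T j n)}
  disjoint : ∀ n i j, 1 ≤ i → i + 1 < j → j ≤ numParts n (X T n) →
    Xlim T '' Set.Icc (Tlim T (i - 1) n) (Tlim T i n) ∩
      Xlim T '' Set.Icc (Tlim T (j - 1) n) (Tlim T j n) = ∅
  corners : ∀ w, (Set.range (Xlim T) ∩ psiWord w '' VG 0).encard ≤ 2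
  max_duration : Tendsto
    (fun n => ⨆ j ∈ Set.Icc 1 (numParts n (X T n)), Slim T j n) atTop (𝓝 0)

end SierpinskiLERW

end

/-! A spanning forest of $G_n$ whose components all contain a corner is coded by one state (an edge
set of $G_0$) for each of the $3^n$ smallest parts, and the trace replaces three states by one
through the finite map `tau`. One subdivision step is therefore a finite check over 512 triples of
states, which `root_spec` and `trace_dec` carry to all levels. A point of $\mathcal T_\infty$
becomes a `Consistent` family of states indexed by words, from which the path from $u_1$ to $u_2$
unfolds recursively (`cr`, `vl`, `support_eq_vl`).

Probability. A state with $e$ edges has $50(3/5)^e$ triples above it (`cardTable_eq`), and each of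
these triples has $e+3$ edges in total (`edges_tau`). Hence all triples above a given state carry
the same number of refinements: given its state, a uniform forest in a part has a uniform triple of
states in its three pieces, and then independent forests in these pieces (`avg`,
`exists_sum_eq_avg`). So the crossings of parts form a branching process with three types, whose
mean matrix has the eigenvalues $\bar\alpha$, `alpha₂` and $0$. The same count shows that all fibers
of the trace between sets of spanning trees have equal size. The uniform laws are thus compatible,
and compatible enumerations of the trees turn a uniform point of $[0,1)$ into a random limit tree
(`exists_uniformLimitTree`).

Path length is a combination of functionals attached to eigenvectors. Each satisfies a linear
recursion whose error has mean zero and second moment $O(3^k)$, and $3<5\le\bar\alpha^2$; so the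
rescaled lengths converge almost surely (`ae_exists_tendsto_lenf`). The limits are positive, because
every path crosses at least two independent pieces and being short by $j$ levels has probability at
most $\theta^{2^j}$ (`ae_not_tendsto_zero`). There are $3^n$ parts of level $n$, with squared
durations of mean $O(\bar\alpha^{-2n})$, so the maximal duration tends to $0$
(`ae_tendsto_sqBound`). A crossing enters the $k$-th sub-part at the third corner of its part with
probability at most $4\cdot2^{-k}$, so in the limit it misses that corner (`ae_not_hitsThird`).

Deterministic part. If durations converge, so do the times $\mathsf t_{j,n}(X_m)$, and for large
$m,m'$ the curves $X_m,X_{m'}$ are at any time in the same or in consecutive $n$-parts; this gives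
uniform convergence (`uniformCauchySeqOn_X`). If crossings miss the third corners, the limit meets
$VG_n$ only in vertices of the path, and the remaining conditions of $\Omega''$ follow
(`GoodEvent.of_missesThird`). On $\Omega''$ two different times up to the end lie in non-consecutive
intervals of a fine enough level, whose images are disjoint, so $X$ is self-avoiding (`Xlim_ne`).
Since different parts of one level share at most one point, $X$ leaves each part exactly at the
limiting time. -/

namespace SierpinskiLERW

/-! ### Local states -/

/-- A set of edges of `G₀`, coded in binary: bit `k` tells whether the edge opposite to the corner
`u k` is present. -/
abbrev St : Type := Fin 8

/-- The edge opposite to the corner `k` is present. -/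
def has (s : St) (k : Fin 3) : Bool := s.val.testBit k.val

/-- The third corner. -/
def third (a b : Fin 3) : Fin 3 := -(a + b)

/-- The corners `a` and `b` are connected by edges of the state `s`. -/
def conn (s : St) (a b : Fin 3) : Bool :=
  a == b || has s (third a b) || (has s a && has s b)

/-- The link between the two inner corners of the `i`-th piece of `G₁`. -/
def central (t : Fin 3 → St) (i : Fin 3) : Bool := conn (t i) (i + 1) (i + 2)

/-- A label for the component of the midpoint opposite to the corner `k`. -/
def midLab (t : Fin 3 → St) (k : Fin 3) : Fin 6 :=
  if k = 0 then 0
  else if k = 1 then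
    if central t 2 || (central t 0 && central t 1) then 0 else 1
  else
    if central t 1 || (central t 0 && central t 2) then 0
    else if central t 0 then 1 else 2

/-- A label for the component of the corner `i`. -/
def outLab (t : Fin 3 → St) (i : Fin 3) : Fin 6 :=
  if conn (t i) i (i + 1) then midLab t (third i (i + 1))
  else if conn (t i) i (i + 2) then midLab t (third i (i + 2))
  else 3 + i.castLE (by omega)

/-- A label for the component of the `a`-th corner of the `i`-th piece of `G₁`. -/
def lab (t : Fin 3 → St) (i a : Fin 3) : Fin 6 :=
  if i = a then outLab t i else midLab t (third i a)

/-- The path from `a` to `b` uses the pieces `a` and `b` only. -/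
def direct (t : Fin 3 → St) (a b : Fin 3) : Bool := conn (t a) a b && conn (t b) a b

/-- The state whose edges are given by three Booleans. -/
def mkSt (p q r : Bool) : St := (cond p 1 0) + (cond q 2 0) + (cond r 4 0)

/-- All pieces are forests, there is no cycle, and all vertices are connected to a corner. -/
def okGlue (t : Fin 3 → St) : Bool :=
  (t 0 != 7 && t 1 != 7 && t 2 != 7) &&
  !(central t 0 && central t 1 && central t 2) &&
  ((lab t 0 1 == lab t 0 0 || lab t 0 1 == lab t 1 1 || lab t 0 1 == lab t 2 2) &&
   (lab t 0 2 == lab t 0 0 || lab t 0 2 == lab t 1 1 || lab t 0 2 == lab t 2 2) &&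
   (lab t 1 2 == lab t 0 0 || lab t 1 2 == lab t 1 1 || lab t 1 2 == lab t 2 2))

/-- The local trace of a triple of states; the value `7` (a triangle) stands for failure. -/
def tau (t : Fin 3 → St) : St :=
  if okGlue t then
    if lab t 0 0 = lab t 1 1 ∧ lab t 0 0 = lab t 2 2 then
      mkSt (direct t 1 2) (direct t 0 2) (direct t 0 1)
    else mkSt (lab t 1 1 == lab t 2 2) (lab t 0 0 == lab t 2 2) (lab t 0 0 == lab t 1 1)
  else 7

/-- The pieces crossed by the path from `a` to `b`, with their entries and exits. -/
def route (t : Fin 3 → St) (a b : Fin 3) : List (Fin 3 × Fin 3 × Fin 3) :=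
  if direct t a b then [(a, a, b), (b, a, b)]
  else [(a, a, third a b), (third a b, a, b), (b, third a b, b)]

/-- Puts a statement about all triples into a form that the kernel can decide by running through the
512 explicit vectors. -/
theorem forall_triple {p : (Fin 3 → St) → Prop} (h : ∀ x y z : St, p ![x, y, z]) (t : Fin 3 → St) :
    p t := by
  have : t = ![t 0, t 1, t 2] := by
    funext i; fin_cases i <;> rfl
  rw [this]
  exact h _ _ _

theorem conn_self (s : St) (a : Fin 3) : conn s a a = true := by simp [conn]

theorem conn_symm : ∀ (s : St) (a b : Fin 3), conn s a b = conn s b a := by decide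

theorem conn_trans : ∀ (s : St) (a b c : Fin 3), conn s a b → conn s b c → conn s a c := by decide

theorem lab_link (t : Fin 3 → St) : ∀ i a b : Fin 3, conn (t i) a b → lab t i a = lab t i b :=
  forall_triple (p := fun t => ∀ i a b : Fin 3, conn (t i) a b → lab t i a = lab t i b)
    (by decide +kernel) t

theorem third_comm (a b : Fin 3) : third a b = third b a := by
  simp [third, add_comm]

theorem lab_swap (t : Fin 3 → St) (i j : Fin 3) : lab t i j = lab t j i := by
  unfold lab
  by_cases h : i = j
  · simp [h]
  · rw [if_neg h, if_neg (Ne.symm h), third_comm]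

/-- Besides a connection inside the piece, the only way between two of its corners is around the
central hole, through the central links of both other pieces. -/
theorem lab_eq_same (t : Fin 3 → St) : ∀ i a b : Fin 3, lab t i a = lab t i b →
    conn (t i) a b ∨ (central t (i + 1) ∧ central t (i + 2) ∧
      ((conn (t i) a (i + 1) ∧ conn (t i) (i + 2) b) ∨
        (conn (t i) a (i + 2) ∧ conn (t i) (i + 1) b))) :=
  forall_triple (p := fun t => ∀ i a b : Fin 3, lab t i a = lab t i b →
    conn (t i) a b ∨ (central t (i + 1) ∧ central t (i + 2) ∧
      ((conn (t i) a (i + 1) ∧ conn (t i) (i + 2) b) ∨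
        (conn (t i) a (i + 2) ∧ conn (t i) (i + 1) b)))) (by decide +kernel) t

theorem tau_ne_iff (t : Fin 3 → St) : tau t ≠ 7 ↔ (∀ i, t i ≠ 7) ∧ (∃ i, central t i = false) ∧
    ∀ i a, ∃ l, lab t i a = lab t l l :=
  forall_triple (p := fun t => tau t ≠ 7 ↔ (∀ i, t i ≠ 7) ∧ (∃ i, central t i = false) ∧
    ∀ i a, ∃ l, lab t i a = lab t l l) (by decide +kernel) t

theorem conn_tau (t : Fin 3 → St) : tau t ≠ 7 → ∀ i j, (conn (tau t) i j ↔ lab t i i = lab t j j) :=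
  forall_triple (p := fun t => tau t ≠ 7 →
    ∀ i j, (conn (tau t) i j ↔ lab t i i = lab t j j)) (by decide +kernel) t

/-- If all three corners are related, the state produced is $7$. So every graph has a connectivity
state, even before it is known to be a forest. -/
theorem exists_state (r : Fin 3 → Fin 3 → Prop) (hr : Equivalence r) :
    ∃ s : St, ∀ a b, r a b ↔ conn s a b := by
  classical
  have key : ∀ f : Fin 3 → Fin 3 → Bool, (∀ a, f a a) → (∀ a b, f a b = f b a) →
      (∀ a b c, f a b → f b c → f a c) → ∀ a b, f a b = conn (mkSt (f 1 2) (f 0 2) (f 0 1)) a b := by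
    intro f h1 h2 h3 a b
    have a1 := h2 1 0
    have a2 := h2 2 0
    have a3 := h2 2 1
    have b1 := h3 0 1 2
    have b2 := h3 0 2 1
    have b3 := h3 1 0 2
    rw [a1] at b3
    rw [a3] at b2
    have c0 := h1 0
    have c1 := h1 1
    have c2 := h1 2
    revert b1 b2 b3
    fin_cases a <;> fin_cases b <;> simp only [Fin.zero_eta, Fin.mk_one, Fin.reduceFinMk, a1, a2, a3, c0, c1, c2] <;>
      generalize f 1 2 = x <;> generalize f 0 2 = y <;> generalize f 0 1 = z <;> revert x y z <;> decide
  refine ⟨mkSt (decide (r 1 2)) (decide (r 0 2)) (decide (r 0 1)), fun a b => ?_⟩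
  rw [← key (fun a b => decide (r a b)) (by simpa using hr.refl)
    (fun a b => by simpa using ⟨hr.symm, hr.symm⟩)
    (fun a b c h1 h2 => by simp at *; exact hr.trans h1 h2)]
  simp

theorem route_valid (t : Fin 3 → St) : tau t ≠ 7 → ∀ a b, a ≠ b → conn (tau t) a b →
    ∀ x ∈ route t a b, x.2.1 ≠ x.2.2 ∧ conn (t x.1) x.2.1 x.2.2 :=
  forall_triple (p := fun t => tau t ≠ 7 → ∀ a b, a ≠ b → conn (tau t) a b →
    ∀ x ∈ route t a b, x.2.1 ≠ x.2.2 ∧ conn (t x.1) x.2.1 x.2.2) (by decide +kernel) t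

/-- The state is a spanning tree of `G₀`. -/
def isTree (s : St) : Bool := s == 3 || s == 5 || s == 6

theorem isTree_iff : ∀ s : St, isTree s ↔ s ≠ 7 ∧ ∀ a b, conn s a b := by decide

/-! ### Geometry of the gasket -/

/-- Barycentric coordinates with respect to the corners. -/
noncomputable def bary (k : Fin 3) (x : Plane) : ℝ :=
  ![1 - x 0 - x 1 / Real.sqrt 3, x 0 - x 1 / Real.sqrt 3, 2 * x 1 / Real.sqrt 3] k

theorem bary_sum (x : Plane) : bary 0 x + bary 1 x + bary 2 x = 1 := by
  simp [bary]; ring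

theorem bary_u (k i : Fin 3) : bary k (u i) = if k = i then 1 else 0 := by
  have h : Real.sqrt 3 ≠ 0 := by positivity
  fin_cases k <;> fin_cases i <;> simp [bary, u] <;> field_simp <;> norm_num

theorem bary_psi (k i : Fin 3) (x : Plane) :
    bary k (psi i x) = bary k x / 2 + (if k = i then 1 / 2 else 0) := by
  have h : Real.sqrt 3 ≠ 0 := by positivity
  fin_cases k <;> fin_cases i <;> simp [bary, u, psi] <;> field_simp <;> ring

theorem bary_ext {x y : Plane} (h : ∀ k, bary k x = bary k y) : x = y := by
  have h3 : Real.sqrt 3 ≠ 0 := by positivity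
  have h1 := h 1
  have h2 := h 2
  simp only [bary, Matrix.cons_val] at h1 h2
  have e1 : x 1 = y 1 := by
    field_simp at h2
    linarith
  have e0 : x 0 = y 0 := by rw [e1] at h1; linarith
  ext i
  fin_cases i
  · exact e0
  · exact e1

theorem continuous_bary (k : Fin 3) : Continuous (bary k) := by
  have : bary k = fun x => bary k x := rfl
  rw [this]
  fin_cases k <;> simp only [bary, Matrix.cons_val, Fin.zero_eta, Fin.mk_one, Fin.reduceFinMk] <;>
    fun_prop

/-- The full triangle. -/
def triangle : Set Plane := {x | ∀ k, 0 ≤ bary k x}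

theorem u_mem_triangle (i : Fin 3) : u i ∈ triangle := by
  intro k; rw [bary_u]; split_ifs <;> norm_num

theorem psi_mem_triangle {x : Plane} (hx : x ∈ triangle) (i : Fin 3) : psi i x ∈ triangle := by
  intro k; rw [bary_psi]; have := hx k; split_ifs <;> linarith

theorem VG_subset_triangle (n : ℕ) : VG n ⊆ triangle := by
  induction n with
  | zero => rintro _ ⟨i, rfl⟩; exact u_mem_triangle i
  | succ n ih =>
    intro x hx
    obtain ⟨i, y, hy, rfl⟩ := Set.mem_iUnion.1 hx
    exact psi_mem_triangle (ih hy) i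

theorem gasket_subset_triangle : gasket ⊆ triangle := by
  refine closure_minimal (Set.iUnion_subset VG_subset_triangle) ?_
  simp only [triangle, Set.ofPred_forall]
  exact isClosed_iInter fun k => isClosed_le continuous_const (continuous_bary k)

theorem eq_u_of_bary {x : Plane} (hx : x ∈ triangle) {j : Fin 3} (h : 1 ≤ bary j x) : x = u j := by
  have hs := bary_sum x
  have h0 := hx 0
  have h1 := hx 1
  have h2 := hx 2
  refine bary_ext fun k => ?_
  rw [bary_u]
  fin_cases j <;> fin_cases k <;> simp at * <;> linarith

theorem u_injective : Function.Injective u := by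
  intro i j h
  have h1 := bary_u i i
  rw [h, bary_u] at h1
  by_contra hij
  simp [hij] at h1

/-- The `j`-th barycentric coordinate is at most $1/2$ on the `i`-th piece and at least $1/2$ on the
`j`-th; equality forces both points to be corners. -/
theorem psi_eq_psi {x y : Plane} (hx : x ∈ triangle) (hy : y ∈ triangle) {i j : Fin 3} (hij : i ≠ j)
    (h : psi i x = psi j y) : x = u j ∧ y = u i := by
  have h1 : bary j (psi i x) = bary j (psi j y) := by rw [h]
  have h2 : bary i (psi i x) = bary i (psi j y) := by rw [h]
  rw [bary_psi, bary_psi] at h1 h2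
  simp only [hij, Ne.symm hij, if_true, if_false] at h1 h2
  have := hx i
  have := hy j
  exact ⟨eq_u_of_bary hx (by linarith), eq_u_of_bary hy (by linarith)⟩

theorem psi_eq_u {x : Plane} (hx : x ∈ triangle) {i j : Fin 3} (h : psi i x = u j) :
    i = j ∧ x = u j := by
  have h1 : bary j (psi i x) = bary j (u j) := by rw [h]
  rw [bary_psi, bary_u, if_pos rfl] at h1
  have hs := bary_sum x
  have h0 := hx 0
  have h01 := hx 1
  have h2 := hx 2
  have hle : bary j x ≤ 1 := by fin_cases j <;> simp <;> linarith
  split_ifs at h1 with hji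
  · exact ⟨hji.symm, eq_u_of_bary hx (by linarith)⟩
  · linarith

theorem psi_injective (i : Fin 3) : Function.Injective (psi i) := by
  intro x y h
  simpa [psi] using h

theorem continuous_psi (i : Fin 3) : Continuous (psi i) := by
  unfold psi; fun_prop

theorem psi_u_self (i : Fin 3) : psi i (u i) = u i := by simp [psi]

theorem psi_u_comm (i j : Fin 3) : psi i (u j) = psi j (u i) := by
  unfold psi; module

theorem psi_mem_gasket {x : Plane} (hx : x ∈ gasket) (i : Fin 3) : psi i x ∈ gasket := by
  rw [gasket_spec.2.2]
  exact Set.mem_iUnion.2 ⟨i, x, hx, rfl⟩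

theorem VG_subset_gasket (n : ℕ) : VG n ⊆ gasket :=
  (Set.subset_iUnion VG n).trans subset_closure

theorem u_mem_gasket (i : Fin 3) : u i ∈ gasket := VG_subset_gasket 0 ⟨i, rfl⟩

theorem psiWord_injective (w : List (Fin 3)) : Function.Injective (psiWord w) := by
  induction w with
  | nil => exact fun _ _ h => h
  | cons i w ih => exact fun x y h => ih (psi_injective i h)

theorem continuous_psiWord (w : List (Fin 3)) : Continuous (psiWord w) := by
  induction w with
  | nil => exact continuous_id
  | cons i w ih => exact (continuous_psi i).comp ih

theorem psiWord_mem_gasket {x : Plane} (hx : x ∈ gasket) (w : List (Fin 3)) :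
    psiWord w x ∈ gasket := by
  induction w with
  | nil => exact hx
  | cons i w ih => exact psi_mem_gasket ih i

theorem psiWord_append (v w : List (Fin 3)) (x : Plane) :
    psiWord (v ++ w) x = psiWord v (psiWord w x) := by
  induction v with
  | nil => rfl
  | cons i v ih => simp [psiWord, ih]

theorem dist_psi (i : Fin 3) (x y : Plane) : dist (psi i x) (psi i y) = (1 / 2) * dist x y := by
  simp only [psi, dist_add_right]
  rw [dist_smul₀, dist_sub_right]
  norm_num

theorem dist_psiWord (w : List (Fin 3)) (x y : Plane) :
    dist (psiWord w x) (psiWord w y) = (1 / 2) ^ w.length * dist x y := by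
  induction w with
  | nil => simp [psiWord]
  | cons i w ih => rw [psiWord, psiWord, dist_psi, ih, List.length_cons]; ring

theorem exists_dist_le : ∃ D : ℝ, 0 < D ∧ ∀ x ∈ gasket, ∀ y ∈ gasket, dist x y ≤ D := by
  obtain ⟨D, hD⟩ := Metric.isBounded_iff.1 gasket_spec.2.1.isBounded
  exact ⟨max D 1, by positivity, fun x hx y hy => (hD hx hy).trans (le_max_left _ _)⟩

theorem psiWord_eq_u {w : List (Fin 3)} {x : Plane} (hx : x ∈ gasket) {j : Fin 3}
    (h : psiWord w x = u j) : w = List.replicate w.length j ∧ x = u j := by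
  induction w with
  | nil => exact ⟨rfl, h⟩
  | cons i w ih =>
    obtain ⟨rfl, h2⟩ := psi_eq_u (gasket_subset_triangle (psiWord_mem_gasket hx w)) h
    obtain ⟨h3, h4⟩ := ih h2
    exact ⟨by rw [List.length_cons, List.replicate_succ, ← h3], h4⟩

/-- Two different parts of the same level have at most one point in common, and this point is a
corner of both parts. -/
theorem psiWord_eq_psiWord {v w : List (Fin 3)} (hl : v.length = w.length) (hne : v ≠ w)
    {x y : Plane} (hx : x ∈ gasket) (hy : y ∈ gasket) (h : psiWord v x = psiWord w y) :
    ∃ i j, x = u i ∧ y = u j ∧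
      ∀ x' ∈ gasket, ∀ y' ∈ gasket, psiWord v x' = psiWord w y' → x' = x ∧ y' = y := by
  induction v generalizing w with
  | nil =>
    cases w with
    | nil => exact absurd rfl hne
    | cons j w => simp at hl
  | cons i v ih =>
    cases w with
    | nil => simp at hl
    | cons j w =>
      by_cases hij : i = j
      · subst hij
        obtain ⟨a, b, h1, h2, h3⟩ := ih (w := w) (by simpa using hl) (by simpa using hne)
          (psi_injective _ h)
        exact ⟨a, b, h1, h2, fun x' hx' y' hy' h' => h3 x' hx' y' hy' (psi_injective _ h')⟩
      -- The first letters differ here, so any common point is the midpoint shared by the pieces `i`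
      -- and `j`, and `psiWord_eq_u` passes this corner down through the remaining letters.
      · have key : ∀ x' ∈ gasket, ∀ y' ∈ gasket, psiWord (i :: v) x' = psiWord (j :: w) y' →
            x' = u j ∧ y' = u i := by
          intro x' hx' y' hy' h'
          obtain ⟨h1, h2⟩ := psi_eq_psi (gasket_subset_triangle (psiWord_mem_gasket hx' v))
            (gasket_subset_triangle (psiWord_mem_gasket hy' w)) hij h'
          exact ⟨(psiWord_eq_u hx' h1).2, (psiWord_eq_u hy' h2).2⟩
        obtain ⟨h1, h2⟩ := key x hx y hy h
        refine ⟨j, i, h1, h2, fun x' hx' y' hy' h' => ?_⟩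
        rw [h1, h2]
        exact key x' hx' y' hy' h'

/-- A point belongs to at most two parts of the same level. -/
theorem eq_or_of_mem_parts {v w z : List (Fin 3)} (h1 : v.length = w.length)
    (h2 : v.length = z.length) {p : Plane} (hv : p ∈ psiWord v '' gasket)
    (hw : p ∈ psiWord w '' gasket) (hz : p ∈ psiWord z '' gasket) : v = w ∨ v = z ∨ w = z := by
  induction v generalizing w z p with
  | nil => left; exact (List.length_eq_zero_iff.1 h1.symm).symm
  | cons i v ih =>
    obtain _ | ⟨j, w⟩ := w
    · simp at h1
    obtain _ | ⟨k, z⟩ := z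
    · simp at h2
    simp only [List.length_cons, Nat.add_right_cancel_iff] at h1 h2
    obtain ⟨x, hx, rfl⟩ := hv
    obtain ⟨y, hy, hy'⟩ := hw
    obtain ⟨t, ht, ht'⟩ := hz
    -- If a point of the `i`-th piece also lies in another piece, it is a corner of the `i`-th
    -- piece. Only the part with the corresponding constant word contains it there, so the tails `v`
    -- and `z` agree.
    have key : ∀ {i j : Fin 3} {v w z : List (Fin 3)} {x y t : Plane}, x ∈ gasket → y ∈ gasket →
        t ∈ gasket → v.length = z.length → i ≠ j → psiWord (j :: w) y = psiWord (i :: v) x →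
        psiWord (i :: z) t = psiWord (i :: v) x → v = z := by
      intro i j v w z x y t hx hy ht hl hij e1 e2
      have e := (psi_eq_psi (gasket_subset_triangle (psiWord_mem_gasket hx v))
          (gasket_subset_triangle (psiWord_mem_gasket hy w)) hij e1.symm).1
      rw [(psiWord_eq_u hx e).1, (psiWord_eq_u ht ((psi_injective _ e2).trans e)).1, hl]
    by_cases hij : i = j
    · subst hij
      by_cases hik : i = k
      · subst hik
        rcases ih h1 h2 ⟨x, hx, rfl⟩ ⟨y, hy, psi_injective _ hy'⟩ ⟨t, ht, psi_injective _ ht'⟩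
          with h | h | h <;> simp [h]
      · left
        rw [key hx ht hy h1 hik ht' hy']
    · by_cases hik : i = k
      · subst hik
        right; left
        rw [key hx hy ht h2 hij hy' ht']
      · by_cases hjk : j = k
        · subst hjk
          right; right
          rw [key hy hx ht (h1.symm.trans h2) (Ne.symm hij) hy'.symm (ht'.trans hy'.symm)]
        · exfalso
          have e1 := (psi_eq_psi (gasket_subset_triangle (psiWord_mem_gasket hx v))
            (gasket_subset_triangle (psiWord_mem_gasket hy w)) hij hy'.symm).1
          have e2 := (psi_eq_psi (gasket_subset_triangle (psiWord_mem_gasket hx v))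
            (gasket_subset_triangle (psiWord_mem_gasket ht z)) hik ht'.symm).1
          exact hjk (u_injective (e1.symm.trans e2))

theorem mem_VG_iff {n : ℕ} {p : Plane} :
    p ∈ VG n ↔ ∃ w : List (Fin 3), w.length = n ∧ ∃ i, p = psiWord w (u i) := by
  induction n generalizing p with
  | zero =>
    constructor
    · rintro ⟨i, rfl⟩; exact ⟨[], rfl, i, rfl⟩
    · rintro ⟨w, hw, i, rfl⟩
      rw [List.length_eq_zero_iff.1 hw]
      exact ⟨i, rfl⟩
  | succ n ih =>
    constructor
    · intro h
      obtain ⟨i, y, hy, rfl⟩ := Set.mem_iUnion.1 h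
      obtain ⟨w, hw, j, rfl⟩ := ih.1 hy
      exact ⟨i :: w, by simp [hw], j, rfl⟩
    · rintro ⟨w, hw, j, rfl⟩
      obtain _ | ⟨i, w⟩ := w
      · simp at hw
      · exact Set.mem_iUnion.2 ⟨i, psiWord w (u j), ih.2 ⟨w, by simpa using hw, j, rfl⟩, rfl⟩

/-- A vertex of level `n` in a part of level `n` is a corner of this part. -/
theorem corner_of_mem {w : List (Fin 3)} {x : Plane} (hx : x ∈ gasket)
    (h : psiWord w x ∈ VG w.length) : ∃ i, x = u i := by
  obtain ⟨v, hv, j, hj⟩ := mem_VG_iff.1 h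
  by_cases hvw : w = v
  · subst hvw
    exact ⟨j, psiWord_injective _ hj⟩
  · obtain ⟨a, b, h1, -, -⟩ := psiWord_eq_psiWord hv.symm hvw hx (u_mem_gasket j) hj
    exact ⟨a, h1⟩

/-- By bisection, each half of the segment is the image of the whole under `psi i` or `psi j`. The
density of vertices obtained in this way puts straight edges into the gasket. -/
theorem exists_VG_dist_le (n : ℕ) (i j : Fin 3) (x : Plane) (hx : x ∈ segment ℝ (u i) (u j)) :
    ∃ y ∈ VG n, dist x y ≤ (1 / 2) ^ n * dist (u i) (u j) := by
  obtain ⟨t, ⟨ht0, ht1⟩, rfl⟩ := (segment_eq_image_lineMap ℝ (u i) (u j)) ▸ hx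
  clear hx
  induction n generalizing t with
  | zero =>
    refine ⟨u i, ⟨i, rfl⟩, ?_⟩
    rw [dist_lineMap_left, Real.norm_of_nonneg ht0]
    have := dist_nonneg (x := u i) (y := u j)
    nlinarith
  | succ n ih =>
    by_cases h : t ≤ 1 / 2
    · obtain ⟨y, hy, hd⟩ := ih (2 * t) (by linarith) (by linarith)
      refine ⟨psi i y, Set.mem_iUnion.2 ⟨i, y, hy, rfl⟩, ?_⟩
      have e : AffineMap.lineMap (u i) (u j) t = psi i (AffineMap.lineMap (u i) (u j) (2 * t)) := by
        simp only [psi, AffineMap.lineMap_apply_module]; module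
      rw [e, dist_psi, pow_succ]
      linarith
    · obtain ⟨y, hy, hd⟩ := ih (2 * t - 1) (by linarith) (by linarith)
      refine ⟨psi j y, Set.mem_iUnion.2 ⟨j, y, hy, rfl⟩, ?_⟩
      have e : AffineMap.lineMap (u i) (u j) t
          = psi j (AffineMap.lineMap (u i) (u j) (2 * t - 1)) := by
        simp only [psi, AffineMap.lineMap_apply_module]; module
      rw [e, dist_psi, pow_succ]
      linarith

theorem segment_subset_gasket (i j : Fin 3) : segment ℝ (u i) (u j) ⊆ gasket := by
  intro x hx
  rw [gasket, Metric.mem_closure_iff]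
  intro ε hε
  have hlim : Tendsto (fun n : ℕ => (1 / 2 : ℝ) ^ n * dist (u i) (u j)) atTop (𝓝 0) := by
    simpa using (tendsto_pow_atTop_nhds_zero_of_lt_one (by norm_num : (0 : ℝ) ≤ 1 / 2)
      (by norm_num)).mul_const (dist (u i) (u j))
  obtain ⟨n, hn⟩ := (hlim.eventually (gt_mem_nhds hε)).exists
  obtain ⟨y, hy, hd⟩ := exists_VG_dist_le n i j x hx
  exact ⟨y, Set.mem_iUnion.2 ⟨n, hy⟩, hd.trans_lt hn⟩

theorem lineMap_psi (i : Fin 3) (x y : Plane) (t : ℝ) :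
    AffineMap.lineMap (psi i x) (psi i y) t = psi i (AffineMap.lineMap x y t) := by
  simp only [psi, AffineMap.lineMap_apply_module]; module

theorem lineMap_psiWord (w : List (Fin 3)) (x y : Plane) (t : ℝ) :
    AffineMap.lineMap (psiWord w x) (psiWord w y) t = psiWord w (AffineMap.lineMap x y t) := by
  induction w with
  | nil => rfl
  | cons i w ih => rw [psiWord, psiWord, psiWord, lineMap_psi, ih]

/-! ### Edges of the Sierpinski graphs -/

theorem EG_ends {n : ℕ} {x y : Plane} (h : s(x, y) ∈ EG n) : x ∈ VG n ∧ y ∈ VG n ∧ x ≠ y := by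
  induction n generalizing x y with
  | zero =>
    obtain ⟨i, j, hij, h⟩ := h
    have hu := u_injective.ne hij
    rcases Sym2.eq_iff.1 h with ⟨rfl, rfl⟩ | ⟨rfl, rfl⟩
    · exact ⟨⟨i, rfl⟩, ⟨j, rfl⟩, hu⟩
    · exact ⟨⟨j, rfl⟩, ⟨i, rfl⟩, hu.symm⟩
  | succ n ih =>
    obtain ⟨i, e, he, h⟩ := Set.mem_iUnion.1 h
    induction e with | _ a b =>
    obtain ⟨ha, hb, hab⟩ := ih he
    have ha' : psi i a ∈ VG (n + 1) := Set.mem_iUnion.2 ⟨i, a, ha, rfl⟩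
    have hb' : psi i b ∈ VG (n + 1) := Set.mem_iUnion.2 ⟨i, b, hb, rfl⟩
    have hu := (psi_injective i).ne hab
    rw [Sym2.map_mk] at h
    rcases Sym2.eq_iff.1 h with ⟨rfl, rfl⟩ | ⟨rfl, rfl⟩
    · exact ⟨ha', hb', hu⟩
    · exact ⟨hb', ha', hu.symm⟩

theorem lineMap_mem_gasket_of_EG {n : ℕ} {x y : Plane} (h : s(x, y) ∈ EG n) {t : ℝ}
    (ht : t ∈ Set.Icc (0 : ℝ) 1) : AffineMap.lineMap x y t ∈ gasket := by
  induction n generalizing x y with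
  | zero =>
    obtain ⟨i, j, hij, h⟩ := h
    rcases Sym2.eq_iff.1 h with ⟨rfl, rfl⟩ | ⟨rfl, rfl⟩
    · exact segment_subset_gasket i j (by rw [segment_eq_image_lineMap]; exact ⟨t, ht, rfl⟩)
    · exact segment_subset_gasket j i (by rw [segment_eq_image_lineMap]; exact ⟨t, ht, rfl⟩)
  | succ n ih =>
    obtain ⟨i, e, he, h⟩ := Set.mem_iUnion.1 h
    induction e with | _ a b =>
    rw [Sym2.map_mk] at h
    rcases Sym2.eq_iff.1 h with ⟨rfl, rfl⟩ | ⟨rfl, rfl⟩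
    · rw [lineMap_psi]
      exact psi_mem_gasket (ih he) i
    · rw [lineMap_psi]
      exact psi_mem_gasket (ih (Sym2.eq_swap ▸ he)) i

theorem map_psi_injective (i : Fin 3) : Function.Injective (Sym2.map (psi i)) :=
  Sym2.map.injective (psi_injective i)

theorem EG_pieces {n : ℕ} {i j : Fin 3} {e e' : Sym2 Plane} (he : e ∈ EG n) (he' : e' ∈ EG n)
    (h : Sym2.map (psi i) e = Sym2.map (psi j) e') : i = j := by
  by_contra hij
  induction e with | _ a b =>
  induction e' with | _ c d =>
  obtain ⟨ha, hb, hab⟩ := EG_ends he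
  obtain ⟨hc, hd, hcd⟩ := EG_ends he'
  rw [Sym2.map_mk, Sym2.map_mk] at h
  have ht := VG_subset_triangle n
  rcases Sym2.eq_iff.1 h with ⟨h1, h2⟩ | ⟨h1, h2⟩
  · exact hab ((psi_eq_psi (ht ha) (ht hc) hij h1).1.trans
      (psi_eq_psi (ht hb) (ht hd) hij h2).1.symm)
  · exact hab ((psi_eq_psi (ht ha) (ht hd) hij h1).1.trans
      (psi_eq_psi (ht hb) (ht hc) hij h2).1.symm)

/-! ### Gluing three graphs -/

theorem reach_mono {f f' : Set (Sym2 Plane)} (h : f ⊆ f') {x y : Plane}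
    (hr : (gr f).Reachable x y) : (gr f').Reachable x y :=
  hr.mono (SimpleGraph.fromEdgeSet_mono h)

theorem gr_map_adj {f f' : Set (Sym2 Plane)} {i : Fin 3} (h : Sym2.map (psi i) '' f ⊆ f')
    {x y : Plane} (hr : (gr f).Adj x y) : (gr f').Adj (psi i x) (psi i y) := by
  rw [SimpleGraph.fromEdgeSet_adj] at hr ⊢
  exact ⟨h ⟨_, hr.1, Sym2.map_mk .. ⟩, (psi_injective i).ne hr.2⟩

theorem reach_map {f f' : Set (Sym2 Plane)} {i : Fin 3} (h : Sym2.map (psi i) '' f ⊆ f')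
    {x y : Plane} (hr : (gr f).Reachable x y) : (gr f').Reachable (psi i x) (psi i y) :=
  hr.map (⟨psi i, gr_map_adj h⟩ : gr f →g gr f')

/-- The union of three rescaled graphs. -/
def glue (g : Fin 3 → Set (Sym2 Plane)) : Set (Sym2 Plane) := ⋃ i, Sym2.map (psi i) '' g i

theorem subset_glue (g : Fin 3 → Set (Sym2 Plane)) (i : Fin 3) :
    Sym2.map (psi i) '' g i ⊆ glue g :=
  Set.subset_iUnion (fun i => Sym2.map (psi i) '' g i) i

theorem glue_subset_EG {n : ℕ} {g : Fin 3 → Set (Sym2 Plane)} (hg : ∀ i, g i ⊆ EG n) :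
    glue g ⊆ EG (n + 1) :=
  Set.iUnion_mono fun i => Set.image_mono (hg i)

/-- The states `t i` describe the connections between the corners in the graphs `g i`. -/
def Matches (g : Fin 3 → Set (Sym2 Plane)) (t : Fin 3 → St) : Prop :=
  ∀ i a b, (gr (g i)).Reachable (u a) (u b) ↔ conn (t i) a b

section Glue

variable {n : ℕ} {g : Fin 3 → Set (Sym2 Plane)} {t : Fin 3 → St}

/-- A walk is followed edge by edge. It can change pieces only at a common corner, whose labels in
the two pieces agree by `lab_swap`, and inside a piece labels are constant along connections by
`lab_link`. Acyclicity is not assumed, so the lemma also applies while acyclicity is being proved.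
-/
theorem reach_glue (hg : ∀ i, g i ⊆ EG n) (hm : Matches g t) {i j : Fin 3} {x y : Plane}
    (hx : x ∈ VG n) (hy : y ∈ VG n) (h : (gr (glue g)).Reachable (psi i x) (psi j y)) :
    (i = j ∧ (gr (g i)).Reachable x y) ∨
      ∃ a b, (gr (g i)).Reachable x (u a) ∧ lab t i a = lab t j b ∧
        (gr (g j)).Reachable (u b) y := by
  have ht := VG_subset_triangle n
  rw [SimpleGraph.reachable_iff_reflTransGen] at h
  generalize hq : psi j y = q at h
  induction h generalizing j y with
  | refl =>
    by_cases hij : i = j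
    · subst hij
      left
      exact ⟨rfl, by rw [psi_injective _ hq]⟩
    · right
      obtain ⟨h1, h2⟩ := psi_eq_psi (ht hy) (ht hx) (Ne.symm hij) hq
      subst h1 h2
      exact ⟨j, i, .refl _, lab_swap t i j, .refl _⟩
  | @tail q r _ hqr ih =>
    subst hq
    rw [SimpleGraph.fromEdgeSet_adj] at hqr
    obtain ⟨hqr, hne⟩ := hqr
    obtain ⟨l, e, he, hqr⟩ := Set.mem_iUnion.1 hqr
    induction e with | _ c d =>
    have hred : ∀ c d, s(c, d) ∈ g l → q = psi l c → psi j y = psi l d →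
      (i = j ∧ (gr (g i)).Reachable x y) ∨
      ∃ a b, (gr (g i)).Reachable x (u a) ∧ lab t i a = lab t j b ∧
        (gr (g j)).Reachable (u b) y := by
      clear he hqr c d
      intro c d he hc hd
      obtain ⟨hcV, hdV, hcd⟩ := EG_ends (hg l he)
      have hadj : (gr (g l)).Reachable c d :=
        SimpleGraph.Adj.reachable ((SimpleGraph.fromEdgeSet_adj _).2 ⟨he, hcd⟩)
      have step : (i = l ∧ (gr (g i)).Reachable x d) ∨
          ∃ a b, (gr (g i)).Reachable x (u a) ∧ lab t i a = lab t l b ∧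
            (gr (g l)).Reachable (u b) d := by
        rcases ih hcV hc.symm with ⟨rfl, h1⟩ | ⟨a, b, h1, h2, h3⟩
        · exact Or.inl ⟨rfl, h1.trans hadj⟩
        · exact Or.inr ⟨a, b, h1, h2, h3.trans hadj⟩
      by_cases hlj : l = j
      · subst hlj
        rw [psi_injective _ hd]
        exact step
      · obtain ⟨h1, h2⟩ := psi_eq_psi (ht hy) (ht hdV) (Ne.symm hlj) hd
        subst h1 h2
        right
        rcases step with ⟨rfl, h1⟩ | ⟨a, b, h1, h2, h3⟩
        · exact ⟨j, i, h1, lab_swap t i j, .refl _⟩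
        · exact ⟨a, l, h1, h2.trans ((lab_link t l b j ((hm l b j).1 h3)).trans (lab_swap t l j)),
            .refl _⟩
    rw [Sym2.map_mk] at hqr
    rcases Sym2.eq_iff.1 hqr with ⟨h1, h2⟩ | ⟨h1, h2⟩
    · exact hred c d he h1.symm h2.symm
    · exact hred d c (Sym2.eq_swap ▸ he) h2.symm h1.symm

theorem reach_of_lab (hm : Matches g t) {i a j b : Fin 3} (h : lab t i a = lab t j b) :
    (gr (glue g)).Reachable (psi i (u a)) (psi j (u b)) := by
  have hl : ∀ i a b, conn (t i) a b → (gr (glue g)).Reachable (psi i (u a)) (psi i (u b)) :=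
    fun i a b h => reach_map (subset_glue g i) ((hm i a b).2 h)
  have hc0 : central t 0 → (gr (glue g)).Reachable (psi 0 (u 1)) (psi 0 (u 2)) := hl 0 1 2
  have hc1 : central t 1 → (gr (glue g)).Reachable (psi 1 (u 2)) (psi 0 (u 1)) :=
    fun h => psi_u_comm 0 1 ▸ hl 1 2 0 h
  have hc2 : central t 2 → (gr (glue g)).Reachable (psi 0 (u 2)) (psi 1 (u 2)) :=
    fun h => psi_u_comm 0 2 ▸ psi_u_comm 1 2 ▸ hl 2 0 1 h
  -- A representative vertex for each label: the labels 0, 1, 2 stand for the midpoints opposite to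
  -- these corners, and `3 + i` for the corner `i` when it is linked to no midpoint.
  let rep : Fin 6 → Plane := ![psi 1 (u 2), psi 0 (u 2), psi 0 (u 1), u 0, u 1, u 2]
  have h0 : (gr (glue g)).Reachable (psi 1 (u 2)) (rep (midLab t 0)) := .refl _
  have h1 : (gr (glue g)).Reachable (psi 0 (u 2)) (rep (midLab t 1)) := by
    by_cases c2 : central t 2
    · simpa [midLab, c2, rep] using hc2 c2
    · by_cases c0 : central t 0
      · by_cases c1 : central t 1
        · simpa [midLab, c0, c1, rep] using (hc0 c0).symm.trans (hc1 c1).symm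
        · simp [midLab, c2, c1, rep]
      · simp [midLab, c2, c0, rep]
  have h2 : (gr (glue g)).Reachable (psi 0 (u 1)) (rep (midLab t 2)) := by
    by_cases c1 : central t 1
    · simpa [midLab, c1, rep] using (hc1 c1).symm
    · by_cases c0 : central t 0
      · by_cases c2 : central t 2
        · simpa [midLab, c0, c2, rep] using (hc0 c0).trans (hc2 c2)
        · simpa [midLab, c2, c1, c0, rep] using hc0 c0
      · simp [midLab, c1, c0, rep]
  have hmid : ∀ i a, i ≠ a →
      (gr (glue g)).Reachable (psi i (u a)) (rep (midLab t (third i a))) := by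
    intro i a hia
    fin_cases i <;> fin_cases a
    · exact absurd rfl hia
    · exact h2
    · exact h1
    · exact psi_u_comm 0 1 ▸ h2
    · exact absurd rfl hia
    · exact h0
    · exact psi_u_comm 0 2 ▸ h1
    · exact psi_u_comm 1 2 ▸ h0
    · exact absurd rfl hia
  have hout : ∀ i, (gr (glue g)).Reachable (psi i (u i)) (rep (outLab t i)) := by
    intro i
    unfold outLab
    split_ifs with e1 e2
    · exact (hl _ _ _ e1).trans (hmid i (i + 1) (by fin_cases i <;> decide))
    · exact (hl _ _ _ e2).trans (hmid i (i + 2) (by fin_cases i <;> decide))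
    · rw [psi_u_self]
      fin_cases i <;> exact .refl _
  have key : ∀ i a, (gr (glue g)).Reachable (psi i (u a)) (rep (lab t i a)) := by
    intro i a
    unfold lab
    split_ifs with e
    · subst e; exact hout i
    · exact hmid i a e
  exact (key i a).trans (h ▸ (key j b).symm)

theorem reach_glue_corners (hg : ∀ i, g i ⊆ EG n) (hm : Matches g t) {i a j b : Fin 3} :
    (gr (glue g)).Reachable (psi i (u a)) (psi j (u b)) ↔ lab t i a = lab t j b := by
  refine ⟨fun h => ?_, reach_of_lab hm⟩
  rcases reach_glue hg hm (u_mem_VG a n) (u_mem_VG b n) h with ⟨rfl, h1⟩ | ⟨a', b', h1, h2, h3⟩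
  · exact lab_link t i a b ((hm i a b).1 h1)
  · exact ((lab_link t i a a' ((hm i a a').1 h1)).trans h2).trans
      (lab_link t j b' b ((hm j b' b).1 h3))

theorem acyclic_iff {f : Set (Sym2 Plane)} (hf : ∀ x y, s(x, y) ∈ f → x ≠ y) :
    (gr f).IsAcyclic ↔ ∀ x y, s(x, y) ∈ f → ¬ (gr (f \ {s(x, y)})).Reachable x y := by
  have hd : ∀ x y, (gr f) \ SimpleGraph.fromEdgeSet {s(x, y)} = gr (f \ {s(x, y)}) := by
    intro x y
    rw [← SimpleGraph.fromEdgeSet_sdiff]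
  rw [SimpleGraph.isAcyclic_iff_forall_adj_isBridge]
  constructor
  · intro h x y hxy
    have := h ((SimpleGraph.fromEdgeSet_adj _).2 ⟨hxy, hf x y hxy⟩)
    rw [SimpleGraph.isBridge_iff] at this
    rw [← hd]
    simpa [SimpleGraph.deleteEdges] using this
  · intro h x y hxy
    rw [SimpleGraph.isBridge_iff]
    have := h x y ((SimpleGraph.fromEdgeSet_adj _).1 hxy).1
    rw [← hd] at this
    simpa [SimpleGraph.deleteEdges] using this

end Glue

theorem fin3_cases : ∀ i l : Fin 3, l = i ∨ l = i + 1 ∨ l = i + 2 := by decide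

theorem fin3_succ_ne : ∀ i : Fin 3, i + 1 ≠ i ∧ i + 2 ≠ i := by decide

theorem third_spec : ∀ i j : Fin 3, i ≠ j →
    third i (third i j) = j ∧ third (third i j) j = i ∧ i ≠ third i j ∧ third i j ≠ j := by decide

theorem eq_of_third_eq : ∀ a b i j : Fin 3, a ≠ b → i ≠ j → third a b = third i j →
    (a = i ∧ b = j) ∨ (a = j ∧ b = i) := by decide

/-- Paths in a forest are unique, so a path that exists in two disjoint edge sets has no edges. -/
theorem eq_of_reach_disjoint {f f₁ f₂ : Set (Sym2 Plane)} (hf : (gr f).IsAcyclic) (h₁ : f₁ ⊆ f)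
    (h₂ : f₂ ⊆ f) (hd : Disjoint f₁ f₂) {x y : Plane} (r₁ : (gr f₁).Reachable x y)
    (r₂ : (gr f₂).Reachable x y) : x = y := by
  obtain ⟨p₁, hp₁⟩ := r₁.exists_isPath
  obtain ⟨p₂, hp₂⟩ := r₂.exists_isPath
  have l₁ : gr f₁ ≤ gr f := SimpleGraph.fromEdgeSet_mono h₁
  have l₂ : gr f₂ ≤ gr f := SimpleGraph.fromEdgeSet_mono h₂
  have h := congrArg Subtype.val
    ((hf.subsingleton_path x y).elim ⟨p₁.mapLe l₁, hp₁.mapLe l₁⟩ ⟨p₂.mapLe l₂, hp₂.mapLe l₂⟩)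
  have he : p₁.edges = p₂.edges := by
    have := congrArg SimpleGraph.Walk.edges h
    simpa using this
  cases p₁ with
  | nil => rfl
  | cons ha p =>
    exfalso
    rename_i v
    have m₁ : s(x, v) ∈ (SimpleGraph.Walk.cons ha p).edges := by simp
    have m₂ := he ▸ m₁
    have n₁ := SimpleGraph.Walk.edges_subset_edgeSet _ m₁
    have n₂ := SimpleGraph.Walk.edges_subset_edgeSet _ m₂
    rw [SimpleGraph.mem_edgeSet, SimpleGraph.fromEdgeSet_adj] at n₁ n₂
    exact Set.disjoint_left.1 hd n₁.1 n₂.1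

section Glue

variable {n : ℕ} {g : Fin 3 → Set (Sym2 Plane)} {t : Fin 3 → St}

theorem exists_matches (g : Fin 3 → Set (Sym2 Plane)) : ∃ t, Matches g t := by
  choose t ht using fun i => exists_state (fun a b => (gr (g i)).Reachable (u a) (u b))
    ⟨fun _ => .refl _, fun h => h.symm, fun h h' => h.trans h'⟩
  exact ⟨t, ht⟩

/-- A cycle in the glued graph lies in one piece or runs around the central hole, and the latter
needs all three central links. -/
theorem acyclic_glue (hg : ∀ i, g i ⊆ EG n) (hm : Matches g t) (ha : ∀ i, (gr (g i)).IsAcyclic)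
    (hc : ∃ i, central t i = false) : (gr (glue g)).IsAcyclic := by
  have hne : ∀ {n : ℕ} {f : Set (Sym2 Plane)}, f ⊆ EG n → ∀ x y, s(x, y) ∈ f → x ≠ y :=
    fun hf x y h => (EG_ends (hf h)).2.2
  rw [acyclic_iff (hne (glue_subset_EG hg))]
  intro x' y' hxy' hr
  have hred : ∃ i x y, s(x, y) ∈ g i ∧ psi i x = x' ∧ psi i y = y' := by
    obtain ⟨i, e, he, h⟩ := Set.mem_iUnion.1 hxy'
    induction e with | _ x y =>
    rw [Sym2.map_mk] at h
    rcases Sym2.eq_iff.1 h with ⟨h1, h2⟩ | ⟨h1, h2⟩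
    · exact ⟨i, x, y, he, h1, h2⟩
    · exact ⟨i, y, x, Sym2.eq_swap ▸ he, h2, h1⟩
  obtain ⟨i, x, y, hxy, rfl, rfl⟩ := hred
  obtain ⟨hx, hy, hxyne⟩ := EG_ends (hg i hxy)
  have hni := (acyclic_iff (hne (hg i))).1 (ha i) x y hxy
  -- Acyclicity is tested by deleting one edge. The connections of the reduced graph are read off
  -- from new states `t'`, which can only have lost links in the piece `i`.
  let g' := Function.update g i (g i \ {s(x, y)})
  have hgi : g' i = g i \ {s(x, y)} := Function.update_self ..
  have hgj : ∀ j, j ≠ i → g' j = g j := fun j hj => Function.update_of_ne hj ..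
  have hgg : ∀ j, g' j ⊆ g j := by
    intro j
    by_cases hj : j = i
    · subst hj; rw [hgi]; exact Set.sdiff_subset
    · rw [hgj j hj]
  have hsub : glue g \ {s(psi i x, psi i y)} ⊆ glue g' := by
    rintro e ⟨he, hne⟩
    obtain ⟨j, e', he', rfl⟩ := Set.mem_iUnion.1 he
    refine Set.mem_iUnion.2 ⟨j, e', ?_, rfl⟩
    by_cases hj : j = i
    · subst hj
      rw [hgi]
      refine ⟨he', ?_⟩
      rintro rfl
      exact hne (Sym2.map_mk ..)
    · rwa [hgj j hj]
  obtain ⟨t', ht'⟩ := exists_matches g'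
  have hedge : (gr (g i)).Reachable x y :=
    SimpleGraph.Adj.reachable ((SimpleGraph.fromEdgeSet_adj _).2 ⟨hxy, hxyne⟩)
  have hcj : ∀ j, j ≠ i → central t' j → central t j := by
    intro j hj h
    have := (ht' j _ _).2 h
    rw [hgj j hj] at this
    exact (hm j _ _).1 this
  rcases reach_glue (fun j => (hgg j).trans (hg j)) ht' hx hy (reach_mono hsub hr) with
    ⟨-, h1⟩ | ⟨a, b, h1, h2, h3⟩
  · exact hni (hgi ▸ h1)
  · have hca : ∀ {j : Fin 3}, central t (i + 1) → central t (i + 2) → central t i → False := by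
      intro j h1 h2 h0
      obtain ⟨l, hl⟩ := hc
      rcases fin3_cases i l with rfl | rfl | rfl <;> simp_all
    -- Without the edge its ends are joined either inside the piece, contradicting acyclicity there,
    -- or around the hole. In the second case the edge itself completes the third central link.
    rcases lab_eq_same t' i a b h2 with h | ⟨c1, c2, h⟩
    · exact hni (hgi ▸ (h1.trans ((ht' i a b).2 h)).trans h3)
    · have c1' := hcj (i + 1) (fin3_succ_ne i).1 c1
      have c2' := hcj (i + 2) (fin3_succ_ne i).2 c2
      refine hca (j := i) c1' c2' ((hm i _ _).1 ?_)
      rcases h with ⟨e1, e2⟩ | ⟨e1, e2⟩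
      · have r1 := reach_mono (hgg i) (h1.trans ((ht' i _ _).2 e1))
        have r2 := reach_mono (hgg i) (((ht' i _ _).2 e2).trans h3)
        exact (r1.symm.trans hedge).trans r2.symm
      · have r1 := reach_mono (hgg i) (h1.trans ((ht' i _ _).2 e1))
        have r2 := reach_mono (hgg i) (((ht' i _ _).2 e2).trans h3)
        exact (r2.trans hedge.symm).trans r1

theorem acyclic_piece (ha : (gr (glue g)).IsAcyclic) (i : Fin 3) : (gr (g i)).IsAcyclic :=
  ha.comap (⟨psi i, gr_map_adj (subset_glue g i)⟩ : gr (g i) →g gr (glue g)) (psi_injective i)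

/-- Three central links would join two midpoints by two edge-disjoint connections: directly through
the piece 0, and through the pieces 1 and 2. -/
theorem exists_not_central (hg : ∀ i, g i ⊆ EG n) (hm : Matches g t)
    (ha : (gr (glue g)).IsAcyclic) : ∃ i, central t i = false := by
  by_contra! hc
  simp only [ne_eq, Bool.not_eq_false] at hc
  have hr : ∀ i, (gr (g i)).Reachable (u (i + 1)) (u (i + 2)) := fun i => (hm i _ _).2 (hc i)
  have h1 : (gr (Sym2.map (psi 0) '' g 0)).Reachable (psi 0 (u 1)) (psi 0 (u 2)) :=
    reach_map subset_rfl (hr 0)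
  have h2 : (gr (Sym2.map (psi 1) '' g 1 ∪ Sym2.map (psi 2) '' g 2)).Reachable
      (psi 0 (u 1)) (psi 0 (u 2)) := by
    rw [psi_u_comm 0 1, psi_u_comm 0 2]
    exact (reach_map Set.subset_union_left (hr 1).symm).trans
      (psi_u_comm 1 2 ▸ reach_map Set.subset_union_right (hr 2).symm)
  have hd : Disjoint (Sym2.map (psi 0) '' g 0)
      (Sym2.map (psi 1) '' g 1 ∪ Sym2.map (psi 2) '' g 2) := by
    rw [Set.disjoint_left]
    rintro _ ⟨e, he, rfl⟩ (⟨e', he', h⟩ | ⟨e', he', h⟩)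
    · exact absurd (EG_pieces (hg _ he') (hg _ he) h) (by decide)
    · exact absurd (EG_pieces (hg _ he') (hg _ he) h) (by decide)
  have := eq_of_reach_disjoint ha (subset_glue g 0)
    (Set.union_subset (subset_glue g 1) (subset_glue g 2)) hd h1 h2
  exact absurd (u_injective (psi_injective 0 this)) (by decide)

end Glue

/-! ### Configurations -/

/-- The subgraph of `G₀` coded by a state. -/
def decSt (s : St) : Set (Sym2 Plane) :=
  {e | ∃ i j, i ≠ j ∧ has s (third i j) ∧ e = s(u i, u j)}

/-- Codes of spanning subgraphs of `Gₙ`: a state for each `n`-part. -/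
def Cfg : ℕ → Type
  | 0 => St
  | n + 1 => Fin 3 → Cfg n

/-- The state of a configuration after `n` applications of the trace. -/
def root : (n : ℕ) → Cfg n → St
  | 0, s => s
  | n + 1, ρ => tau fun i => root n (ρ i)

/-- The edge set of the spanning subgraph coded by a configuration. -/
def dec : (n : ℕ) → Cfg n → Set (Sym2 Plane)
  | 0, s => decSt s
  | n + 1, ρ => glue fun i => dec n (ρ i)

theorem decSt_subset (s : St) : decSt s ⊆ EG 0 := by
  rintro _ ⟨i, j, hij, -, rfl⟩
  exact ⟨i, j, hij, rfl⟩

theorem dec_subset : ∀ (n : ℕ) (ρ : Cfg n), dec n ρ ⊆ EG n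
  | 0, s => decSt_subset s
  | n + 1, ρ => glue_subset_EG fun i => dec_subset n (ρ i)

theorem mem_decSt {s : St} {i j : Fin 3} :
    s(u i, u j) ∈ decSt s ↔ i ≠ j ∧ has s (third i j) := by
  constructor
  · rintro ⟨a, b, hab, h, he⟩
    rcases Sym2.eq_iff.1 he with ⟨h1, h2⟩ | ⟨h1, h2⟩
    · rw [u_injective h1, u_injective h2]; exact ⟨hab, h⟩
    · rw [u_injective h1, u_injective h2, third_comm]; exact ⟨hab.symm, h⟩
  · rintro ⟨hij, h⟩
    exact ⟨i, j, hij, h, rfl⟩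

theorem reach_decSt (s : St) (i j : Fin 3) :
    (gr (decSt s)).Reachable (u i) (u j) ↔ conn s i j := by
  have hadj : ∀ i j, i ≠ j → has s (third i j) → (gr (decSt s)).Reachable (u i) (u j) :=
    fun i j hij h => SimpleGraph.Adj.reachable ((SimpleGraph.fromEdgeSet_adj _).2
      ⟨mem_decSt.2 ⟨hij, h⟩, u_injective.ne hij⟩)
  constructor
  · intro h
    rw [SimpleGraph.reachable_iff_reflTransGen] at h
    suffices H : ∀ q, Relation.ReflTransGen (gr (decSt s)).Adj (u i) q →
        ∃ k, q = u k ∧ conn s i k by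
      obtain ⟨k, hk, hc⟩ := H _ h
      rwa [u_injective hk]
    intro q hq
    induction hq with
    | refl => exact ⟨i, rfl, conn_self s i⟩
    | tail _ hqr ih =>
      obtain ⟨k, rfl, hk⟩ := ih
      obtain ⟨⟨a, b, hab, h, he⟩, -⟩ := (SimpleGraph.fromEdgeSet_adj _).1 hqr
      rcases Sym2.eq_iff.1 he with ⟨h1, rfl⟩ | ⟨h1, rfl⟩
      · refine ⟨b, rfl, conn_trans s i k b hk ?_⟩
        rw [u_injective h1]
        simp [conn, h]
      · refine ⟨a, rfl, conn_trans s i k a hk ?_⟩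
        rw [u_injective h1, conn_symm]
        simp [conn, h]
  · intro h
    by_cases hij : i = j
    · rw [hij]
    · by_cases h1 : has s (third i j)
      · exact hadj i j hij h1
      · have h2 : has s i ∧ has s j := by simpa [conn, hij, h1] using h
        have e := third_spec i j hij
        exact (hadj i (third i j) e.2.2.1 (e.1.symm ▸ h2.2)).trans
          (hadj (third i j) j e.2.2.2 (e.2.1.symm ▸ h2.1))

theorem exists_clear : ∀ (s : St) (k : Fin 3), ∃ s' : St, (∀ l, l ≠ k → has s' l = has s l) ∧
    (s ≠ 7 → has s k → ∀ i j, i ≠ j → third i j = k → ¬ conn s' i j) ∧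
    (s = 7 → ∀ i j, conn s' i j) ∧ has s' k = false := by decide +kernel

theorem acyclic_decSt (s : St) : (gr (decSt s)).IsAcyclic ↔ s ≠ 7 := by
  have hne : ∀ x y, s(x, y) ∈ decSt s → x ≠ y := fun x y h => (EG_ends (decSt_subset s h)).2.2
  rw [acyclic_iff hne]
  constructor
  · rintro h rfl
    obtain ⟨s', h1, -, h2, h3⟩ := exists_clear 7 (third 0 1)
    refine h (u 0) (u 1) (mem_decSt.2 (by decide)) (reach_mono ?_ ((reach_decSt s' 0 1).2 (h2 rfl 0 1)))
    rintro _ ⟨i, j, hij, hs, rfl⟩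
    have hk : third i j ≠ third 0 1 := by rintro e; rw [e, h3] at hs; cases hs
    refine ⟨mem_decSt.2 ⟨hij, h1 _ hk ▸ hs⟩, fun he => hk ?_⟩
    rcases Sym2.eq_iff.1 he with ⟨h1, h2⟩ | ⟨h1, h2⟩
    · rw [u_injective h1, u_injective h2]
    · rw [u_injective h1, u_injective h2, third_comm]
  · rintro hs x y ⟨i, j, hij, hh, he⟩ hr
    obtain ⟨s', h1, h2, -, -⟩ := exists_clear s (third i j)
    have hsub : decSt s \ {s(x, y)} ⊆ decSt s' := by
      rintro _ ⟨⟨a, b, hab, h, rfl⟩, hne⟩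
      refine mem_decSt.2 ⟨hab, ?_⟩
      rw [h1]
      · exact h
      · intro hk
        apply hne
        rw [he]
        rcases eq_of_third_eq a b i j hab hij hk with ⟨rfl, rfl⟩ | ⟨rfl, rfl⟩
        · rfl
        · exact Sym2.eq_swap
    have hr' := reach_mono hsub hr
    rcases Sym2.eq_iff.1 he with ⟨rfl, rfl⟩ | ⟨rfl, rfl⟩
    · exact h2 hs hh i j hij rfl ((reach_decSt s' i j).1 hr')
    · exact h2 hs hh i j hij rfl ((reach_decSt s' i j).1 hr'.symm)

/-- A configuration codes a spanning forest each of whose components contains a corner if and only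
if its root is a forest, and in this case the root tells which corners are connected. -/
theorem root_spec : ∀ (n : ℕ) (ρ : Cfg n),
    (root n ρ ≠ 7 ↔ (gr (dec n ρ)).IsAcyclic ∧
      ∀ x ∈ VG n, ∃ i, (gr (dec n ρ)).Reachable x (u i)) ∧
    (root n ρ ≠ 7 → ∀ i j, (gr (dec n ρ)).Reachable (u i) (u j) ↔ conn (root n ρ) i j)
  | 0, s => by
    refine ⟨⟨fun h => ⟨(acyclic_decSt s).2 h, ?_⟩, fun h => (acyclic_decSt s).1 h.1⟩,
      fun _ => reach_decSt s⟩
    rintro _ ⟨i, rfl⟩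
    exact ⟨i, .refl _⟩
  | n + 1, ρ => by
    have hg : ∀ i, dec n (ρ i) ⊆ EG n := fun i => dec_subset n (ρ i)
    have hM : (∀ i, root n (ρ i) ≠ 7) →
        Matches (fun i => dec n (ρ i)) (fun i => root n (ρ i)) :=
      fun h i => (root_spec n (ρ i)).2 (h i)
    have htau := tau_ne_iff fun i => root n (ρ i)
    have hback : (gr (dec (n + 1) ρ)).IsAcyclic ∧
        (∀ x ∈ VG (n + 1), ∃ i, (gr (dec (n + 1) ρ)).Reachable x (u i)) → root (n + 1) ρ ≠ 7 := by
      rintro ⟨ha, hv⟩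
      have h7 : ∀ i, root n (ρ i) ≠ 7 := by
        intro i
        refine (root_spec n (ρ i)).1.2
          ⟨acyclic_piece (g := fun i => dec n (ρ i)) ha i, fun x hx => ?_⟩
        obtain ⟨l, hl⟩ := hv (psi i x) (Set.mem_iUnion.2 ⟨i, x, hx, rfl⟩)
        -- A connection to a corner of the whole graph leaves the piece through one of the corners
        -- of the piece. Auxiliary states are needed, because the roots describe connections only
        -- once they are known not to be `7`.
        obtain ⟨t, ht⟩ := exists_matches fun i => dec n (ρ i)
        rw [← psi_u_self l] at hl
        rcases reach_glue hg ht hx (u_mem_VG l n) hl with ⟨rfl, h1⟩ | ⟨a, b, h1, -, -⟩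
        · exact ⟨_, h1⟩
        · exact ⟨_, h1⟩
      refine htau.2 ⟨h7, exists_not_central hg (hM h7) ha, fun i a => ?_⟩
      obtain ⟨l, hl⟩ := hv (psi i (u a)) (Set.mem_iUnion.2 ⟨i, u a, u_mem_VG a n, rfl⟩)
      rw [← psi_u_self l] at hl
      exact ⟨l, (reach_glue_corners hg (hM h7)).1 hl⟩
    refine ⟨⟨fun h => ?_, hback⟩, fun h i j => ?_⟩
    · obtain ⟨h7, hc, hl⟩ := htau.1 h
      refine ⟨acyclic_glue hg (hM h7) (fun i => ((root_spec n (ρ i)).1.1 (h7 i)).1) hc, ?_⟩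
      intro x hx
      obtain ⟨i, y, hy, rfl⟩ := Set.mem_iUnion.1 hx
      obtain ⟨a, ha⟩ := ((root_spec n (ρ i)).1.1 (h7 i)).2 y hy
      obtain ⟨l, hl⟩ := hl i a
      have h1 := (reach_map (subset_glue (fun i => dec n (ρ i)) i) ha).trans
        (reach_of_lab (hM h7) hl)
      rw [psi_u_self] at h1
      exact ⟨l, h1⟩
    · obtain ⟨h7, -, -⟩ := htau.1 h
      rw [root, conn_tau _ h, ← reach_glue_corners hg (hM h7), psi_u_self, psi_u_self]
      rfl

theorem mem_glue_iff {n : ℕ} {g : Fin 3 → Set (Sym2 Plane)} (hg : ∀ i, g i ⊆ EG n) {i : Fin 3}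
    {e : Sym2 Plane} (he : e ∈ EG n) : Sym2.map (psi i) e ∈ glue g ↔ e ∈ g i := by
  constructor
  · intro h
    obtain ⟨j, e', he', h⟩ := Set.mem_iUnion.1 h
    obtain rfl := EG_pieces (hg j he') he h
    rwa [← map_psi_injective _ h]
  · exact fun h => subset_glue g i ⟨e, h, rfl⟩

theorem has_ext : ∀ s s' : St, (∀ k, has s k = has s' k) → s = s' := by decide

theorem third_succ : ∀ k : Fin 3, third (k + 1) (k + 2) = k ∧ k + 1 ≠ k + 2 := by decide

theorem dec_injective : ∀ n : ℕ, Function.Injective (dec n)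
  | 0, s, s', h => by
    refine has_ext s s' fun k => ?_
    have h1 := mem_decSt (s := s) (i := k + 1) (j := k + 2)
    have h2 := mem_decSt (s := s') (i := k + 1) (j := k + 2)
    have h : decSt s = decSt s' := h
    rw [h, h2, (third_succ k).1] at h1
    have := (third_succ k).2
    simp only [ne_eq, this, not_false_eq_true, true_and] at h1
    exact (Bool.eq_iff_iff.2 h1).symm
  | n + 1, ρ, ρ', h => by
    funext i
    refine dec_injective n (Set.ext fun e => ?_)
    have key : ∀ ρ : Cfg (n + 1), e ∈ dec n (ρ i) ↔ e ∈ EG n ∧ Sym2.map (psi i) e ∈ dec (n + 1) ρ := by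
      intro ρ
      constructor
      · exact fun he => ⟨dec_subset n _ he,
          (mem_glue_iff (fun i => dec_subset n (ρ i)) (dec_subset n _ he)).2 he⟩
      · exact fun he => (mem_glue_iff (fun i => dec_subset n (ρ i)) he.1).1 he.2
    rw [key ρ, key ρ', h]

theorem has_mkSt : ∀ p q r : Bool, has (mkSt p q r) 0 = p ∧ has (mkSt p q r) 1 = q ∧
    has (mkSt p q r) 2 = r := by decide

theorem exists_has (p : Fin 3 → Prop) : ∃ s : St, ∀ k, has s k ↔ p k := by
  classical
  refine ⟨mkSt (p 0) (p 1) (p 2), fun k => ?_⟩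
  obtain ⟨h0, h1, h2⟩ := has_mkSt (p 0) (p 1) (p 2)
  fin_cases k <;> simp_all

theorem dec_surjective : ∀ (n : ℕ) (f : Set (Sym2 Plane)), f ⊆ EG n → ∃ ρ : Cfg n, dec n ρ = f
  | 0, f, hf => by
    obtain ⟨s, hs⟩ := exists_has fun k => s(u (k + 1), u (k + 2)) ∈ f
    refine ⟨s, Set.ext fun e => ?_⟩
    have key : ∀ i j, i ≠ j → (s(u i, u j) ∈ f ↔ has s (third i j)) := by
      intro i j hij
      rw [hs]
      rcases eq_of_third_eq i j _ _ hij (third_succ (third i j)).2 (third_succ _).1.symm with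
        ⟨h1, h2⟩ | ⟨h1, h2⟩
      · rw [← h1, ← h2]
      · rw [← h1, ← h2, Sym2.eq_swap]
    constructor
    · rintro ⟨i, j, hij, h, rfl⟩
      exact (key i j hij).2 h
    · intro he
      obtain ⟨i, j, hij, rfl⟩ := hf he
      exact ⟨i, j, hij, (key i j hij).1 he, rfl⟩
  | n + 1, f, hf => by
    choose ρ hρ using fun i : Fin 3 => dec_surjective n {e | e ∈ EG n ∧ Sym2.map (psi i) e ∈ f}
      fun e he => he.1
    refine ⟨ρ, Set.ext fun e => ?_⟩
    constructor
    · intro he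
      obtain ⟨i, e', he', rfl⟩ := Set.mem_iUnion.1 he
      have he' : e' ∈ dec n (ρ i) := he'
      rw [hρ] at he'
      exact he'.2
    · intro he
      obtain ⟨i, e', he', rfl⟩ := Set.mem_iUnion.1 (hf he)
      refine Set.mem_iUnion.2 ⟨i, e', ?_, rfl⟩
      show e' ∈ dec n (ρ i)
      rw [hρ]
      exact ⟨he', he⟩

theorem isSpanningTree_dec {n : ℕ} {ρ : Cfg n} :
    IsSpanningTree n (dec n ρ) ↔ isTree (root n ρ) := by
  obtain ⟨h1, h2⟩ := root_spec n ρ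
  rw [isTree_iff]
  constructor
  · rintro ⟨⟨-, ha⟩, hr⟩
    have h7 : root n ρ ≠ 7 := h1.2 ⟨ha, fun x hx => ⟨0, hr x hx _ (u_mem_VG 0 n)⟩⟩
    exact ⟨h7, fun a b => (h2 h7 a b).1 (hr _ (u_mem_VG a n) _ (u_mem_VG b n))⟩
  · rintro ⟨h7, hc⟩
    refine ⟨⟨dec_subset n ρ, (h1.1 h7).1⟩, fun x hx y hy => ?_⟩
    obtain ⟨a, ha⟩ := (h1.1 h7).2 x hx
    obtain ⟨b, hb⟩ := (h1.1 h7).2 y hy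
    exact (ha.trans ((h2 h7 a b).2 (hc a b))).trans hb.symm

/-- The code of a spanning tree. -/
noncomputable def code {n : ℕ} (t : SpanTree n) : Cfg n := (dec_surjective n t.1 t.2.1.1).choose

theorem dec_code {n : ℕ} (t : SpanTree n) : dec n (code t) = t.1 :=
  (dec_surjective n t.1 t.2.1.1).choose_spec

theorem isTree_code {n : ℕ} (t : SpanTree n) : isTree (root n (code t)) :=
  isSpanningTree_dec.1 (by rw [dec_code]; exact t.2)

/-- Spanning trees correspond to configurations whose root is a tree. -/
noncomputable def codeEquiv (n : ℕ) : SpanTree n ≃ {ρ : Cfg n // isTree (root n ρ)} where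
  toFun t := ⟨code t, isTree_code t⟩
  invFun ρ := ⟨dec n ρ.1, isSpanningTree_dec.2 ρ.2⟩
  left_inv t := Subtype.ext (dec_code t)
  right_inv ρ := Subtype.ext (dec_injective n
    (dec_code (⟨dec n ρ.1, isSpanningTree_dec.2 ρ.2⟩ : SpanTree n)))

/-! ### Traces of configurations -/

/-- The trace of a configuration. -/
def tr : (n : ℕ) → Cfg (n + 1) → Cfg n
  | 0, ρ => tau ρ
  | n + 1, ρ => fun i => tr n (ρ i)

/-- The trace applies `tau` to the finest parts, which is just the first stage of computing the
root. -/
theorem root_tr : ∀ (n : ℕ) (ρ : Cfg (n + 1)), root n (tr n ρ) = root (n + 1) ρ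
  | 0, ρ => rfl
  | n + 1, ρ => by
    rw [root, root]
    exact congrArg tau (funext fun i => root_tr n (ρ i))

/-- Replacing the third piece by the empty state `0` leaves only connections through the pieces `i`
and `j`. So directness becomes a question about labels, to which the gluing lemmas apply. -/
theorem direct_iff_lab (t : Fin 3 → St) : ∀ i j, i ≠ j →
    (direct t i j ↔ lab (fun k => if k = i ∨ k = j then t k else 0) i i =
      lab (fun k => if k = i ∨ k = j then t k else 0) j j) :=
  forall_triple (p := fun t => ∀ i j, i ≠ j →
    (direct t i j ↔ lab (fun k => if k = i ∨ k = j then t k else 0) i i =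
      lab (fun k => if k = i ∨ k = j then t k else 0) j j)) (by decide +kernel) t

theorem decSt_zero : decSt 0 = ∅ := by
  ext e
  constructor
  · rintro ⟨i, j, hij, h, -⟩
    have : ∀ k, has 0 k = false := by decide
    rw [this] at h
    cases h
  · exact fun h => h.elim

theorem direct_iff_reach (t : Fin 3 → St) {i j : Fin 3} (hij : i ≠ j) :
    direct t i j ↔ (gr (Sym2.map (psi i) '' decSt (t i) ∪ Sym2.map (psi j) '' decSt (t j))).Reachable
      (u i) (u j) := by
  rw [direct_iff_lab t i j hij,
    ← reach_glue_corners (n := 0) (g := fun k => decSt (if k = i ∨ k = j then t k else 0))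
      (fun k => decSt_subset _) (fun k => reach_decSt _), psi_u_self, psi_u_self]
  have : glue (fun k => decSt (if k = i ∨ k = j then t k else 0)) =
      Sym2.map (psi i) '' decSt (t i) ∪ Sym2.map (psi j) '' decSt (t j) := by
    ext e
    constructor
    · intro he
      obtain ⟨k, he⟩ := Set.mem_iUnion.1 he
      by_cases hi : k = i
      · subst hi; left; simpa using he
      · by_cases hj : k = j
        · subst hj; right; simpa using he
        · simp [hi, hj, decSt_zero] at he
    · rintro (he | he)
      · exact Set.mem_iUnion.2 ⟨i, by simpa using he⟩
      · exact Set.mem_iUnion.2 ⟨j, by simpa using he⟩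
  rw [this]

/-- By uniqueness of paths in a forest, the condition on paths in `IsTreeOfType` becomes mere
reachability in a subgraph. -/
theorem edges_subset_iff_reach {f f' : Set (Sym2 Plane)} (hf : (gr f).IsAcyclic) (h : f' ⊆ f)
    {x y : Plane} (hr : (gr f).Reachable x y) :
    (∀ p : (gr f).Walk x y, p.IsPath → ∀ e ∈ p.edges, e ∈ f') ↔ (gr f').Reachable x y := by
  constructor
  · intro hp
    obtain ⟨p, hpp⟩ := hr.exists_isPath
    refine ⟨p.transfer (gr f') fun e he => ?_⟩
    rw [SimpleGraph.edgeSet_fromEdgeSet]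
    refine ⟨hp p hpp e he, ?_⟩
    have := SimpleGraph.Walk.edges_subset_edgeSet p he
    rw [SimpleGraph.edgeSet_fromEdgeSet] at this
    exact this.2
  · intro hr' p hp e he
    obtain ⟨q, hq⟩ := hr'.exists_isPath
    have l : gr f' ≤ gr f := SimpleGraph.fromEdgeSet_mono h
    have := congrArg Subtype.val ((hf.subsingleton_path x y).elim ⟨p, hp⟩ ⟨q.mapLe l, hq.mapLe l⟩)
    have hpq : p = q.mapLe l := this
    rw [hpq, SimpleGraph.Walk.edges_mapLe_eq_edges] at he
    have := SimpleGraph.Walk.edges_subset_edgeSet q he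
    rw [SimpleGraph.edgeSet_fromEdgeSet] at this
    exact this.1

/-- The right-hand side expresses the two clauses of `traceOne` by states: an edge of a tree starts
from the corner that gives the type, and an edge of a forest with two components joins the two
connected corners. -/
theorem has_tau_iff (t : Fin 3 → St) : tau t ≠ 7 → ∀ a b, a ≠ b → (has (tau t) (third a b) ↔
    (isTree (tau t) ∧ ((∀ j, j ≠ a → direct t a j) ∨ (∀ j, j ≠ b → direct t b j))) ∨
    ((∀ j, j ≠ third a b → ¬ conn (tau t) (third a b) j) ∧ conn (tau t) a b)) :=
  forall_triple (p := fun t => tau t ≠ 7 → ∀ a b, a ≠ b → (has (tau t) (third a b) ↔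
    (isTree (tau t) ∧ ((∀ j, j ≠ a → direct t a j) ∨ (∀ j, j ≠ b → direct t b j))) ∨
    ((∀ j, j ≠ third a b → ¬ conn (tau t) (third a b) j) ∧ conn (tau t) a b)))
    (by decide +kernel) t

theorem eq_or_of_ne_third : ∀ a b j : Fin 3, a ≠ b → j ≠ third a b → j = a ∨ j = b := by decide

theorem eq_third : ∀ i j k : Fin 3, j ≠ i → k ≠ i → j ≠ k → third j k = i := by decide

/-- The bridge from the geometric trace to the table `tau`. Each class of forests in the definition
is translated into a condition on states. -/
theorem traceOne_glue {t : Fin 3 → St} (ht : tau t ≠ 7) :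
    traceOne (glue fun i => decSt (t i)) = decSt (tau t) := by
  have hs := root_spec 1 (t : Cfg 1)
  have hdec : dec 1 (t : Cfg 1) = glue fun i => decSt (t i) := rfl
  have hroot : root 1 (t : Cfg 1) = tau t := rfl
  rw [hdec, hroot] at hs
  obtain ⟨h1, h2⟩ := hs
  obtain ⟨ha, hv⟩ := h1.1 ht
  have h2 := h2 ht
  have hsp : IsSpanningTree 1 (glue fun i => decSt (t i)) ↔ isTree (tau t) :=
    isSpanningTree_dec (n := 1) (ρ := (t : Cfg 1))
  have htype : ∀ i, IsTreeOfType 0 i (glue fun i => decSt (t i)) ↔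
      isTree (tau t) ∧ ∀ j, j ≠ i → direct t i j := by
    intro i
    rw [IsTreeOfType, hsp]
    refine and_congr_right fun hT => forall_congr' fun j => forall_congr' fun hj => ?_
    have hc := ((isTree_iff _).1 hT).2
    rw [direct_iff_reach t (Ne.symm hj),
      ← edges_subset_iff_reach ha
        (Set.union_subset (subset_glue (fun i => decSt (t i)) i) (subset_glue (fun i => decSt (t i)) j))
        ((h2 i j).2 (hc i j))]
    refine forall_congr' fun p => forall_congr' fun _ => forall_congr' fun e =>
      forall_congr' fun he => ?_
    have hef : e ∈ glue fun i => decSt (t i) := by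
      have := SimpleGraph.Walk.edges_subset_edgeSet p he
      rw [SimpleGraph.edgeSet_fromEdgeSet] at this
      exact this.1
    constructor
    · rintro (⟨e', he', rfl⟩ | ⟨e', he', rfl⟩)
      · exact Or.inl ⟨e', (mem_glue_iff (fun i => decSt_subset (t i)) he').1 hef, rfl⟩
      · exact Or.inr ⟨e', (mem_glue_iff (fun i => decSt_subset (t i)) he').1 hef, rfl⟩
    · exact fun h => h.imp (fun h => Set.image_mono (decSt_subset _) h)
        fun h => Set.image_mono (decSt_subset _) h
  have htwo : ∀ i, IsTwoForest 1 i (glue fun i => decSt (t i)) ↔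
      (∀ j, j ≠ i → ¬ conn (tau t) i j) ∧ ∀ j k, j ≠ i → k ≠ i → conn (tau t) j k := by
    intro i
    rw [IsTwoForest]
    constructor
    · rintro ⟨-, e1, e2, -⟩
      exact ⟨fun j hj h => e1 j hj ((h2 i j).2 h), fun j k hj hk => (h2 j k).1 (e2 j k hj hk)⟩
    · rintro ⟨e1, e2⟩
      refine ⟨⟨hdec ▸ dec_subset 1 t, ha⟩, fun j hj h => e1 j hj ((h2 i j).1 h),
        fun j k hj hk => (h2 j k).2 (e2 j k hj hk), fun x hx => ?_⟩
      obtain ⟨l, hl⟩ := hv x hx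
      by_cases hli : l = i
      · exact Or.inl (hli ▸ hl)
      · exact Or.inr ⟨l, hli, hl⟩
  ext e
  constructor
  · rintro (⟨i, hi, j, hj, rfl⟩ | ⟨i, hi, j, k, hj, hk, hjk, rfl⟩)
    · have := (htype i).1 hi
      exact mem_decSt.2 ⟨hj.symm, (has_tau_iff t ht i j hj.symm).2 (Or.inl ⟨this.1, Or.inl this.2⟩)⟩
    · have := (htwo i).1 hi
      refine mem_decSt.2 ⟨hjk, (has_tau_iff t ht j k hjk).2 (Or.inr ⟨?_, this.2 j k hj hk⟩)⟩
      rw [eq_third i j k hj hk hjk]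
      exact this.1
  · rintro ⟨a, b, hab, h, rfl⟩
    rcases (has_tau_iff t ht a b hab).1 h with ⟨h0, h1 | h1⟩ | ⟨h1, h3⟩
    · exact Or.inl ⟨a, (htype a).2 ⟨h0, h1⟩, b, hab.symm, rfl⟩
    · exact Or.inl ⟨b, (htype b).2 ⟨h0, h1⟩, a, hab, Sym2.eq_swap⟩
    · have hth := third_spec a b hab
      refine Or.inr ⟨third a b, (htwo _).2 ⟨h1, fun j k hj hk => ?_⟩, a, b, hth.2.2.1,
        hth.2.2.2.symm, hab, rfl⟩
      rcases eq_or_of_ne_third a b j hab hj with rfl | rfl <;>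
        rcases eq_or_of_ne_third _ _ k hab hk with rfl | rfl
      · exact conn_self _ _
      · exact h3
      · rw [conn_symm]; exact h3
      · exact conn_self _ _

theorem map_psiWord_mem_EG {k : ℕ} {e : Sym2 Plane} (he : e ∈ EG k) :
    ∀ w : List (Fin 3), Sym2.map (psiWord w) e ∈ EG (k + w.length)
  | [] => by
    have : psiWord [] = id := rfl
    simpa [this] using he
  | i :: w => Set.mem_iUnion.2 ⟨i, _, map_psiWord_mem_EG he w, by
      rw [Sym2.map_map]; rfl⟩

/-- The trace acts on the finest copies of $G_1$, each of which lies in a single piece; so it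
commutes with gluing. -/
theorem trace_glue {n : ℕ} {g : Fin 3 → Set (Sym2 Plane)} (hg : ∀ i, g i ⊆ EG (n + 1)) :
    trace (n + 1) (glue g) = glue fun i => trace n (g i) := by
  have hmm : ∀ (i : Fin 3) (w : List (Fin 3)) (e : Sym2 Plane),
      Sym2.map (psiWord (i :: w)) e = Sym2.map (psi i) (Sym2.map (psiWord w) e) := by
    intro i w e
    rw [Sym2.map_map]; rfl
  have hres : ∀ (i : Fin 3) (w : List (Fin 3)), w.length = n →
      restrict 1 (i :: w) (glue g) = restrict 1 w (g i) := by
    intro i w hw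
    ext e
    refine and_congr_right fun he => ?_
    rw [hmm]
    refine mem_glue_iff hg ?_
    have := map_psiWord_mem_EG he w
    rwa [hw, add_comm] at this
  ext e
  simp only [trace, glue, Set.mem_iUnion, Set.mem_image, exists_prop]
  constructor
  · rintro ⟨w, hw, e', he', rfl⟩
    obtain _ | ⟨i, w⟩ := w
    · simp at hw
    have hw : w.length = n := by simpa using hw
    have he' := hres i w hw ▸ he'
    exact ⟨i, _, ⟨w, hw, e', he', rfl⟩, (hmm i w e').symm⟩
  · rintro ⟨i, _, ⟨w, hw, e', he', rfl⟩, rfl⟩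
    refine ⟨i :: w, by simpa using hw, e', ?_, hmm i w e'⟩
    have := hres i w hw
    rw [glue] at this
    rwa [this]

theorem trace_dec : ∀ (n : ℕ) (ρ : Cfg (n + 1)), root (n + 1) ρ ≠ 7 →
    trace n (dec (n + 1) ρ) = dec n (tr n ρ)
  | 0, ρ, h => by
    have h1 : trace 0 (dec 1 ρ) = traceOne (dec 1 ρ) := by
      have hid : psiWord [] = id := rfl
      have hres : restrict 1 [] (dec 1 ρ) = dec 1 ρ := by
        ext e
        simp only [restrict, hid]
        rw [Set.mem_ofPred_eq, Sym2.map_id, id]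
        exact ⟨fun h => h.2, fun h => ⟨dec_subset 1 ρ h, h⟩⟩
      ext e
      simp only [trace, Set.mem_iUnion, exists_prop]
      constructor
      · rintro ⟨w, hw, he⟩
        obtain rfl := List.length_eq_zero_iff.1 hw
        simpa [hres, hid] using he
      · intro he
        exact ⟨[], rfl, by simpa [hres, hid] using he⟩
    rw [h1]
    exact traceOne_glue h
  | n + 1, ρ, h => by
    have h7 := ((tau_ne_iff _).1 h).1
    have : dec (n + 1 + 1) ρ = glue fun i => dec (n + 1) (ρ i) := rfl
    rw [this, trace_glue fun i => dec_subset (n + 1) (ρ i)]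
    exact congrArg glue (funext fun i => trace_dec n (ρ i) (h7 i))

/-! ### Consistent families of states -/

/-- The states of all parts of a piece. -/
def sh (i : Fin 3) (σ : List (Fin 3) → St) : List (Fin 3) → St := fun w => σ (i :: w)

/-- The states of all parts of the part with word `w`. -/
def shw (w : List (Fin 3)) (σ : List (Fin 3) → St) : List (Fin 3) → St := fun v => σ (w ++ v)

/-- The state of each part is the trace of the states of its three pieces, and all states are
forests. -/
structure Consistent (σ : List (Fin 3) → St) : Prop where
  trace_eq : ∀ w, tau (fun i => σ (w ++ [i])) = σ w
  ne_seven : ∀ w, σ w ≠ 7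

theorem Consistent.sh {σ : List (Fin 3) → St} (h : Consistent σ) (i : Fin 3) :
    Consistent (sh i σ) :=
  ⟨fun w => h.trace_eq (i :: w), fun w => h.ne_seven (i :: w)⟩

theorem Consistent.shw {σ : List (Fin 3) → St} (h : Consistent σ) (v : List (Fin 3)) :
    Consistent (shw v σ) :=
  ⟨fun w => by simpa [SierpinskiLERW.shw] using h.trace_eq (v ++ w), fun w => h.ne_seven (v ++ w)⟩

theorem Consistent.tau_eq {σ : List (Fin 3) → St} (h : Consistent σ) :
    tau (fun i => σ [i]) = σ [] := h.trace_eq []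

theorem Consistent.tau_ne {σ : List (Fin 3) → St} (h : Consistent σ) :
    tau (fun i => σ [i]) ≠ 7 := h.tau_eq ▸ h.ne_seven []

/-- The configuration of level `n` of a family of states. -/
def cfgOf : (n : ℕ) → (List (Fin 3) → St) → Cfg n
  | 0, σ => σ []
  | n + 1, σ => fun i => cfgOf n (sh i σ)

/-- The state of a part in a configuration. -/
def val : (n : ℕ) → Cfg n → List (Fin 3) → St
  | 0, s, _ => s
  | _ + 1, ρ, [] => root _ ρ
  | n + 1, ρ, i :: w => val n (ρ i) w

theorem cfgOf_eq : ∀ (n : ℕ) (σ : List (Fin 3) → St) (ρ : Cfg n),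
    (∀ w, w.length = n → σ w = val n ρ w) → cfgOf n σ = ρ
  | 0, σ, ρ, h => h [] rfl
  | n + 1, σ, ρ, h => funext fun i => cfgOf_eq n (sh i σ) (ρ i) fun w hw => h (i :: w) (by simp [hw])

theorem val_tr : ∀ (n : ℕ) (ρ : Cfg (n + 1)) (w : List (Fin 3)), w.length = n →
    tau (fun i => val (n + 1) ρ (w ++ [i])) = val n (tr n ρ) w
  | 0, ρ, w, h => by
    obtain rfl := List.length_eq_zero_iff.1 h
    rfl
  | n + 1, ρ, [], h => by simp at h
  | n + 1, ρ, i :: w, h => val_tr n (ρ i) w (by simpa using h)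

theorem val_ne_seven : ∀ (n : ℕ) (ρ : Cfg n), root n ρ ≠ 7 → ∀ w, val n ρ w ≠ 7
  | 0, _, h, _ => h
  | _ + 1, _, h, [] => h
  | n + 1, ρ, h, i :: w => val_ne_seven n (ρ i) (((tau_ne_iff _).1 h).1 i) w

theorem root_cfgOf : ∀ (n : ℕ) {σ : List (Fin 3) → St}, Consistent σ → root n (cfgOf n σ) = σ []
  | 0, _, _ => rfl
  | n + 1, σ, h => by
    rw [← h.tau_eq, root]
    exact congrArg tau (funext fun i => root_cfgOf n (h.sh i))

/-- The family of states of a limit tree. -/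
noncomputable def states (T : LimitTree) (w : List (Fin 3)) : St :=
  val w.length (code (T.proj w.length)) w

theorem tr_code (T : LimitTree) (n : ℕ) : tr n (code (T.proj (n + 1))) = code (T.proj n) := by
  apply dec_injective
  have h7 := ((isTree_iff _).1 (isTree_code (T.proj (n + 1)))).1
  rw [← trace_dec n _ h7, dec_code, dec_code]
  exact T.2 n

theorem consistent_states (T : LimitTree) : Consistent (states T) := by
  refine ⟨fun w => ?_, fun w =>
    val_ne_seven _ _ ((isTree_iff _).1 (isTree_code (T.proj w.length))).1 w⟩
  have h := val_tr w.length (code (T.proj (w.length + 1))) w rfl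
  rw [tr_code] at h
  rw [states, ← h]
  refine congrArg tau (funext fun i => ?_)
  have hl : (w ++ [i]).length = w.length + 1 := by simp
  rw [states, hl]

theorem cfgOf_states (T : LimitTree) (n : ℕ) : cfgOf n (states T) = code (T.proj n) := by
  refine cfgOf_eq n _ _ fun w hw => ?_
  subst hw
  rfl

theorem isTree_states (T : LimitTree) : isTree (states T []) := isTree_code (T.proj 0)

/-! ### Paths -/

/-- The crossings of `n`-parts by the path from `a` to `b`: words, entries and exits. -/
def cr : ℕ → (List (Fin 3) → St) → Fin 3 → Fin 3 → List (List (Fin 3) × Fin 3 × Fin 3)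
  | 0, _, a, b => [([], a, b)]
  | n + 1, σ, a, b => (route (fun i => σ [i]) a b).flatMap fun x =>
      (cr n (sh x.1 σ) x.2.1 x.2.2).map fun y => (x.1 :: y.1, y.2)

/-- The vertices of the path from `a` to `b` in the graph of level `n`, without the last one. -/
noncomputable def vl : ℕ → (List (Fin 3) → St) → Fin 3 → Fin 3 → List Plane
  | 0, σ, a, b => if has (σ []) (third a b) then [u a] else [u a, u (third a b)]
  | n + 1, σ, a, b => (route (fun i => σ [i]) a b).flatMap fun x =>
      (vl n (sh x.1 σ) x.2.1 x.2.2).map (psi x.1)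

/-- Self-similarity of paths: refining by `k` levels replaces each crossing of an `n`-part by the
path of level `k` in that part. All later counts of edges per crossing rest on this. -/
theorem vl_add (k : ℕ) : ∀ (n : ℕ) (σ : List (Fin 3) → St) (a b : Fin 3),
    vl (k + n) σ a b = (cr n σ a b).flatMap fun x =>
      (vl k (shw x.1 σ) x.2.1 x.2.2).map (psiWord x.1)
  | 0, σ, a, b => by
    have h1 : psiWord [] = id := rfl
    have h2 : shw [] σ = σ := rfl
    simp [cr, h1, h2]
  | n + 1, σ, a, b => by
    rw [← add_assoc, vl, cr, List.flatMap_assoc]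
    congr 1
    funext x
    rw [vl_add k n, List.map_flatMap, List.flatMap_map]
    congr 1
    funext y
    rw [List.map_map]
    rfl

theorem cr_spec : ∀ (n : ℕ) {σ : List (Fin 3) → St}, Consistent σ → ∀ {a b : Fin 3}, a ≠ b →
    conn (σ []) a b → ∀ x ∈ cr n σ a b, x.1.length = n ∧ x.2.1 ≠ x.2.2 ∧ conn (σ x.1) x.2.1 x.2.2
  | 0, σ, _, a, b, hab, hc, x, hx => by
    obtain rfl : x = ([], a, b) := by simpa [cr] using hx
    exact ⟨rfl, hab, hc⟩
  | n + 1, σ, h, a, b, hab, hc, x, hx => by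
    rw [cr, List.mem_flatMap] at hx
    obtain ⟨y, hy, hx⟩ := hx
    obtain ⟨z, hz, rfl⟩ := List.mem_map.1 hx
    have hr := route_valid _ h.tau_ne a b hab (h.tau_eq ▸ hc) y hy
    obtain ⟨h1, h2, h3⟩ := cr_spec n (h.sh y.1) hr.1 hr.2 z hz
    exact ⟨by simp [h1], h2, h3⟩

theorem isChain_append_of_head {α : Type*} {R : α → α → Prop} {l₁ l₂ : List α} {v : α}
    (h₁ : (l₁ ++ [v]).IsChain R) (h₂ : l₂.IsChain R) (hv : l₂.head? = some v) :
    (l₁ ++ l₂).IsChain R := by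
  rw [List.isChain_append] at h₁ ⊢
  refine ⟨h₁.1, h₂, fun x hx y hy => ?_⟩
  rw [hv] at hy
  exact h₁.2.2 x hx y (by simpa using hy)

theorem vl_head : ∀ (n : ℕ) (σ : List (Fin 3) → St) (a b : Fin 3),
    (vl n σ a b).head? = some (u a)
  | 0, σ, a, b => by rw [vl]; split_ifs <;> rfl
  | n + 1, σ, a, b => by
    rw [vl, route]
    split_ifs
    · simp only [List.flatMap_cons, List.head?_append, List.head?_map, vl_head n]
      simp [psi_u_self]
    · simp only [List.flatMap_cons, List.head?_append, List.head?_map, vl_head n]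
      simp [psi_u_self]

theorem vl_mem_VG : ∀ (n : ℕ) (σ : List (Fin 3) → St) (a b : Fin 3), ∀ x ∈ vl n σ a b, x ∈ VG n
  | 0, σ, a, b, x, hx => by
    rw [vl] at hx
    split_ifs at hx
    · obtain rfl : x = u a := by simpa using hx
      exact ⟨a, rfl⟩
    · have : x = u a ∨ x = u (third a b) := by simpa using hx
      rcases this with rfl | rfl
      · exact ⟨_, rfl⟩
      · exact ⟨_, rfl⟩
  | n + 1, σ, a, b, x, hx => by
    rw [vl, List.mem_flatMap] at hx
    obtain ⟨y, -, hx⟩ := hx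
    obtain ⟨z, hz, rfl⟩ := List.mem_map.1 hx
    exact Set.mem_iUnion.2 ⟨y.1, z, vl_mem_VG n _ _ _ z hz, rfl⟩

theorem route_corner (t : Fin 3 → St) : tau t ≠ 7 → ∀ a b, a ≠ b → conn (tau t) a b →
    ∀ x ∈ route t a b, conn (t x.1) x.2.1 x.1 → conn (tau t) a x.1 :=
  forall_triple (p := fun t => tau t ≠ 7 → ∀ a b, a ≠ b → conn (tau t) a b →
    ∀ x ∈ route t a b, conn (t x.1) x.2.1 x.1 → conn (tau t) a x.1) (by decide +kernel) t

theorem conn_of_not_has : ∀ (s : St) (a b : Fin 3), a ≠ b → conn s a b →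
    has s (third a b) = false → has s a ∧ has s b ∧ conn s a (third a b) := by decide

/-- Needed in `vl_nodup`: a visited corner yields a link in the state, which excludes that the first
and the last piece of a detour both visit their common vertex. -/
theorem conn_of_mem_vl : ∀ (n : ℕ) {σ : List (Fin 3) → St}, Consistent σ → ∀ {a b : Fin 3},
    a ≠ b → conn (σ []) a b → ∀ x, u x ∈ vl n σ a b → conn (σ []) a x
  | 0, σ, h, a, b, hab, hc, x, hx => by
    rw [vl] at hx
    split_ifs at hx with hh
    · have : u x = u a := by simpa using hx
      rw [u_injective this]
      exact conn_self _ _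
    · have : u x = u a ∨ u x = u (third a b) := by simpa using hx
      rcases this with h1 | h1
      · rw [u_injective h1]
        exact conn_self _ _
      · rw [u_injective h1]
        exact (conn_of_not_has _ a b hab hc (by simpa using hh)).2.2
  | n + 1, σ, h, a, b, hab, hc, x, hx => by
    rw [vl, List.mem_flatMap] at hx
    obtain ⟨y, hy, hx⟩ := hx
    obtain ⟨z, hz, hzx⟩ := List.mem_map.1 hx
    obtain ⟨rfl, h2⟩ := psi_eq_u (VG_subset_triangle n (vl_mem_VG n _ _ _ z hz)) hzx
    subst h2
    have hr := route_valid _ h.tau_ne a b hab (h.tau_eq ▸ hc) y hy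
    have := conn_of_mem_vl n (h.sh y.1) hr.1 hr.2 _ hz
    rw [← h.tau_eq]
    exact route_corner _ h.tau_ne a b hab (h.tau_eq ▸ hc) y hy this

theorem isChain_map_psi {f f' : Set (Sym2 Plane)} {i : Fin 3} (h : Sym2.map (psi i) '' f ⊆ f')
    {l : List Plane} (hl : l.IsChain (gr f).Adj) : (l.map (psi i)).IsChain (gr f').Adj := by
  rw [List.isChain_map]
  exact hl.imp fun _ _ hxy => gr_map_adj h hxy

/-- The route stays in one of two shapes. -/
theorem route_cases (t : Fin 3 → St) (a b : Fin 3) :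
    (direct t a b ∧ route t a b = [(a, a, b), (b, a, b)]) ∨
    (¬ direct t a b ∧ route t a b =
      [(a, a, third a b), (third a b, a, b), (b, third a b, b)]) := by
  unfold route
  by_cases h : direct t a b <;> simp [h]

theorem vl_chain : ∀ (n : ℕ) {σ : List (Fin 3) → St}, Consistent σ → ∀ {a b : Fin 3},
    a ≠ b → conn (σ []) a b → (vl n σ a b ++ [u b]).IsChain (gr (dec n (cfgOf n σ))).Adj
  | 0, σ, h, a, b, hab, hc => by
    have hadj : ∀ i j, i ≠ j → has (σ []) (third i j) →
        (gr (dec 0 (cfgOf 0 σ))).Adj (u i) (u j) := fun i j hij h =>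
      (SimpleGraph.fromEdgeSet_adj _).2 ⟨mem_decSt.2 ⟨hij, h⟩, u_injective.ne hij⟩
    rw [vl]
    split_ifs with hh
    · simpa using hadj a b hab hh
    · have h1 := conn_of_not_has _ a b hab hc (by simpa using hh)
      have h2 := third_spec a b hab
      have e1 := hadj a (third a b) h2.2.2.1 (by rw [h2.1]; exact h1.2.1)
      have e2 := hadj (third a b) b h2.2.2.2 (by rw [h2.2.1]; exact h1.1)
      simp only [List.cons_append, List.nil_append, List.isChain_cons_cons, List.isChain_singleton,
        and_true]
      exact ⟨e1, e2⟩
  | n + 1, σ, h, a, b, hab, hc => by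
    have ih : ∀ x ∈ route (fun i => σ [i]) a b,
        ((vl n (sh x.1 σ) x.2.1 x.2.2).map (psi x.1) ++ [psi x.1 (u x.2.2)]).IsChain
          (gr (dec (n + 1) (cfgOf (n + 1) σ))).Adj := by
      intro x hx
      have hr := route_valid _ h.tau_ne a b hab (h.tau_eq ▸ hc) x hx
      have := isChain_map_psi (f' := dec (n + 1) (cfgOf (n + 1) σ))
        (subset_glue (fun i => dec n (cfgOf (n + 1) σ i)) x.1) (vl_chain n (h.sh x.1) hr.1 hr.2)
      simpa using this
    have hh : ∀ i c d, ((vl n (sh i σ) c d).map (psi i)).head? = some (psi i (u c)) := by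
      intro i c d
      rw [List.head?_map, vl_head]; rfl
    rw [vl]
    rcases route_cases (fun i => σ [i]) a b with ⟨-, hrt⟩ | ⟨-, hrt⟩
    · rw [hrt] at ih ⊢
      have h1 := ih (a, a, b) (by simp)
      have h2 := ih (b, a, b) (by simp)
      simp only [List.flatMap_cons, List.flatMap_nil, List.append_nil, List.append_assoc]
      rw [psi_u_self] at h2
      refine isChain_append_of_head h1 h2 ?_
      rw [List.head?_append, hh, psi_u_comm a b]; rfl
    · rw [hrt] at ih ⊢
      have h1 := ih (a, a, third a b) (by simp)
      have h2 := ih (third a b, a, b) (by simp)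
      have h3 := ih (b, third a b, b) (by simp)
      simp only [List.flatMap_cons, List.flatMap_nil, List.append_nil, List.append_assoc]
      rw [psi_u_self] at h3
      refine isChain_append_of_head h1 (isChain_append_of_head h2 h3 ?_) ?_
      · rw [List.head?_append, hh, psi_u_comm _ b]; rfl
      · rw [List.head?_append, hh, psi_u_comm a _]; rfl

/-- Different pieces share one vertex only. Consecutive pieces of the route meet where one ends and
the next begins, so only the first and the last piece of a detour need an argument. -/
theorem vl_nodup : ∀ (n : ℕ) {σ : List (Fin 3) → St}, Consistent σ → ∀ {a b : Fin 3},
    a ≠ b → conn (σ []) a b → (vl n σ a b ++ [u b]).Nodup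
  | 0, σ, h, a, b, hab, hc => by
    have h2 := third_spec a b hab
    have e1 := u_injective.ne hab
    have e2 := u_injective.ne h2.2.2.1
    have e3 := u_injective.ne h2.2.2.2
    rw [vl]
    split_ifs with hh <;> simp [e1, e2, e3]
  | n + 1, σ, h, a, b, hab, hc => by
    have hVG : ∀ i c d, ∀ x ∈ vl n (sh i σ) c d ++ [u d], x ∈ triangle := by
      intro i c d x hx
      rcases List.mem_append.1 hx with hx | hx
      · exact VG_subset_triangle n (vl_mem_VG n _ _ _ x hx)
      · rw [List.mem_singleton.1 hx]; exact u_mem_triangle d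
    have ih : ∀ x ∈ route (fun i => σ [i]) a b,
        (vl n (sh x.1 σ) x.2.1 x.2.2 ++ [u x.2.2]).Nodup := by
      intro x hx
      have hr := route_valid _ h.tau_ne a b hab (h.tau_eq ▸ hc) x hx
      exact vl_nodup n (h.sh x.1) hr.1 hr.2
    have hcm : ∀ x ∈ route (fun i => σ [i]) a b, ∀ y, u y ∈ vl n (sh x.1 σ) x.2.1 x.2.2 →
        conn (σ [x.1]) x.2.1 y := by
      intro x hx y hy
      have hr := route_valid _ h.tau_ne a b hab (h.tau_eq ▸ hc) x hx
      exact conn_of_mem_vl n (h.sh x.1) hr.1 hr.2 y hy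
    have hend : ∀ x ∈ route (fun i => σ [i]) a b, u x.2.2 ∉ vl n (sh x.1 σ) x.2.1 x.2.2 := by
      intro x hx hm
      have := ih x hx
      rw [List.nodup_append] at this
      exact this.2.2 _ hm _ (List.mem_singleton.2 rfl) rfl
    have hmap : ∀ i (l : List Plane), l.Nodup → (l.map (psi i)).Nodup :=
      fun i l hl => hl.map (psi_injective i)
    rw [vl]
    rcases route_cases (fun i => σ [i]) a b with ⟨-, hrt⟩ | ⟨hnd, hrt⟩
    · rw [hrt] at ih hend ⊢
      have h1 := ih (a, a, b) (by simp)
      have h2 := ih (b, a, b) (by simp)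
      have he := hend (a, a, b) (by simp)
      have e : [u b] = [u b].map (psi b) := by simp [psi_u_self]
      simp only [List.flatMap_cons, List.flatMap_nil, List.append_nil, List.append_assoc]
      rw [e, ← List.map_append, List.nodup_append]
      refine ⟨hmap _ _ (List.nodup_append.1 h1).1, hmap _ _ h2, ?_⟩
      rintro _ hx y hy rfl
      obtain ⟨p, hp, rfl⟩ := List.mem_map.1 hx
      obtain ⟨q, hq, hpq⟩ := List.mem_map.1 hy
      have := psi_eq_psi (hVG _ _ _ p (List.mem_append_left _ hp)) (hVG _ _ _ q hq) hab hpq.symm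
      exact he (this.1 ▸ hp)
    · rw [hrt] at ih hend hcm ⊢
      have hth := third_spec a b hab
      have h1 := ih (a, a, third a b) (by simp)
      have h2 := ih (third a b, a, b) (by simp)
      have h3 := ih (b, third a b, b) (by simp)
      have he1 := hend (a, a, third a b) (by simp)
      have he2 := hend (third a b, a, b) (by simp)
      have e : [u b] = [u b].map (psi b) := by simp [psi_u_self]
      simp only [List.flatMap_cons, List.flatMap_nil, List.append_nil, List.append_assoc]
      rw [e, ← List.map_append, List.nodup_append, List.nodup_append]
      refine ⟨hmap _ _ (List.nodup_append.1 h1).1,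
        ⟨hmap _ _ (List.nodup_append.1 h2).1, hmap _ _ h3, ?_⟩, ?_⟩
      · rintro _ hx y hy rfl
        obtain ⟨p, hp, rfl⟩ := List.mem_map.1 hx
        obtain ⟨q, hq, hpq⟩ := List.mem_map.1 hy
        have := psi_eq_psi (hVG _ _ _ p (List.mem_append_left _ hp)) (hVG _ _ _ q hq)
          hth.2.2.2 hpq.symm
        exact he2 (this.1 ▸ hp)
      · rintro _ hx y hy rfl
        obtain ⟨p, hp, rfl⟩ := List.mem_map.1 hx
        rcases List.mem_append.1 hy with hy | hy
        · obtain ⟨q, hq, hpq⟩ := List.mem_map.1 hy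
          have := psi_eq_psi (hVG _ _ _ p (List.mem_append_left _ hp))
            (hVG _ _ _ q (List.mem_append_left _ hq)) hth.2.2.1 hpq.symm
          exact he1 (this.1 ▸ hp)
        · obtain ⟨q, hq, hpq⟩ := List.mem_map.1 hy
          obtain ⟨rfl, rfl⟩ := psi_eq_psi (hVG _ _ _ p (List.mem_append_left _ hp)) (hVG _ _ _ q hq)
            hab hpq.symm
          have c1 := hcm (a, a, third a b) (by simp) b hp
          have hq' : u a ∈ vl n (sh b σ) (third a b) b := by
            rcases List.mem_append.1 hq with hq | hq
            · exact hq
            · exact absurd (u_injective (List.mem_singleton.1 hq)) hab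
          have c2 := hcm (b, third a b, b) (by simp) a hq'
          have hr := (route_valid _ h.tau_ne a b hab (h.tau_eq ▸ hc) (b, third a b, b)
            (by rw [hrt]; simp)).2
          -- If both outer pieces contained their common vertex, both would link `a` to `b`, and the
          -- route would be direct.
          refine hnd ?_
          rw [direct, Bool.and_eq_true]
          refine ⟨c1, conn_trans _ _ _ _ ?_ hr⟩
          rw [conn_symm]; exact c2

/-- The list of vertices is a chain without repetitions, hence a path, and in a forest there is only
one. -/
theorem support_eq_vl {n : ℕ} {σ : List (Fin 3) → St} (h : Consistent σ) {a b : Fin 3}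
    (hab : a ≠ b) (hc : conn (σ []) a b) (p : (gr (dec n (cfgOf n σ))).Walk (u a) (u b))
    (hp : p.IsPath) : p.support = vl n σ a b ++ [u b] := by
  have hne : vl n σ a b ++ [u b] ≠ [] := by simp
  let q := SimpleGraph.Walk.ofSupport _ hne (vl_chain n h hab hc)
  have hq : q.support = vl n σ a b ++ [u b] := SimpleGraph.Walk.support_ofSupport ..
  have e1 : (vl n σ a b ++ [u b]).head hne = u a := by
    rw [← Option.some_inj, ← List.head?_eq_some_head, List.head?_append, vl_head]; rfl
  have e2 : (vl n σ a b ++ [u b]).getLast hne = u b := by simp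
  have hq' : (q.copy e1 e2).IsPath := by
    rw [SimpleGraph.Walk.isPath_def, SimpleGraph.Walk.support_copy, hq]
    exact vl_nodup n h hab hc
  have ha := ((root_spec n (cfgOf n σ)).1.1 (root_cfgOf n h ▸ h.ne_seven [])).1
  have := congrArg Subtype.val ((ha.subsingleton_path _ _).elim ⟨p, hp⟩ ⟨_, hq'⟩)
  have hpq : p = q.copy e1 e2 := this
  rw [hpq, SimpleGraph.Walk.support_copy, hq]

theorem treePath_support (T : LimitTree) (n : ℕ) :
    (treePath (T.proj n)).support = vl n (states T) 0 1 ++ [u 1] := by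
  have key : ∀ f : Set (Sym2 Plane), f = dec n (cfgOf n (states T)) →
      ∀ p : (gr f).Walk (u 0) (u 1), p.IsPath → p.support = vl n (states T) 0 1 ++ [u 1] := by
    rintro f rfl p hp
    exact support_eq_vl (consistent_states T) (by decide)
      (((isTree_iff _).1 (isTree_states T)).2 0 1) p hp
  refine key _ ?_ _ ((T.proj n).2.2 _ (u_mem_VG 0 n) _ (u_mem_VG 1 n)).exists_isPath.choose_spec
  rw [cfgOf_states, dec_code]

/-! ### Uniqueness of the decomposition -/

/-- Two different parts of a level meet only in a corner, so a point that is not a corner determines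
its part. This is why the decomposition demands such points. -/
theorem part_eq_of_hits {v w : List (Fin 3)} (hl : v.length = w.length) {S : Set Plane}
    (h : (S ∩ psiWord v '' (gasket \ VG 0)).Nonempty) (hS : S ⊆ psiWord w '' gasket) : v = w := by
  by_contra hne
  obtain ⟨_, hp, x, ⟨hx, hx0⟩, rfl⟩ := h
  obtain ⟨y, hy, hxy⟩ := hS hp
  obtain ⟨i, j, hi, -, -⟩ := psiWord_eq_psiWord hl hne hx hy hxy.symm
  exact hx0 ⟨i, hi.symm⟩

section Uniqueness

variable {n : ℕ} {γ : ℝ≥0∞ → Plane} {m m' : ℕ} {t t' : ℕ → ℝ≥0∞} {w w' : ℕ → List (Fin 3)}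

theorem IsPartDecomp.time_lt_of_lt (h : IsPartDecomp n γ m t w) {i j : ℕ} (hij : i < j)
    (hj : j ≤ m) : t i < t j := by
  induction j, hij using Nat.le_induction with
  | base => exact h.time_lt i (by omega)
  | succ j hij ih => exact (ih (by omega)).trans (h.time_lt j (by omega))

theorem IsPartDecomp.exit_lt_end (h : IsPartDecomp n γ m t w) {j : ℕ} (hj : j + 1 < m) :
    t (j + 1) < endTime γ := by
  rw [← h.time_last]
  exact h.time_lt_of_lt hj le_rfl

/-- Of two intervals with the same start, the shorter is contained in the longer; its non-corner
point then lies in both parts. -/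
theorem IsPartDecomp.word_eq (h : IsPartDecomp n γ m t w) (h' : IsPartDecomp n γ m' t' w') {j : ℕ}
    (hj : j < m) (hj' : j < m') (ht : t j = t' j) : w j = w' j := by
  rcases le_total (t (j + 1)) (t' (j + 1)) with hle | hle
  · refine part_eq_of_hits ((h.length_word j hj).trans (h'.length_word j hj').symm)
      (h.hits_inner j hj) ((Set.image_mono ?_).trans (h'.subset_part j hj'))
    rw [ht]
    exact Set.Icc_subset_Icc_right hle
  · refine (part_eq_of_hits ((h'.length_word j hj').trans (h.length_word j hj).symm)
      (h'.hits_inner j hj') ((Set.image_mono ?_).trans (h.subset_part j hj))).symm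
    rw [ht]
    exact Set.Icc_subset_Icc_right hle

theorem IsPartDecomp.not_exit_of_last (h : IsPartDecomp n γ m t w)
    (h' : IsPartDecomp n γ m' t' w') {j : ℕ} (hj : j + 1 = m) (hj' : j + 1 < m')
    (ht : t j = t' j) : False := by
  -- One decomposition stays in the part until the end, while the other leaves the same part
  -- strictly before the end.
  have hw := h.word_eq h' (by omega) (by omega) ht
  have h1 := h'.exit_time j hj'
  have h2 := h'.exit_lt_end hj'
  rw [h1] at h2
  obtain ⟨s, ⟨hs1, hs2⟩, hs3⟩ := sInf_lt_iff.1 h2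
  refine hs2 ?_
  rw [← hw]
  refine h.subset_part j (by omega) ⟨s, ⟨ht ▸ hs1.le, ?_⟩, rfl⟩
  rw [hj, h.time_last]
  exact hs3.le

theorem IsPartDecomp.time_eq (h : IsPartDecomp n γ m t w) (h' : IsPartDecomp n γ m' t' w') (j : ℕ)
    (hj : j ≤ m) (hj' : j ≤ m') : t j = t' j := by
  induction j with
  | zero => rw [h.time_zero, h'.time_zero]
  | succ j ih =>
    have ih := ih (by omega) (by omega)
    have hw := h.word_eq h' (by omega) (by omega) ih
    rcases hj.lt_or_eq with h1 | h1 <;> rcases hj'.lt_or_eq with h2 | h2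
    · rw [h.exit_time j h1, h'.exit_time j h2, ih, hw]
    · exact (h'.not_exit_of_last h h2 h1 ih.symm).elim
    · exact (h.not_exit_of_last h' h1 h2 ih).elim
    · exact (congrArg t h1).trans (h.time_last.trans (h'.time_last.symm.trans (congrArg t' h2.symm)))

theorem IsPartDecomp.length_le (h : IsPartDecomp n γ m t w) (h' : IsPartDecomp n γ m' t' w') :
    m ≤ m' := by
  by_contra! hlt
  have h1 := h.time_eq h' m' hlt.le le_rfl
  have h2 := h.time_lt_of_lt hlt le_rfl
  rw [h1, h'.time_last, h.time_last] at h2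
  exact lt_irrefl _ h2

theorem IsPartDecomp.length_eq (h : IsPartDecomp n γ m t w) (h' : IsPartDecomp n γ m' t' w') :
    m = m' := le_antisymm (h.length_le h') (h'.length_le h)

theorem isPartDecomp_partDecomp (h : IsPartDecomp n γ m t w) :
    IsPartDecomp n γ (numParts n γ) (fun j => partTime j n γ) (fun j => partWord j n γ) := by
  have hex : ∃ d : ℕ × (ℕ → ℝ≥0∞) × (ℕ → List (Fin 3)), IsPartDecomp n γ d.1 d.2.1 d.2.2 :=
    ⟨(m, t, w), h⟩
  have := hex.choose_spec
  have e : partDecomp n γ = hex.choose := by rw [partDecomp, dif_pos hex]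
  rw [← e] at this
  exact this

theorem numParts_eq (h : IsPartDecomp n γ m t w) : numParts n γ = m :=
  (isPartDecomp_partDecomp h).length_eq h

theorem partTime_eq (h : IsPartDecomp n γ m t w) {j : ℕ} (hj : j ≤ m) : partTime j n γ = t j :=
  (isPartDecomp_partDecomp h).time_eq h j (by rwa [numParts_eq h]) hj

end Uniqueness

/-! ### Interpolated paths -/

theorem interpolate_of_mem {r : ℕ} {x : ℕ → Plane} {N : ℕ} (hN : N < r) {τ : ℝ≥0∞}
    (h1 : (N : ℝ≥0∞) ≤ τ) (h2 : τ ≤ (N + 1 : ℕ)) :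
    interpolate r x τ = AffineMap.lineMap (x N) (x (N + 1)) (τ.toReal - N) := by
  have hτ : τ ≠ ∞ := ne_top_of_le_ne_top (ENNReal.natCast_ne_top _) h2
  obtain ⟨s, rfl⟩ : ∃ s : NNReal, τ = s := ⟨τ.toNNReal, (ENNReal.coe_toNNReal hτ).symm⟩
  have h1' : (N : ℝ) ≤ s := by exact_mod_cast h1
  have h2' : (s : ℝ) ≤ N + 1 := by exact_mod_cast h2
  rw [interpolate, AffineMap.lineMap_apply_module, ENNReal.coe_toReal]
  rcases h2'.lt_or_eq with h | h
  · have hr : (s : ℝ≥0∞) < r := by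
      have : (s : ℝ) < r := h.trans_le (by exact_mod_cast hN)
      exact_mod_cast this
    have hf : ⌊(s : ℝ)⌋₊ = N := (Nat.floor_eq_iff s.2).2 ⟨h1', h⟩
    rw [if_pos hr, hf]
    congr 2
    ring
  · have hf : ⌊(s : ℝ)⌋₊ = N + 1 := by rw [h]; exact_mod_cast Nat.floor_natCast (N + 1)
    have hs : (s : ℝ≥0∞) = (N + 1 : ℕ) := by
      have : s = (N + 1 : ℕ) := by ext; push_cast; exact h
      rw [this]; simp
    split_ifs with hr
    · rw [hf, h]
      push_cast
      simp
    · have : r = N + 1 := by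
        rw [hs] at hr
        have : ¬ (N + 1 < r) := fun h => hr (by exact_mod_cast h)
        omega
      rw [this, h]
      simp

theorem interpolate_of_le {r : ℕ} {x : ℕ → Plane} {τ : ℝ≥0∞} (h : (r : ℝ≥0∞) ≤ τ) :
    interpolate r x τ = x r := by
  rw [interpolate, if_neg (not_lt.2 h)]

theorem exists_nat_mem {a b : ℕ} (hab : a < b) {τ : ℝ≥0∞} (h1 : (a : ℝ≥0∞) ≤ τ)
    (h2 : τ ≤ (b : ℕ)) : ∃ N, a ≤ N ∧ N < b ∧ (N : ℝ≥0∞) ≤ τ ∧ τ ≤ (N + 1 : ℕ) := by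
  induction b, hab using Nat.le_induction with
  | base => exact ⟨a, le_rfl, by omega, h1, h2⟩
  | succ b hb ih =>
    rcases le_total τ b with h | h
    · obtain ⟨N, e1, e2, e3, e4⟩ := ih h
      exact ⟨N, e1, by omega, e3, e4⟩
    · exact ⟨b, by omega, by omega, h, h2⟩

/-- Written as a sum of the increments along edges, each weighted by the clamped elapsed time `min
(τ - N) 1`. The clamping makes every summand continuous on all of `ℝ≥0∞`, including the point
$\infty$. -/
theorem continuous_interpolate (r : ℕ) (x : ℕ → Plane) : Continuous (interpolate r x) := by
  have key : interpolate r x = fun τ : ℝ≥0∞ => x 0 +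
      ∑ N ∈ Finset.range r, (min (τ - N) 1).toReal • (x (N + 1) - x N) := by
    funext τ
    have hone : ∀ N : ℕ, ((N + 1 : ℕ) : ℝ≥0∞) ≤ τ → (min (τ - N) 1).toReal = 1 := by
      intro N hN
      have : (1 : ℝ≥0∞) ≤ τ - N := by
        refine ENNReal.le_sub_of_add_le_left (ENNReal.natCast_ne_top _) ?_
        exact_mod_cast hN
      rw [min_eq_right this]; rfl
    have hsum : ∀ M : ℕ, (M : ℝ≥0∞) ≤ τ →
        x 0 + ∑ N ∈ Finset.range M, (min (τ - N) 1).toReal • (x (N + 1) - x N) = x M := by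
      intro M hM
      induction M with
      | zero => simp
      | succ M ih =>
        have hM' : (M : ℝ≥0∞) ≤ τ := le_trans (by exact_mod_cast Nat.le_succ M) hM
        rw [Finset.sum_range_succ, ← add_assoc, ih hM', hone M hM]
        simp
    rcases le_or_gt (r : ℝ≥0∞) τ with h | h
    · rw [interpolate_of_le h, hsum r h]
    · have hr : 0 < r := by
        rcases Nat.eq_zero_or_pos r with rfl | h'
        · simp at h
        · exact h'
      obtain ⟨N, -, h2, h3, h4⟩ := exists_nat_mem (a := 0) hr (by simp) h.le
      have hz : ∀ M ∈ Finset.range r, M ∉ Finset.range (N + 1) →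
          (min (τ - M) 1).toReal • (x (M + 1) - x M) = 0 := by
        intro M _ hM
        have hM' : N + 1 ≤ M := by simpa using hM
        have : τ - M = 0 := tsub_eq_zero_of_le (h4.trans (by exact_mod_cast hM'))
        simp [this]
      rw [← Finset.sum_subset (s₁ := Finset.range (N + 1)) (by simpa using h2) hz,
        Finset.sum_range_succ, ← add_assoc, hsum N h3, interpolate_of_mem h2 h3 h4,
        AffineMap.lineMap_apply]
      have hle : τ - N ≤ 1 := by
        rw [tsub_le_iff_left]
        exact_mod_cast h4
      rw [min_eq_left hle, ENNReal.toReal_sub_of_le h3 (ne_top_of_lt h)]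
      simp [add_comm]
  rw [key]
  refine continuous_const.add (continuous_finsetSum _ fun N _ => ?_)
  refine Continuous.smul (f := fun τ : ℝ≥0∞ => (min (τ - N) 1).toReal) ?_ continuous_const
  have h1 : Continuous fun τ : ℝ≥0∞ => min (τ - N) 1 :=
    (ENNReal.continuous_sub_right _).min continuous_const
  exact ENNReal.continuousOn_toReal.comp_continuous h1
    fun τ => ne_top_of_le_ne_top ENNReal.one_ne_top (min_le_right _ _)

/-- The data of a path in a graph which is divided into crossings of `n`-parts. -/
structure CrossingData (n k : ℕ) (x : ℕ → Plane) (m : ℕ) (c : ℕ → ℕ) (w : ℕ → List (Fin 3)) :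
    Prop where
  one_le : 1 ≤ m
  zero : c 0 = 0
  lt : ∀ j < m, c j < c (j + 1)
  length_word : ∀ j < m, (w j).length = n
  word_ne : ∀ i < m, ∀ j < m, i ≠ j → w i ≠ w j
  edge : ∀ j < m, ∀ N, c j ≤ N → N < c (j + 1) → ∃ y y', s(y, y') ∈ EG k ∧
    x N = psiWord (w j) y ∧ x (N + 1) = psiWord (w j) y'
  last : x (c m) = u 1

theorem lineMap_eq_left {x y : Plane} (hxy : x ≠ y) {θ : ℝ}
    (h : AffineMap.lineMap x y θ = x) : θ = 0 := by
  rcases AffineMap.lineMap_eq_left_iff.1 h with h | h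
  · exact absurd h hxy
  · exact h

theorem lineMap_eq_right {x y : Plane} (hxy : x ≠ y) {θ : ℝ}
    (h : AffineMap.lineMap x y θ = y) : θ = 1 := by
  rcases AffineMap.lineMap_eq_right_iff.1 h with h | h
  · exact absurd h hxy
  · exact h

section Crossing

variable {n k : ℕ} {x : ℕ → Plane} {m : ℕ} {c : ℕ → ℕ} {w : ℕ → List (Fin 3)} {a : ℝ≥0∞}

theorem CrossingData.le_of_le (h : CrossingData n k x m c w) {i j : ℕ} (hij : i ≤ j) (hj : j ≤ m) :
    c i ≤ c j := by
  induction j, hij using Nat.le_induction with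
  | base => rfl
  | succ j _ ih => exact (ih (by omega)).trans (h.lt j (by omega)).le

theorem CrossingData.mem_part (h : CrossingData n k x m c w) {j : ℕ} (hj : j < m) {τ : ℝ≥0∞}
    (h1 : (c j : ℝ≥0∞) ≤ τ) (h2 : τ ≤ c (j + 1)) :
    interpolate (c m) x τ ∈ psiWord (w j) '' gasket := by
  obtain ⟨N, e1, e2, e3, e4⟩ := exists_nat_mem (h.lt j hj) h1 h2
  obtain ⟨y, y', hy, h3, h4⟩ := h.edge j hj N e1 e2
  have hN : N < c m := e2.trans_le (h.le_of_le hj le_rfl)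
  rw [interpolate_of_mem hN e3 e4, h3, h4, lineMap_psiWord]
  refine ⟨_, lineMap_mem_gasket_of_EG hy ⟨?_, ?_⟩, rfl⟩
  · have := ENNReal.toReal_mono (ne_top_of_le_ne_top (ENNReal.natCast_ne_top _) e4) e3
    simpa using this
  · have := ENNReal.toReal_mono (ENNReal.natCast_ne_top _) e4
    rw [ENNReal.toReal_natCast] at this
    push_cast at this
    linarith

theorem CrossingData.at_time (h : CrossingData n k x m c w) {j : ℕ} (hj : j ≤ m) :
    interpolate (c m) x (c j) = x (c j) := by
  rcases hj.lt_or_eq with h1 | rfl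
  · have h2 := (h.lt j h1).trans_le (h.le_of_le h1 le_rfl)
    rw [interpolate_of_mem h2 le_rfl (by exact_mod_cast Nat.le_succ _)]
    simp
  · exact interpolate_of_le le_rfl

theorem CrossingData.first_edge (h : CrossingData n k x m c w) {j : ℕ} (hj : j < m) {θ : ℝ}
    (h0 : 0 ≤ θ) (h1 : θ ≤ 1) : interpolate (c m) x (c j + ENNReal.ofReal θ) =
      AffineMap.lineMap (x (c j)) (x (c j + 1)) θ := by
  have h2 := (h.lt j hj).trans_le (h.le_of_le hj le_rfl)
  rw [interpolate_of_mem h2 (by simp) (by push_cast; gcongr; simpa using h1),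
    ENNReal.toReal_add (by simp) (by simp), ENNReal.toReal_ofReal h0]
  simp

theorem CrossingData.endTime_eq (h : CrossingData n k x m c w) (ha : a ≠ 0) (ha' : a ≠ ∞) :
    endTime (fun t => interpolate (c m) x (a * t)) = c m / a := by
  have hpos : 0 < c m := (Nat.zero_le _).trans_lt ((h.lt 0 h.one_le).trans_le (h.le_of_le h.one_le le_rfl))
  refine le_antisymm (sInf_le ?_) (le_sInf fun t ht => ?_)
  · intro s hs
    show interpolate (c m) x (a * s) = u 1
    rw [interpolate_of_le, h.last]
    rwa [ENNReal.div_le_iff_le_mul (Or.inl ha) (Or.inl ha'), mul_comm] at hs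
  · by_contra! hlt
    rw [ENNReal.lt_div_iff_mul_lt (Or.inl ha) (Or.inl ha'), mul_comm] at hlt
    -- Choose a time after `t` in the interior of the last edge. This edge is nondegenerate, so the
    -- curve is not yet at its end.
    have h1 : max (a * t) ((c m - 1 : ℕ) : ℝ≥0∞) < c m := by
      refine max_lt hlt ?_
      exact_mod_cast Nat.sub_lt hpos one_pos
    obtain ⟨τ, hτ1, hτ2⟩ := exists_between h1
    have hτ3 := (le_max_left _ _).trans_lt hτ1
    have hτ4 := (le_max_right _ _).trans_lt hτ1
    have := ht (τ / a) (by
      rw [ENNReal.le_div_iff_mul_le (Or.inl ha) (Or.inl ha'), mul_comm]; exact hτ3.le)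
    simp only [ENNReal.mul_div_cancel ha ha'] at this
    have hcm : c m - 1 + 1 = c m := by omega
    obtain ⟨j, hj⟩ : ∃ j, m = j + 1 := ⟨m - 1, by have := h.one_le; omega⟩
    have hlt := h.lt j (by omega)
    rw [← hj] at hlt
    obtain ⟨y, y', hy, e1, e2⟩ := h.edge j (by omega) (c m - 1) (by omega) (by rw [← hj]; omega)
    rw [interpolate_of_mem (N := c m - 1) (by omega) hτ4.le (by rw [hcm]; exact hτ2.le), hcm,
      ← h.last] at this
    have hne : x (c m - 1) ≠ x (c m) := by
      rw [← hcm, e2, hcm, e1]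
      exact (psiWord_injective _).ne (EG_ends hy).2.2
    have h3 := lineMap_eq_right hne this
    have h4 := ENNReal.toReal_strict_mono (ENNReal.natCast_ne_top _) hτ2
    have h5 : ((c m : ℕ) : ℝ) = ((c m - 1 : ℕ) : ℝ) + 1 := by exact_mod_cast hcm.symm
    simp only [ENNReal.toReal_natCast] at h4
    linarith

theorem CrossingData.isPartDecomp (h : CrossingData n k x m c w) (ha : a ≠ 0) (ha' : a ≠ ∞) :
    IsPartDecomp n (fun t => interpolate (c m) x (a * t)) m (fun j => c j / a) w where
  one_le := h.one_le
  time_zero := by simp [h.zero]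
  time_last := (h.endTime_eq ha ha').symm
  time_lt j hj := by
    have := h.lt j hj
    exact ENNReal.div_lt_div_right ha ha' (by exact_mod_cast this)
  length_word := h.length_word
  subset_part j hj := by
    rintro _ ⟨t, ⟨h1, h2⟩, rfl⟩
    rw [ENNReal.div_le_iff_le_mul (Or.inl ha) (Or.inl ha'), mul_comm] at h1
    rw [ENNReal.le_div_iff_mul_le (Or.inl ha) (Or.inl ha'), mul_comm] at h2
    exact h.mem_part hj h1 h2
  hits_inner j hj := by
    obtain ⟨y, y', hy, e1, e2⟩ := h.edge j hj (c j) le_rfl (h.lt j hj)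
    have hne := (EG_ends hy).2.2
    -- The first edge of the crossing contains infinitely many points and only finitely many of them
    -- are corners.
    have hfin : (VG 0).Finite := Set.finite_range u
    have hinf : ((fun θ : ℝ => AffineMap.lineMap y y' θ) '' Set.Icc (0 : ℝ) 1).Infinite := by
      refine Set.Infinite.image ?_ (Set.Icc_infinite zero_lt_one)
      intro θ _ θ' _ he
      exact AffineMap.lineMap_injective ℝ hne he
    obtain ⟨_, ⟨θ, hθ, rfl⟩, hn⟩ := (hinf.sdiff hfin).nonempty
    refine ⟨psiWord (w j) (AffineMap.lineMap y y' θ), ⟨(c j + ENNReal.ofReal θ) / a, ⟨?_, ?_⟩, ?_⟩,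
      _, ⟨lineMap_mem_gasket_of_EG hy hθ, hn⟩, rfl⟩
    · exact ENNReal.div_le_div_right (by simp) _
    · refine ENNReal.div_le_div_right ?_ _
      have h1 : c j + 1 ≤ c (j + 1) := h.lt j hj
      calc (c j : ℝ≥0∞) + ENNReal.ofReal θ ≤ c j + 1 := by gcongr; simpa using hθ.2
        _ ≤ c (j + 1) := by exact_mod_cast h1
    · simp only
      rw [ENNReal.mul_div_cancel ha ha', h.first_edge hj hθ.1 hθ.2, e1, e2, lineMap_psiWord]
  exit_time j hj := by
    refine le_antisymm (le_sInf ?_) ?_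
    · rintro s ⟨h1, h2⟩
      by_contra! hlt
      refine h2 (h.mem_part (by omega) ?_ ?_)
      · have := h1.le
        rwa [ENNReal.div_le_iff_le_mul (Or.inl ha) (Or.inl ha'), mul_comm] at this
      · have := hlt.le
        rwa [ENNReal.le_div_iff_mul_le (Or.inl ha) (Or.inl ha'), mul_comm] at this
    · refine le_of_forall_gt fun s hs => ?_
      rw [ENNReal.div_lt_iff (Or.inl ha) (Or.inl ha'), mul_comm] at hs
      rw [sInf_lt_iff]
      -- Just after `c (j + 1)` the curve is on the first edge of the next part, already away from
      -- its initial vertex, and that vertex is the only point common to both parts.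
      have hmin : (c (j + 1) : ℝ≥0∞) < min (a * s) (c (j + 1) + 1) :=
        lt_min hs (ENNReal.lt_add_right (by simp) (by simp))
      obtain ⟨τ, hτ1, hτ2⟩ := exists_between hmin
      have hτ3 := hτ2.trans_le (min_le_left _ _)
      have hτ4 := hτ2.trans_le (min_le_right _ _)
      refine ⟨τ / a, ⟨?_, ?_⟩, ?_⟩
      · refine ENNReal.div_lt_div_right ha ha' (lt_trans ?_ hτ1)
        have := h.lt j (by omega)
        exact_mod_cast this
      · simp only [ENNReal.mul_div_cancel ha ha']
        rintro ⟨z, hz, hz'⟩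
        obtain ⟨y, y', hy, e1, e2⟩ := h.edge (j + 1) hj (c (j + 1)) le_rfl (h.lt _ hj)
        have hlt := h.lt j (by omega)
        obtain ⟨q, q', hq, -, e4⟩ := h.edge j (by omega) (c (j + 1) - 1) (by omega) (by omega)
        rw [Nat.sub_add_cancel (by omega)] at e4
        have hN : c (j + 1) < c m := (h.lt _ hj).trans_le (h.le_of_le hj le_rfl)
        rw [interpolate_of_mem hN hτ1.le (by exact_mod_cast hτ4.le), e1, e2, lineMap_psiWord] at hz'
        have hθ : 0 < τ.toReal - c (j + 1) := by
          have := ENNReal.toReal_strict_mono (ne_top_of_lt hτ4) hτ1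
          simpa using this
        have hθ1 : τ.toReal - c (j + 1) ≤ 1 := by
          have := ENNReal.toReal_mono (by simp) hτ4.le
          rw [ENNReal.toReal_add (by simp) (by simp)] at this
          simp at this
          linarith
        have hl := (h.length_word j (by omega)).trans (h.length_word (j + 1) hj).symm
        have hg := lineMap_mem_gasket_of_EG hy ⟨hθ.le, hθ1⟩
        have hyg := VG_subset_gasket k (EG_ends hy).1
        have hqg := VG_subset_gasket k (EG_ends hq).2.1
        obtain ⟨_, _, _, _, huniq⟩ := psiWord_eq_psiWord hl
          (h.word_ne j (by omega) (j + 1) hj (by omega)) hz hg hz'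
        have := (huniq q' hqg y hyg (e4.symm.trans e1)).2
        have := lineMap_eq_left (EG_ends hy).2.2 this.symm
        linarith
      · rwa [ENNReal.div_lt_iff (Or.inl ha) (Or.inl ha'), mul_comm]

end Crossing

/-! ### The crossings of a tree path -/

/-- The point where a crossing enters its part. -/
noncomputable def entry (x : List (Fin 3) × Fin 3 × Fin 3) : Plane := psiWord x.1 (u x.2.1)

/-- The point where a crossing leaves its part. -/
noncomputable def exit (x : List (Fin 3) × Fin 3 × Fin 3) : Plane := psiWord x.1 (u x.2.2)

/-- A list of crossings leads from `p` to `v`. -/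
def Linked (v : Plane) : Plane → List (List (Fin 3) × Fin 3 × Fin 3) → Prop
  | p, [] => p = v
  | p, x :: L => entry x = p ∧ Linked v (exit x) L

theorem Linked.append {p q v : Plane} {L₁ L₂ : List (List (Fin 3) × Fin 3 × Fin 3)}
    (h₁ : Linked q p L₁) (h₂ : Linked v q L₂) : Linked v p (L₁ ++ L₂) := by
  induction L₁ generalizing p with
  | nil => obtain rfl : p = q := h₁; exact h₂
  | cons x L ih => exact ⟨h₁.1, ih h₁.2⟩

theorem Linked.cons {p v : Plane} {L : List (List (Fin 3) × Fin 3 × Fin 3)} (h : Linked v p L)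
    (i : Fin 3) : Linked (psi i v) (psi i p) (L.map fun y => (i :: y.1, y.2)) := by
  induction L generalizing p with
  | nil => obtain rfl : p = v := h; rfl
  | cons x L ih =>
    refine ⟨?_, ih h.2⟩
    rw [← h.1]; rfl

theorem linked_cr : ∀ (n : ℕ) (σ : List (Fin 3) → St) (a b : Fin 3),
    Linked (u b) (u a) (cr n σ a b)
  | 0, σ, a, b => ⟨rfl, rfl⟩
  | n + 1, σ, a, b => by
    have h : ∀ i c d, Linked (psi i (u d)) (psi i (u c))
        ((cr n (sh i σ) c d).map fun y => (i :: y.1, y.2)) := fun i c d => (linked_cr n _ c d).cons i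
    rw [cr]
    rcases route_cases (fun i => σ [i]) a b with ⟨-, hrt⟩ | ⟨-, hrt⟩
    · rw [hrt]
      simp only [List.flatMap_cons, List.flatMap_nil, List.append_nil]
      have h1 := h a a b
      have h2 := h b a b
      rw [psi_u_self] at h1 h2
      rw [psi_u_comm] at h1
      exact h1.append h2
    · rw [hrt]
      simp only [List.flatMap_cons, List.flatMap_nil, List.append_nil]
      have h1 := h a a (third a b)
      have h2 := h (third a b) a b
      have h3 := h b (third a b) b
      rw [psi_u_self] at h1 h3
      rw [psi_u_comm a] at h1
      rw [psi_u_comm b] at h3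
      exact h1.append (h2.append h3)

theorem cr_ne_nil (n : ℕ) (σ : List (Fin 3) → St) {a b : Fin 3} (hab : a ≠ b) :
    cr n σ a b ≠ [] := by
  intro h
  have := linked_cr n σ a b
  rw [h] at this
  exact hab (u_injective this)

theorem cr_words_nodup : ∀ (n : ℕ) (σ : List (Fin 3) → St) {a b : Fin 3}, a ≠ b →
    ((cr n σ a b).map Prod.fst).Nodup
  | 0, σ, a, b, _ => by simp [cr]
  | n + 1, σ, a, b, hab => by
    have hth := third_spec a b hab
    have key : ∀ i c d, (((cr n (sh i σ) c d).map fun y => (i :: y.1, y.2)).map Prod.fst) =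
        ((cr n (sh i σ) c d).map Prod.fst).map (List.cons i) := by
      intro i c d
      simp [List.map_map, Function.comp_def]
    have hn : ∀ i c d, c ≠ d → (((cr n (sh i σ) c d).map Prod.fst).map (List.cons i)).Nodup :=
      fun i c d hcd => (cr_words_nodup n _ hcd).map (List.cons_injective)
    have hd : ∀ {i j : Fin 3} {l l' : List (List (Fin 3))}, i ≠ j →
        ∀ x ∈ l.map (List.cons i), ∀ y ∈ l'.map (List.cons j), x ≠ y := by
      intro i j l l' hij x hx y hy hxy
      obtain ⟨p, -, rfl⟩ := List.mem_map.1 hx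
      obtain ⟨q, -, rfl⟩ := List.mem_map.1 hy
      exact hij (List.cons.inj hxy).1
    rw [cr]
    rcases route_cases (fun i => σ [i]) a b with ⟨-, hrt⟩ | ⟨-, hrt⟩
    · rw [hrt]
      simp only [List.flatMap_cons, List.flatMap_nil, List.append_nil, List.map_append, key]
      exact List.nodup_append.2 ⟨hn _ _ _ hab, hn _ _ _ hab, hd hab⟩
    · rw [hrt]
      simp only [List.flatMap_cons, List.flatMap_nil, List.append_nil, List.map_append, key]
      refine List.nodup_append.2 ⟨hn _ _ _ hth.2.2.1,
        List.nodup_append.2 ⟨hn _ _ _ hab, hn _ _ _ hth.2.2.2, hd hth.2.2.2⟩, ?_⟩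
      intro x hx y hy
      rcases List.mem_append.1 hy with hy | hy
      · exact hd hth.2.2.1 x hx y hy
      · exact hd hab x hx y hy

/-- Blocks omit their last vertex, which is the first vertex of the next block. The bound `q ≤
length` therefore includes the exit of the crossing. -/
theorem getElem?_flatMap {f : List (Fin 3) × Fin 3 × Fin 3 → List Plane} {v : Plane} :
    ∀ {L : List (List (Fin 3) × Fin 3 × Fin 3)} {p : Plane},
    (∀ x ∈ L, (f x).head? = some (entry x)) → Linked v p L →
    (L.flatMap f ++ [v])[0]? = some p ∧
    ∀ (j : ℕ) (hj : j < L.length) (q : ℕ), q ≤ (f L[j]).length →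
      (L.flatMap f ++ [v])[((L.take j).map fun x => (f x).length).sum + q]? =
        (f L[j] ++ [exit L[j]])[q]?
  | [], p, _, hL => by
    obtain rfl : p = v := hL
    exact ⟨rfl, fun j hj => absurd hj (by simp)⟩
  | x :: L, p, hf, hL => by
    obtain ⟨h0, ih⟩ := getElem?_flatMap (fun y hy => hf y (List.mem_cons_of_mem _ hy)) hL.2
    have hx := hf x List.mem_cons_self
    refine ⟨?_, ?_⟩
    · rw [List.flatMap_cons, List.append_assoc, ← List.head?_eq_getElem?, List.head?_append, hx,
        hL.1]; rfl
    · rintro (_ | j) hj q hq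
      · simp only [List.take_zero, List.map_nil, List.sum_nil, zero_add, List.getElem_cons_zero]
          at hq ⊢
        rw [List.flatMap_cons, List.append_assoc]
        rcases hq.lt_or_eq with hq | rfl
        · rw [List.getElem?_append_left hq, List.getElem?_append_left hq]
        · rw [List.getElem?_append_right le_rfl, List.getElem?_append_right le_rfl, Nat.sub_self, h0]
          rfl
      · simp only [List.take_succ_cons, List.map_cons, List.sum_cons, List.getElem_cons_succ]
          at hq ⊢
        rw [List.flatMap_cons, List.append_assoc, add_assoc,
          List.getElem?_append_right (Nat.le_add_right _ _), Nat.add_sub_cancel_left]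
        exact ih j (by simpa using hj) q hq

/-- The number of edges of the path from `a` to `b` in the graph of level `k`. -/
noncomputable def len (k : ℕ) (σ : List (Fin 3) → St) (a b : Fin 3) : ℕ := (vl k σ a b).length

theorem len_pos (k : ℕ) (σ : List (Fin 3) → St) (a b : Fin 3) : 0 < len k σ a b := by
  rw [len, List.length_pos_iff]
  intro h
  have := vl_head k σ a b
  rw [h] at this
  cases this

/-! ### The path of a limit tree, cut into its crossings of parts -/

section Tree

variable (T : LimitTree)

/-- The crossings of `n`-parts by the path from `u 0` to `u 1` in a limit tree. -/
noncomputable def crT (n : ℕ) : List (List (Fin 3) × Fin 3 × Fin 3) := cr n (states T) 0 1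

/-- The number of crossings. -/
noncomputable def num (n : ℕ) : ℕ := (crT T n).length

/-- The `(j+1)`-st crossing. -/
noncomputable def crossing (n j : ℕ) : List (Fin 3) × Fin 3 × Fin 3 := (crT T n).getD j ([], 0, 1)

/-- The number of edges of level `n + k` in the `(j+1)`-st crossing of level `n`. -/
noncomputable def dur (n k j : ℕ) : ℕ :=
  len k (shw (crossing T n j).1 (states T)) (crossing T n j).2.1 (crossing T n j).2.2

/-- The number of edges of level `n + k` in the first `j` crossings of level `n`. -/
noncomputable def cum (n k j : ℕ) : ℕ := ∑ i ∈ Finset.range j, dur T n k i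

/-- The `j`-th vertex of level `n` which separates two crossings. -/
noncomputable def vert (n j : ℕ) : Plane := if j < num T n then entry (crossing T n j) else u 1

theorem crossing_eq {n j : ℕ} (hj : j < num T n) : crossing T n j = (crT T n)[j]'hj := by
  rw [crossing, List.getD_eq_getElem _ _ hj]

theorem num_pos (n : ℕ) : 1 ≤ num T n :=
  List.length_pos_iff.2 (cr_ne_nil n _ (by decide))

theorem conn_states (a b : Fin 3) : conn (states T []) a b :=
  ((isTree_iff _).1 (isTree_states T)).2 a b

theorem crossing_spec {n j : ℕ} (hj : j < num T n) : (crossing T n j).1.length = n ∧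
    (crossing T n j).2.1 ≠ (crossing T n j).2.2 ∧
    conn (states T (crossing T n j).1) (crossing T n j).2.1 (crossing T n j).2.2 := by
  refine cr_spec n (consistent_states T) (by decide) (conn_states T 0 1) _ ?_
  rw [crossing_eq T hj]
  exact List.getElem_mem _

theorem cum_eq {n k j : ℕ} (hj : j ≤ num T n) : cum T n k j =
    (((crT T n).take j).map fun x =>
      ((vl k (shw x.1 (states T)) x.2.1 x.2.2).map (psiWord x.1)).length).sum := by
  induction j with
  | zero => simp [cum]
  | succ j ih =>
    rw [cum, Finset.sum_range_succ]
    have := ih (by omega)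
    rw [cum] at this
    rw [this, List.take_add_one, List.getElem?_eq_getElem (by exact hj)]
    simp [dur, crossing_eq T hj, len]

theorem exit_eq {n j : ℕ} (hj : j < num T n) : exit (crossing T n j) = vert T n (j + 1) := by
  have key : ∀ (L : List (List (Fin 3) × Fin 3 × Fin 3)) (p v : Plane), Linked v p L →
      ∀ j (hj : j < L.length), exit (L[j]) = if h : j + 1 < L.length then entry (L[j + 1]) else v := by
    intro L
    induction L with
    | nil => intro p v _ j hj; simp at hj
    | cons x L ih =>
      intro p v h j hj
      obtain _ | j := j
      · cases L with
        | nil => exact h.2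
        | cons y L => simpa using h.2.1.symm
      · simpa using ih _ v h.2 j (by simpa using hj)
  have := key (crT T n) _ _ (linked_cr n (states T) 0 1) j hj
  rw [crossing_eq T hj, this, vert]
  split_ifs with h1 h2 h2
  · rw [crossing_eq T h2]; rfl
  · exact absurd h1 h2
  · exact absurd h2 h1
  · rfl

theorem getVert_block {n k j q : ℕ} (hj : j < num T n) (hq : q ≤ dur T n k j) :
    some ((treePath (T.proj (k + n))).getVert (cum T n k j + q)) =
      ((vl k (shw (crossing T n j).1 (states T)) (crossing T n j).2.1 (crossing T n j).2.2 ++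
        [u (crossing T n j).2.2]).map (psiWord (crossing T n j).1))[q]? := by
  have h := (getElem?_flatMap (f := fun x => (vl k (shw x.1 (states T)) x.2.1 x.2.2).map (psiWord x.1))
    (fun x _ => by rw [List.head?_map, vl_head]; rfl) (linked_cr n (states T) 0 1)).2 j hj q
    (by rw [List.length_map]; rw [dur, crossing_eq T hj] at hq; exact hq)
  have hc := cum_eq T (k := k) hj.le
  rw [crT] at hc
  rw [← vl_add, ← hc, ← treePath_support] at h
  have h2 : ((vl k (shw (crossing T n j).1 (states T)) (crossing T n j).2.1 (crossing T n j).2.2 ++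
        [u (crossing T n j).2.2]).map (psiWord (crossing T n j).1))[q]? =
      (treePath (T.proj (k + n))).support[cum T n k j + q]? := by
    rw [h, crossing_eq T hj, List.map_append]
    rfl
  rw [h2, SimpleGraph.Walk.getVert_eq_support_getElem?]
  have hlt : q < (vl k (shw (crossing T n j).1 (states T)) (crossing T n j).2.1 (crossing T n j).2.2 ++
        [u (crossing T n j).2.2]).length := by
    rw [List.length_append]
    simp only [List.length_cons, List.length_nil]
    rw [dur, len] at hq
    omega
  by_contra! hle
  have h3 : (treePath (T.proj (k + n))).support[cum T n k j + q]? = none :=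
    List.getElem?_eq_none (by rw [SimpleGraph.Walk.length_support]; exact hle)
  rw [h3, List.getElem?_eq_getElem (by rw [List.length_map]; exact hlt)] at h2
  cases h2

theorem cum_num (n k : ℕ) : cum T n k (num T n) = (treePath (T.proj (k + n))).length := by
  have h := congrArg List.length (treePath_support T (k + n))
  rw [SimpleGraph.Walk.length_support, List.length_append, vl_add] at h
  have h2 : (treePath (T.proj (k + n))).length = ((cr n (states T) 0 1).flatMap fun x =>
      (vl k (shw x.1 (states T)) x.2.1 x.2.2).map (psiWord x.1)).length := by
    simpa using h
  rw [h2, List.length_flatMap, cum_eq T le_rfl, num, List.take_length]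
  rfl

theorem getVert_cum {n k j : ℕ} (hj : j ≤ num T n) :
    (treePath (T.proj (k + n))).getVert (cum T n k j) = vert T n j := by
  rcases hj.lt_or_eq with h | rfl
  · have := getVert_block T (k := k) (q := 0) h (Nat.zero_le _)
    rw [add_zero, List.getElem?_map, ← List.head?_eq_getElem?, List.head?_append, vl_head] at this
    rw [vert, if_pos h]
    exact Option.some_inj.1 this
  · rw [cum_num, SimpleGraph.Walk.getVert_length, vert, if_neg (lt_irrefl _)]

theorem crossingData (n k : ℕ) : CrossingData n k (treePath (T.proj (k + n))).getVert (num T n)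
    (cum T n k) (fun j => (crossing T n j).1) where
  one_le := num_pos T n
  zero := by simp [cum]
  lt j _ := by
    rw [cum, cum, Finset.sum_range_succ]
    exact Nat.lt_add_of_pos_right (len_pos ..)
  length_word j hj := (crossing_spec T hj).1
  word_ne i hi j hj hij h := by
    have hn := cr_words_nodup n (states T) (a := 0) (b := 1) (by decide)
    simp only [crossing_eq T hi, crossing_eq T hj] at h
    refine hij ((List.Nodup.getElem_inj_iff hn (hi := by rw [List.length_map]; exact hi)
      (hj := by rw [List.length_map]; exact hj)).1 ?_)
    rw [List.getElem_map, List.getElem_map]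
    exact h
  edge j hj N h1 h2 := by
    obtain ⟨q, rfl⟩ : ∃ q, N = cum T n k j + q := ⟨N - cum T n k j, by omega⟩
    have hq : q + 1 ≤ dur T n k j := by
      have : cum T n k (j + 1) = cum T n k j + dur T n k j := by
        rw [cum, cum, Finset.sum_range_succ]
      omega
    have e1 := getVert_block T (k := k) (q := q) hj (by omega)
    have e2 := getVert_block T (k := k) (q := q + 1) hj hq
    obtain ⟨s1, s2, s3⟩ := crossing_spec T hj
    rw [dur, len] at hq
    set w := (crossing T n j).1
    have hcs : Consistent (shw w (states T)) := (consistent_states T).shw w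
    have hch := vl_chain k hcs s2 (by simpa [shw] using s3)
    have hlen : q + 1 < (vl k (shw w (states T)) (crossing T n j).2.1 (crossing T n j).2.2 ++
        [u (crossing T n j).2.2]).length := by
      rw [List.length_append]
      simp only [List.length_cons, List.length_nil]
      omega
    rw [List.getElem?_map, List.getElem?_eq_getElem (by omega)] at e1
    rw [List.getElem?_map, List.getElem?_eq_getElem hlen] at e2
    refine ⟨_, _, dec_subset k _ ((SimpleGraph.fromEdgeSet_adj _).1 (hch.getElem q hlen)).1,
      Option.some_inj.1 e1, Option.some_inj.1 e2⟩
  last := by rw [getVert_cum T le_rfl, vert, if_neg (lt_irrefl _)]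

/-- The separating vertices occur at increasing positions on a simple path. -/
theorem vert_injective {n i j : ℕ} (hi : i ≤ num T n) (hj : j ≤ num T n)
    (h : vert T n i = vert T n j) : i = j := by
  have hp : (treePath (T.proj (0 + n))).IsPath :=
    ((T.proj (0 + n)).2.2 _ (u_mem_VG 0 _) _ (u_mem_VG 1 _)).exists_isPath.choose_spec
  have hd := crossingData T n 0
  have hmono : ∀ {i j}, i < j → j ≤ num T n → cum T n 0 i < cum T n 0 j := fun {i j} hij hj =>
    (hd.lt i (by omega)).trans_le (hd.le_of_le hij hj)
  rw [← getVert_cum T (k := 0) hi, ← getVert_cum T (k := 0) hj] at h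
  have h2 := (SimpleGraph.Walk.IsPath.getVert_injOn hp)
    (show cum T n 0 i ≤ _ by rw [← cum_num]; exact hd.le_of_le hi le_rfl)
    (show cum T n 0 j ≤ _ by rw [← cum_num]; exact hd.le_of_le hj le_rfl) h
  rcases lt_trichotomy i j with hij | hij | hij
  · exact absurd h2 (hmono hij hj).ne
  · exact hij
  · exact absurd h2 (hmono hij hi).ne'

theorem vert_zero (n : ℕ) : vert T n 0 = u 0 := by
  have := getVert_cum T (k := 0) (Nat.zero_le (num T n))
  rw [← this, (crossingData T n 0).zero, SimpleGraph.Walk.getVert_zero]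

theorem vert_num (n : ℕ) : vert T n (num T n) = u 1 := if_neg (lt_irrefl _)

/-- The time scale of the curve of level `m`. -/
noncomputable def scale (m : ℕ) : ℝ≥0∞ := ENNReal.ofReal (alpha ^ m)

theorem alpha_pos : 0 < alpha := by unfold alpha; positivity

theorem scale_ne_zero (m : ℕ) : scale m ≠ 0 := by
  rw [scale, ne_eq, ENNReal.ofReal_eq_zero, not_le]
  exact pow_pos alpha_pos m

theorem scale_ne_top (m : ℕ) : scale m ≠ ∞ := ENNReal.ofReal_ne_top

theorem X_eq (n k : ℕ) : X T (k + n) = fun t => interpolate (cum T n k (num T n))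
    (treePath (T.proj (k + n))).getVert (scale (k + n) * t) := by
  funext t
  rw [cum_num]; rfl

theorem isPartDecomp_X (n k : ℕ) : IsPartDecomp n (X T (k + n)) (num T n)
    (fun j => cum T n k j / scale (k + n)) (fun j => (crossing T n j).1) := by
  rw [X_eq]
  exact (crossingData T n k).isPartDecomp (scale_ne_zero _) (scale_ne_top _)

theorem numParts_X (n k : ℕ) : numParts n (X T (k + n)) = num T n :=
  numParts_eq (isPartDecomp_X T n k)

theorem numParts_X_self (n : ℕ) : numParts n (X T n) = num T n := by
  have := numParts_X T n 0
  rwa [zero_add] at this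

theorem partTime_X {n k j : ℕ} (hj : j ≤ num T n) :
    partTime j n (X T (k + n)) = cum T n k j / scale (k + n) :=
  partTime_eq (isPartDecomp_X T n k) hj

theorem partDuration_X {n k j : ℕ} (hj : j < num T n) :
    partDuration (j + 1) n (X T (k + n)) = dur T n k j / scale (k + n) := by
  rw [partDuration, partTime_X T hj, Nat.add_sub_cancel, partTime_X T hj.le, cum,
    Finset.sum_range_succ, ← cum]
  push_cast
  rw [ENNReal.add_div, ENNReal.add_sub_cancel_left]
  exact ENNReal.div_ne_top (by simp) (scale_ne_zero _)

theorem X_partTime {n k j : ℕ} (hj : j ≤ num T n) :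
    X T (k + n) (cum T n k j / scale (k + n)) = vert T n j := by
  rw [X_eq]
  simp only [ENNReal.mul_div_cancel (scale_ne_zero _) (scale_ne_top _)]
  rw [(crossingData T n k).at_time hj, getVert_cum T hj]

theorem continuous_X (m : ℕ) : Continuous (X T m) :=
  (continuous_interpolate _ _).comp (ENNReal.continuous_const_mul (scale_ne_top m))

end Tree

/-! ### The limit curve -/

section Limit

variable {T : LimitTree}

theorem tendsto_partDuration (h : DurationsConverge T) {n j : ℕ} (hj : j < num T n) :
    0 < Slim T (j + 1) n ∧ Slim T (j + 1) n < ∞ ∧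
      Tendsto (fun m => partDuration (j + 1) n (X T m)) atTop (𝓝 (Slim T (j + 1) n)) := by
  obtain ⟨S, h1, h2, h3⟩ := h n (j + 1) (by omega) (by rw [numParts_X_self]; exact hj)
  rw [Slim, h3.limUnder_eq]
  exact ⟨h1, h2, h3⟩

theorem partTime_succ_X {n m j : ℕ} (hm : n ≤ m) (hj : j < num T n) :
    partTime (j + 1) n (X T m) = partTime j n (X T m) + partDuration (j + 1) n (X T m) := by
  obtain ⟨k, rfl⟩ := Nat.exists_eq_add_of_le' hm
  rw [partDuration_X T hj, partTime_X T hj, partTime_X T hj.le, cum, Finset.sum_range_succ, ← cum]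
  push_cast
  rw [ENNReal.add_div]

theorem partTime_zero_X {n m : ℕ} (hm : n ≤ m) : partTime 0 n (X T m) = 0 := by
  obtain ⟨k, rfl⟩ := Nat.exists_eq_add_of_le' hm
  rw [partTime_X T (Nat.zero_le _)]
  simp [cum]

theorem exists_tendsto_partTime (h : DurationsConverge T) (n j : ℕ) (hj : j ≤ num T n) :
    ∃ s, Tendsto (fun m => partTime j n (X T m)) atTop (𝓝 s) := by
  induction j with
  | zero =>
    refine ⟨0, tendsto_const_nhds.congr' ?_⟩
    filter_upwards [eventually_ge_atTop n] with m hm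
    exact (partTime_zero_X hm).symm
  | succ j ih =>
    obtain ⟨s, hs⟩ := ih (by omega)
    refine ⟨_, (hs.add (tendsto_partDuration h hj).2.2).congr' ?_⟩
    filter_upwards [eventually_ge_atTop n] with m hm
    exact (partTime_succ_X hm hj).symm

theorem tendsto_partTime (h : DurationsConverge T) {n j : ℕ} (hj : j ≤ num T n) :
    Tendsto (fun m => partTime j n (X T m)) atTop (𝓝 (Tlim T j n)) := by
  obtain ⟨s, hs⟩ := exists_tendsto_partTime h n j hj
  rw [Tlim, hs.limUnder_eq]
  exact hs

theorem Tlim_zero (h : DurationsConverge T) (n : ℕ) : Tlim T 0 n = 0 := by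
  refine tendsto_nhds_unique (tendsto_partTime h (Nat.zero_le _)) (tendsto_const_nhds.congr' ?_)
  filter_upwards [eventually_ge_atTop n] with m hm
  exact (partTime_zero_X hm).symm

theorem Tlim_succ (h : DurationsConverge T) {n j : ℕ} (hj : j < num T n) :
    Tlim T (j + 1) n = Tlim T j n + Slim T (j + 1) n := by
  refine tendsto_nhds_unique (tendsto_partTime h hj)
    (((tendsto_partTime h hj.le).add (tendsto_partDuration h hj).2.2).congr' ?_)
  filter_upwards [eventually_ge_atTop n] with m hm
  exact (partTime_succ_X hm hj).symm

theorem Tlim_lt_top (h : DurationsConverge T) {n j : ℕ} (hj : j ≤ num T n) : Tlim T j n < ∞ := by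
  induction j with
  | zero => rw [Tlim_zero h]; exact ENNReal.zero_lt_top
  | succ j ih =>
    rw [Tlim_succ h hj]
    exact ENNReal.add_lt_top.2 ⟨ih (by omega), (tendsto_partDuration h hj).2.1⟩

theorem Tlim_lt_succ (h : DurationsConverge T) {n j : ℕ} (hj : j < num T n) :
    Tlim T j n < Tlim T (j + 1) n := by
  rw [Tlim_succ h hj]
  exact ENNReal.lt_add_right (Tlim_lt_top h hj.le).ne (tendsto_partDuration h hj).1.ne'

theorem Tlim_lt (h : DurationsConverge T) {n i j : ℕ} (hij : i < j) (hj : j ≤ num T n) :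
    Tlim T i n < Tlim T j n := by
  induction j, hij using Nat.le_induction with
  | base => exact Tlim_lt_succ h hj
  | succ j _ ih => exact (ih (by omega)).trans (Tlim_lt_succ h hj)

theorem Tlim_le (h : DurationsConverge T) {n i j : ℕ} (hij : i ≤ j) (hj : j ≤ num T n) :
    Tlim T i n ≤ Tlim T j n := by
  rcases hij.lt_or_eq with h1 | rfl
  · exact (Tlim_lt h h1 hj).le
  · exact le_rfl

/-- For every fixed curve `X T m` the last time of the decomposition is its end time, whatever the
level. -/
theorem Tlim_num (h : DurationsConverge T) (n : ℕ) :
    Tlim T (num T n) n = Tlim T (num T 0) 0 := by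
  refine tendsto_nhds_unique (tendsto_partTime h le_rfl)
    ((tendsto_partTime h le_rfl).congr' ?_)
  filter_upwards [eventually_ge_atTop n] with m hm
  obtain ⟨k, rfl⟩ := Nat.exists_eq_add_of_le' hm
  have h1 := (isPartDecomp_partDecomp (isPartDecomp_X T n k)).time_last
  have h2 := (isPartDecomp_partDecomp (isPartDecomp_X T 0 (k + n))).time_last
  rw [numParts_X] at h1
  rw [numParts_X] at h2
  rw [h1]
  exact h2

/-- Every time belongs to one of finitely many consecutive intervals. -/
theorem exists_interval (s : ℕ → ℝ≥0∞) (h0 : s 0 = 0) {m : ℕ} (t : ℝ≥0∞) (hm : 1 ≤ m) :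
    ∃ j < m, s j ≤ t ∧ (j + 1 < m → t ≤ s (j + 1)) := by
  induction m, hm using Nat.le_induction with
  | base => exact ⟨0, by omega, by simp [h0], by omega⟩
  | succ m hm ih =>
    obtain ⟨j, hj, h1, h2⟩ := ih
    by_cases h3 : j + 1 < m
    · exact ⟨j, by omega, h1, fun _ => h2 h3⟩
    · obtain rfl : m = j + 1 := by omega
      rcases le_total t (s (j + 1)) with h4 | h4
      · exact ⟨j, by omega, h1, fun _ => h4⟩
      · exact ⟨j + 1, by omega, h4, by omega⟩

theorem entry_mem {n j : ℕ} (hj : j < num T n) :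
    vert T n j ∈ psiWord (crossing T n j).1 '' gasket := by
  rw [vert, if_pos hj]
  exact ⟨_, u_mem_gasket _, rfl⟩

theorem exit_mem {n j : ℕ} (hj : j < num T n) :
    vert T n (j + 1) ∈ psiWord (crossing T n j).1 '' gasket := by
  rw [← exit_eq T hj]
  exact ⟨_, u_mem_gasket _, rfl⟩

theorem vert_mem_VG (n j : ℕ) : vert T n j ∈ VG n := by
  rw [vert]
  split_ifs with h
  · exact mem_VG_iff.2 ⟨_, (crossing_spec T h).1, _, rfl⟩
  · exact u_mem_VG 1 n

theorem X_mem_part {n m j : ℕ} (hm : n ≤ m) (hj : j < num T n) {t : ℝ≥0∞}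
    (h1 : partTime j n (X T m) ≤ t) (h2 : j + 1 < num T n → t ≤ partTime (j + 1) n (X T m)) :
    X T m t ∈ psiWord (crossing T n j).1 '' gasket := by
  obtain ⟨k, rfl⟩ := Nat.exists_eq_add_of_le' hm
  have hd := isPartDecomp_X T n k
  rcases le_total t (partTime (j + 1) n (X T (k + n))) with h3 | h3
  · refine hd.subset_part j hj ⟨t, ⟨?_, ?_⟩, rfl⟩
    · rwa [partTime_X T hj.le] at h1
    · rwa [partTime_X T hj] at h3
  · have hv := exit_mem hj
    by_cases h4 : j + 1 < num T n
    · have : t = partTime (j + 1) n (X T (k + n)) := le_antisymm (h2 h4) h3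
      rw [this, partTime_X T hj, X_partTime T hj]
      exact hv
    · have e : j + 1 = num T n := by omega
      rw [e, vert_num] at hv
      rw [partTime_X T hj, ENNReal.div_le_iff_le_mul (Or.inl (scale_ne_zero _))
        (Or.inl (scale_ne_top _)), mul_comm, Nat.succ_eq_add_one, e] at h3
      rw [X_eq]
      simp only
      rw [interpolate_of_le h3, getVert_cum T le_rfl, vert_num]
      exact hv

theorem part_dist_le {D : ℝ} (hD : ∀ x ∈ gasket, ∀ y ∈ gasket, dist x y ≤ D) {w : List (Fin 3)}
    {p q : Plane} (hp : p ∈ psiWord w '' gasket) (hq : q ∈ psiWord w '' gasket) :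
    dist p q ≤ (1 / 2) ^ w.length * D := by
  obtain ⟨x, hx, rfl⟩ := hp
  obtain ⟨y, hy, rfl⟩ := hq
  rw [dist_psiWord]
  exact mul_le_mul_of_nonneg_left (hD x hx y hy) (by positivity)

theorem adjacent_dist_le {D : ℝ} (hD0 : 0 < D) (hD : ∀ x ∈ gasket, ∀ y ∈ gasket, dist x y ≤ D)
    {n i j : ℕ} (hi : i < num T n) (hj : j < num T n) (hij : i ≤ j + 1) (hji : j ≤ i + 1)
    {p q : Plane} (hp : p ∈ psiWord (crossing T n i).1 '' gasket)
    (hq : q ∈ psiWord (crossing T n j).1 '' gasket) : dist p q ≤ 2 * ((1 / 2) ^ n * D) := by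
  have li := (crossing_spec T hi).1
  have lj := (crossing_spec T hj).1
  have hpos : 0 ≤ (1 / 2 : ℝ) ^ n * D := by positivity
  obtain h | h | h : i = j ∨ i = j + 1 ∨ j = i + 1 := by omega
  · subst h
    have := part_dist_le hD hp hq
    rw [li] at this
    linarith
  · subst h
    have h1 := part_dist_le hD hp (entry_mem hi)
    have h2 := part_dist_le hD (exit_mem hj) hq
    rw [li] at h1
    rw [lj] at h2
    have := dist_triangle p (vert T n (j + 1)) q
    linarith
  · subst h
    have h1 := part_dist_le hD hp (exit_mem hi)
    have h2 := part_dist_le hD (entry_mem hj) hq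
    rw [li] at h1
    rw [lj] at h2
    have := dist_triangle p (vert T n (i + 1)) q
    linarith

theorem eventually_separated (h : DurationsConverge T) (n : ℕ) : ∃ r : ℕ → ℝ≥0∞,
    ∀ᶠ m in atTop, n ≤ m ∧ ∀ j < num T n,
      partTime j n (X T m) < r j ∧ r j < partTime (j + 1) n (X T m) := by
  have : ∀ j, ∃ r, j < num T n → Tlim T j n < r ∧ r < Tlim T (j + 1) n := by
    intro j
    by_cases hj : j < num T n
    · obtain ⟨r, hr⟩ := exists_between (Tlim_lt_succ h hj)
      exact ⟨r, fun _ => hr⟩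
    · exact ⟨0, fun h => absurd h hj⟩
  choose r hr using this
  refine ⟨r, (eventually_ge_atTop n).and ?_⟩
  have : ∀ j ∈ Finset.range (num T n), ∀ᶠ m in atTop,
      partTime j n (X T m) < r j ∧ r j < partTime (j + 1) n (X T m) := by
    intro j hj
    have hj : j < num T n := by simpa using hj
    exact ((tendsto_partTime h hj.le).eventually_lt_const (hr j hj).1).and
      ((tendsto_partTime h hj).eventually_const_lt (hr j hj).2)
  filter_upwards [(Filter.eventually_all_finset _).2 this] with m hm j hj
  exact hm j (by simpa using hj)

/-- At large indices the times of level `n` of all curves are close to their limits. At any time two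
curves are then in the same or in consecutive `n`-parts; consecutive parts share a vertex, so the
distance is at most two diameters of parts. -/
theorem uniformCauchySeqOn_X (h : DurationsConverge T) :
    UniformCauchySeqOn (X T) atTop Set.univ := by
  obtain ⟨D, hD0, hD⟩ := exists_dist_le
  rw [Metric.uniformCauchySeqOn_iff]
  intro ε hε
  have hlim : Tendsto (fun n : ℕ => 2 * ((1 / 2 : ℝ) ^ n * D)) atTop (𝓝 0) := by
    simpa using ((tendsto_pow_atTop_nhds_zero_of_lt_one (by norm_num : (0 : ℝ) ≤ 1 / 2)
      (by norm_num)).mul_const D).const_mul 2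
  obtain ⟨n, hn⟩ := (hlim.eventually (gt_mem_nhds hε)).exists
  obtain ⟨r, hr⟩ := eventually_separated h n
  obtain ⟨M, hM⟩ := eventually_atTop.1 hr
  refine ⟨M, fun m hm m' hm' t _ => lt_of_le_of_lt ?_ hn⟩
  obtain ⟨e1, f1⟩ := hM m hm
  obtain ⟨e2, f2⟩ := hM m' hm'
  obtain ⟨i, hi, i1, i2⟩ := exists_interval (fun j => partTime j n (X T m)) (partTime_zero_X e1) t
    (num_pos T n)
  obtain ⟨j, hj, j1, j2⟩ := exists_interval (fun j => partTime j n (X T m')) (partTime_zero_X e2) t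
    (num_pos T n)
  -- The separators `r` lie in the corresponding intervals of both curves. If one curve were two
  -- intervals ahead at time `t`, then `t` would lie on both sides of `r (j + 1)`.
  have key : ∀ {s s' : ℕ → ℝ≥0∞} {i j : ℕ}, (∀ j < num T n, s j < r j ∧ r j < s (j + 1)) →
      (∀ j < num T n, s' j < r j ∧ r j < s' (j + 1)) → i < num T n → s i ≤ t →
      (j + 1 < num T n → t ≤ s' (j + 1)) → i ≤ j + 1 := by
    intro s s' i j hs hs' hi hit hjt
    by_contra! hlt
    have mono : ∀ l, j + 2 ≤ l → l < num T n → s (j + 2) ≤ s l := by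
      intro l hl
      induction l, hl using Nat.le_induction with
      | base => exact fun _ => le_rfl
      | succ l _ ih =>
        intro hl
        have := hs l (by omega)
        exact (ih (by omega)).trans (this.1.trans this.2).le
    have a1 := hjt (by omega)
    have a2 := (hs' (j + 1) (by omega)).1
    have a3 := (hs (j + 1) (by omega)).2
    have a4 := mono i (by omega) hi
    exact lt_irrefl _ ((a1.trans_lt (a2.trans a3)).trans_le (a4.trans hit))
  exact adjacent_dist_le hD0 hD hi hj (key f1 f2 hi i1 j2) (key f2 f1 hj j1 i2)
    (X_mem_part e1 hi i1 i2) (X_mem_part e2 hj j1 j2)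

theorem tendsto_X (h : DurationsConverge T) (t : ℝ≥0∞) :
    Tendsto (fun m => X T m t) atTop (𝓝 (Xlim T t)) := by
  have hc : CauchySeq fun m => X T m t := by
    rw [Metric.cauchySeq_iff]
    intro ε hε
    obtain ⟨N, hN⟩ := Metric.uniformCauchySeqOn_iff.1 (uniformCauchySeqOn_X h) ε hε
    exact ⟨N, fun m hm m' hm' => hN m hm m' hm' t trivial⟩
  exact CauchySeq.tendsto_limUnder hc

theorem tendstoUniformly_X (h : DurationsConverge T) :
    TendstoUniformly (X T) (Xlim T) atTop := by
  rw [← tendstoUniformlyOn_univ]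
  exact (uniformCauchySeqOn_X h).tendstoUniformlyOn_of_tendsto fun t _ => tendsto_X h t

theorem continuous_Xlim (h : DurationsConverge T) : Continuous (Xlim T) :=
  (tendstoUniformly_X h).continuous (Frequently.of_forall fun m => continuous_X T m)

/-- Uniform convergence allows the curve and the time to pass to the limit together. -/
theorem Xlim_Tlim (h : DurationsConverge T) {n j : ℕ} (hj : j ≤ num T n) :
    Xlim T (Tlim T j n) = vert T n j := by
  refine tendsto_nhds_unique ((tendstoUniformly_X h).tendsto_comp
    (continuous_Xlim h).continuousAt (tendsto_partTime h hj)) (tendsto_const_nhds.congr' ?_)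
  filter_upwards [eventually_ge_atTop n] with m hm
  obtain ⟨k, rfl⟩ := Nat.exists_eq_add_of_le' hm
  rw [partTime_X T hj, X_partTime T hj]

theorem Xlim_mem_of_eventually (h : DurationsConverge T) {n j : ℕ} (hj : j < num T n) {S : Set Plane}
    (hS : IsClosed S) {t : ℝ≥0∞} (h1 : Tlim T j n < t) (h2 : t < Tlim T (j + 1) n)
    (hev : ∀ᶠ m in atTop, partTime j n (X T m) ≤ t → t ≤ partTime (j + 1) n (X T m) →
      X T m t ∈ S) : Xlim T t ∈ S := by
  refine hS.mem_of_tendsto (tendsto_X h t) ?_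
  filter_upwards [hev, (tendsto_partTime h hj.le).eventually_lt_const h1,
    (tendsto_partTime h hj).eventually_const_lt h2] with m e1 e2 e3
  exact e1 e2.le e3.le

theorem isClosed_part (w : List (Fin 3)) : IsClosed (psiWord w '' gasket) :=
  (gasket_spec.2.1.image (continuous_psiWord w)).isClosed

theorem Xlim_mem_part (h : DurationsConverge T) {n j : ℕ} (hj : j < num T n) {t : ℝ≥0∞}
    (h1 : Tlim T j n ≤ t) (h2 : t ≤ Tlim T (j + 1) n) :
    Xlim T t ∈ psiWord (crossing T n j).1 '' gasket := by
  rcases h1.lt_or_eq with h1 | rfl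
  · rcases h2.lt_or_eq with h2 | rfl
    · refine Xlim_mem_of_eventually h hj (isClosed_part _) h1 h2 ?_
      filter_upwards [eventually_ge_atTop n] with m hm e1 e2
      exact X_mem_part hm hj e1 fun _ => e2
    · rw [Xlim_Tlim h hj]; exact exit_mem hj
  · rw [Xlim_Tlim h hj.le]; exact entry_mem hj

theorem Xlim_of_le (h : DurationsConverge T) {n : ℕ} {t : ℝ≥0∞} (ht : Tlim T (num T n) n ≤ t) :
    Xlim T t = u 1 := by
  rcases ht.lt_or_eq with ht | rfl
  · refine tendsto_nhds_unique (tendsto_X h t) (tendsto_const_nhds.congr' ?_)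
    filter_upwards [eventually_ge_atTop n, (tendsto_partTime h le_rfl).eventually_lt_const ht]
      with m hm hlt
    obtain ⟨k, rfl⟩ := Nat.exists_eq_add_of_le' hm
    rw [partTime_X T le_rfl] at hlt
    have hlt := hlt.le
    rw [ENNReal.div_le_iff_le_mul (Or.inl (scale_ne_zero _)) (Or.inl (scale_ne_top _)),
      mul_comm] at hlt
    rw [X_eq]
    simp only
    rw [interpolate_of_le hlt, getVert_cum T le_rfl, vert_num]
  · rw [Xlim_Tlim h le_rfl, vert_num]

theorem part_subset_gasket (w : List (Fin 3)) : psiWord w '' gasket ⊆ gasket := by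
  rintro _ ⟨x, hx, rfl⟩
  exact psiWord_mem_gasket hx w

theorem exists_Tlim_interval (h : DurationsConverge T) (n : ℕ) (t : ℝ≥0∞) :
    ∃ j < num T n, Tlim T j n ≤ t ∧ (t ≤ Tlim T (num T n) n → t ≤ Tlim T (j + 1) n) := by
  obtain ⟨j, hj, h1, h2⟩ := exists_interval (fun j => Tlim T j n) (Tlim_zero h n) t (num_pos T n)
  refine ⟨j, hj, h1, fun h3 => ?_⟩
  by_cases h4 : j + 1 < num T n
  · exact h2 h4
  · have : j + 1 = num T n := by omega
    rwa [this]

theorem isCurve_Xlim (h : DurationsConverge T) : IsCurve (Xlim T) where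
  continuous := continuous_Xlim h
  mem_gasket t := by
    obtain ⟨j, hj, h1, h2⟩ := exists_Tlim_interval h 0 t
    rcases le_total t (Tlim T (num T 0) 0) with h3 | h3
    · exact part_subset_gasket _ (Xlim_mem_part h hj h1 (h2 h3))
    · rw [Xlim_of_le h h3]; exact u_mem_gasket 1
  start := by
    have := Xlim_Tlim h (Nat.zero_le (num T 0))
    rwa [Tlim_zero h, vert_zero] at this
  finish := Xlim_of_le h (n := 0) le_top

/-! ### Self-avoidance and the decomposition of the limit curve -/

section Injective

variable (h : DurationsConverge T)
  (hdis : ∀ n i j, 1 ≤ i → i + 1 < j → j ≤ numParts n (X T n) →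
    Xlim T '' Set.Icc (Tlim T (i - 1) n) (Tlim T i n) ∩
      Xlim T '' Set.Icc (Tlim T (j - 1) n) (Tlim T j n) = ∅)
  (hmax : Tendsto (fun n => ⨆ j ∈ Set.Icc 1 (numParts n (X T n)), Slim T j n) atTop (𝓝 0))

include h hdis hmax

/-- At a level where all durations are below half the time difference, the two times fall into
non-consecutive intervals, whose images are disjoint by assumption. -/
theorem Xlim_ne {s t : ℝ≥0∞} (hst : s < t) (ht : t ≤ Tlim T (num T 0) 0) :
    Xlim T s ≠ Xlim T t := by
  have ht' : t ≠ ∞ := ne_top_of_le_ne_top (Tlim_lt_top h le_rfl).ne ht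
  have hpos : 0 < (t - s) / 2 := ENNReal.half_pos (tsub_pos_of_lt hst).ne'
  obtain ⟨n, hn⟩ := (hmax.eventually (gt_mem_nhds hpos)).exists
  have hS : ∀ j < num T n, Slim T (j + 1) n < (t - s) / 2 := by
    intro j hj
    refine lt_of_le_of_lt ?_ hn
    exact le_iSup₂ (f := fun j (_ : j ∈ Set.Icc 1 (numParts n (X T n))) => Slim T j n) (j + 1)
      ⟨by omega, by rw [numParts_X_self]; exact hj⟩
  obtain ⟨i, hi, i1, i2⟩ := exists_Tlim_interval h n s
  obtain ⟨j, hj, j1, j2⟩ := exists_Tlim_interval h n t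
  rw [Tlim_num h n] at i2 j2
  have i2 := i2 (hst.le.trans ht)
  have j2 := j2 ht
  -- Otherwise `t` comes no later than the end of the interval after that of `s`, and two durations
  -- would cover `t - s`.
  have hij : i + 1 < j := by
    by_contra! hle
    have h1 : t ≤ s + (t - s) / 2 + Slim T (j + 1) n := by
      refine j2.trans ?_
      rw [Tlim_succ h hj]
      gcongr
      refine (Tlim_le h hle hi).trans ?_
      rw [Tlim_succ h hi]
      exact add_le_add i1 (hS i hi).le
    have h2 : s + (t - s) / 2 + Slim T (j + 1) n < s + (t - s) / 2 + (t - s) / 2 := by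
      refine ENNReal.add_lt_add_left ?_ (hS j hj)
      refine ENNReal.add_ne_top.2 ⟨ne_top_of_lt hst, ?_⟩
      exact ENNReal.div_ne_top (ENNReal.sub_ne_top ht') (by norm_num)
    rw [add_assoc s ((t - s) / 2) ((t - s) / 2), ENNReal.add_halves, add_tsub_cancel_of_le hst.le] at h2
    exact lt_irrefl _ (h1.trans_lt h2)
  intro he
  have := hdis n (i + 1) (j + 1) (by omega) (by omega) (by rw [numParts_X_self]; exact hj)
  rw [Nat.add_sub_cancel, Nat.add_sub_cancel] at this
  refine Set.notMem_empty (Xlim T s) (this ▸ ⟨⟨s, ⟨i1, i2⟩, rfl⟩, ⟨t, ⟨j1, j2⟩, he.symm⟩⟩)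

theorem endTime_Xlim : endTime (Xlim T) = Tlim T (num T 0) 0 := by
  refine le_antisymm (sInf_le fun s hs => Xlim_of_le h hs) (le_sInf fun t ht => ?_)
  by_contra! hlt
  refine Xlim_ne h hdis hmax hlt le_rfl ?_
  rw [ht t le_rfl, Xlim_of_le h le_rfl]

theorem isPartDecomp_Xlim (n : ℕ) : IsPartDecomp n (Xlim T) (num T n) (fun j => Tlim T j n)
    (fun j => (crossing T n j).1) where
  one_le := num_pos T n
  time_zero := Tlim_zero h n
  time_last := (Tlim_num h n).trans (endTime_Xlim h hdis hmax).symm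
  time_lt j hj := Tlim_lt_succ h hj
  length_word j hj := (crossing_spec T hj).1
  subset_part j hj := by
    rintro _ ⟨t, ⟨h1, h2⟩, rfl⟩
    exact Xlim_mem_part h hj h1 h2
  hits_inner j hj := by
    have hle : Tlim T (j + 1) n ≤ Tlim T (num T 0) 0 := by
      rw [← Tlim_num h n]; exact Tlim_le h hj le_rfl
    -- An injective image of an interval is infinite, so it contains points that are not corners of
    -- the part.
    have hinj : Set.InjOn (Xlim T) (Set.Icc (Tlim T j n) (Tlim T (j + 1) n)) := by
      intro s hs t ht hst
      rcases lt_trichotomy s t with h1 | h1 | h1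
      · exact absurd hst (Xlim_ne h hdis hmax h1 (ht.2.trans hle))
      · exact h1
      · exact absurd hst.symm (Xlim_ne h hdis hmax h1 (hs.2.trans hle))
    have hinf := (Set.Icc_infinite (Tlim_lt_succ h hj)).image hinj
    have hfin : (psiWord (crossing T n j).1 '' VG 0).Finite := (Set.finite_range u).image _
    obtain ⟨p, hp, hn⟩ := (hinf.sdiff hfin).nonempty
    refine ⟨p, hp, ?_⟩
    obtain ⟨t, ht, rfl⟩ := hp
    obtain ⟨x, hx, hxt⟩ := Xlim_mem_part h hj ht.1 ht.2
    exact ⟨x, ⟨hx, fun hx0 => hn ⟨x, hx0, hxt⟩⟩, hxt⟩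
  exit_time j hj := by
    refine le_antisymm (le_sInf ?_) (le_of_forall_gt fun s' hs' => ?_)
    · rintro s ⟨h1, h2⟩
      by_contra! hlt
      exact h2 (Xlim_mem_part h (by omega) h1.le hlt.le)
    · rw [sInf_lt_iff]
      -- Shortly after the limiting time the curve is in the next part. If it were still in the old
      -- one, it would be at their common vertex, which injectivity reserves for the limiting time
      -- itself.
      obtain ⟨s, hs1, hs2⟩ := exists_between (lt_min hs' (Tlim_lt_succ h hj))
      refine ⟨s, ⟨(Tlim_lt_succ h (by omega)).trans hs1, fun hmem => ?_⟩,
        hs2.trans_le (min_le_left _ _)⟩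
      have hs3 := hs2.trans_le (min_le_right _ _)
      have hle : Tlim T (j + 1 + 1) n ≤ Tlim T (num T 0) 0 := by
        rw [← Tlim_num h n]; exact Tlim_le h hj le_rfl
      have hmem' := Xlim_mem_part h hj hs1.le hs3.le
      have hj' : j < num T n := by omega
      obtain ⟨x, hx, hx'⟩ := hmem
      obtain ⟨y, hy, hy'⟩ := hmem'
      obtain ⟨p, hp, hp'⟩ := exit_mem (T := T) hj'
      obtain ⟨q, hq, hq'⟩ := entry_mem hj
      have hl := (crossing_spec T hj').1.trans (crossing_spec T hj).1.symm
      have hne := (crossingData T n 0).word_ne j hj' (j + 1) hj (by omega)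
      obtain ⟨_, _, _, _, huniq⟩ := psiWord_eq_psiWord hl hne hx hy (hx'.trans hy'.symm)
      have := (huniq p hp q hq (hp'.trans hq'.symm)).1
      refine Xlim_ne h hdis hmax hs1 (hs3.le.trans hle) ?_
      rw [Xlim_Tlim h hj'.nat_succ_le, ← hp', ← hx', this]

end Injective

/-- The deterministic part of the main theorem. -/
theorem GoodEvent.conclusion (hT : GoodEvent T) :
    IsCurve (Xlim T) ∧ TendstoUniformly (X T) (Xlim T) atTop ∧ SelfAvoiding (Xlim T) ∧
    ∀ n, IsPartDecomp n (Xlim T) (numParts n (Xlim T)) (fun j => partTime j n (Xlim T))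
        (fun j => partWord j n (Xlim T)) ∧
      numParts n (Xlim T) = numParts n (X T n) ∧
      ∀ j, 1 ≤ j → j ≤ numParts n (X T n) →
        Tendsto (fun m => partTime j n (X T m)) atTop (𝓝 (Tlim T j n)) ∧
        Tlim T j n = partTime j n (Xlim T) ∧
        partTime j n (Xlim T) = sInf {t | partTime (j - 1) n (Xlim T) < t ∧ Xlim T t ∈ VG n} := by
  have h := hT.durations
  have hne : ∀ {s t}, s < t → t ≤ Tlim T (num T 0) 0 → Xlim T s ≠ Xlim T t :=
    fun h1 h2 => Xlim_ne h hT.disjoint hT.max_duration h1 h2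
  have hdec := isPartDecomp_Xlim h hT.disjoint hT.max_duration
  refine ⟨isCurve_Xlim h, tendstoUniformly_X h, fun s t hst ht => ?_, fun n => ?_⟩
  · rw [endTime_Xlim h hT.disjoint hT.max_duration] at ht
    exact hne hst ht
  refine ⟨isPartDecomp_partDecomp (hdec n), (numParts_eq (hdec n)).trans (numParts_X_self T n).symm,
    fun j hj1 hj => ?_⟩
  rw [numParts_X_self] at hj
  have e1 := partTime_eq (hdec n) hj
  have e2 := partTime_eq (hdec n) (j := j - 1) (by omega)
  refine ⟨tendsto_partTime h hj, e1.symm, ?_⟩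
  rw [e1, e2]
  refine le_antisymm (le_sInf ?_) (sInf_le ⟨Tlim_lt h (by omega) hj, ?_⟩)
  · rintro t ⟨h1, h2⟩
    have hmem : Xlim T t ∈ Set.range (Xlim T) ∩ VG n := ⟨⟨t, rfl⟩, h2⟩
    rw [hT.range_inter n] at hmem
    obtain ⟨i, hi, hit⟩ := hmem
    rw [numParts_X_self] at hi
    rcases le_or_gt t (Tlim T (num T n) n) with h3 | h3
    · have hle := Tlim_le h hi le_rfl
      rw [Tlim_num h n] at h3 hle
      -- Within the lifetime of the curve, injectivity turns equality of points into equality of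
      -- times, so visits to $VG_n$ happen only at the times $\mathsf T_{i,n}$.
      have hti : t = Tlim T i n := by
        rcases lt_trichotomy t (Tlim T i n) with h4 | h4 | h4
        · exact absurd hit (hne h4 hle)
        · exact h4
        · exact absurd hit.symm (hne h4 h3)
      rw [hti] at h1 ⊢
      refine Tlim_le h ?_ hi
      by_contra! hlt
      exact absurd h1 (not_lt.2 (Tlim_le h (by omega) (by omega)))
    · exact (Tlim_le h hj le_rfl).trans h3.le
  · rw [Xlim_Tlim h hj]
    exact vert_mem_VG _ _

end Limit

/-! ### A sufficient condition for the good event -/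

theorem Linked.isChain {R : Plane → Plane → Prop} {g : List (Fin 3) × Fin 3 × Fin 3 → List Plane}
    {v : Plane} {L : List (List (Fin 3) × Fin 3 × Fin 3)} {p : Plane} (h : Linked v p L)
    (hR : ∀ x ∈ L, (g x ++ [exit x]).IsChain R) (hh : ∀ x ∈ L, (g x).head? = some (entry x)) :
    (L.flatMap g ++ [v]).IsChain R ∧ (L.flatMap g ++ [v]).head? = some p := by
  induction L generalizing p with
  | nil => obtain rfl : p = v := h; simp
  | cons x L ih =>
    obtain ⟨h1, h2⟩ := ih h.2 (fun y hy => hR y (by simp [hy])) (fun y hy => hh y (by simp [hy]))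
    rw [List.flatMap_cons, List.append_assoc]
    refine ⟨isChain_append_of_head (hR x (by simp)) h1 h2, ?_⟩
    rw [List.head?_append, hh x (by simp), h.1]
    rfl

/-- Records for each edge of the fine path a crossed part of level `k` that contains it. This
confines the interpolated curve, not only its vertices, to the listed parts. -/
theorem vl_chain_parts (k' k : ℕ) {σ : List (Fin 3) → St} (h : Consistent σ) {a b : Fin 3}
    (hab : a ≠ b) (hc : conn (σ []) a b) :
    (vl (k' + k) σ a b ++ [u b]).IsChain fun p q => ∃ x ∈ cr k σ a b, ∃ y y', s(y, y') ∈ EG k' ∧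
      p = psiWord x.1 y ∧ q = psiWord x.1 y' := by
  rw [vl_add]
  refine ((linked_cr k σ a b).isChain (fun x hx => ?_) fun x _ => ?_).1
  · obtain ⟨-, h2, h3⟩ := cr_spec k h hab hc x hx
    have hch := vl_chain k' (h.shw x.1) h2 (by simpa [shw] using h3)
    have e : (vl k' (shw x.1 σ) x.2.1 x.2.2).map (psiWord x.1) ++ [exit x] =
        (vl k' (shw x.1 σ) x.2.1 x.2.2 ++ [u x.2.2]).map (psiWord x.1) := by
      rw [List.map_append]; rfl
    rw [e, List.isChain_map]
    exact hch.imp fun y y' hy => ⟨x, hx, y, y',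
      dec_subset k' _ ((SimpleGraph.fromEdgeSet_adj _).1 hy).1, rfl, rfl⟩
  · rw [List.head?_map, vl_head]; rfl

variable {T : LimitTree}

/-- The words of the sub-parts crossed by a crossing of a part. -/
noncomputable def subWords (T : LimitTree) (n j k : ℕ) : List (List (Fin 3)) :=
  (cr k (shw (crossing T n j).1 (states T)) (crossing T n j).2.1 (crossing T n j).2.2).map Prod.fst

theorem X_mem_subparts {n k k' j : ℕ} (hj : j < num T n) {t : ℝ≥0∞}
    (h1 : partTime j n (X T (k' + k + n)) ≤ t) (h2 : t ≤ partTime (j + 1) n (X T (k' + k + n))) :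
    ∃ v ∈ subWords T n j k, X T (k' + k + n) t ∈ psiWord ((crossing T n j).1 ++ v) '' gasket := by
  have hd := crossingData T n (k' + k)
  rw [partTime_X T hj.le, ENNReal.div_le_iff_le_mul (Or.inl (scale_ne_zero _))
    (Or.inl (scale_ne_top _)), mul_comm] at h1
  rw [partTime_X T hj, ENNReal.le_div_iff_mul_le (Or.inl (scale_ne_zero _))
    (Or.inl (scale_ne_top _)), mul_comm] at h2
  rw [X_eq T n (k' + k)]
  simp only
  obtain ⟨N, e1, e2, e3, e4⟩ := exists_nat_mem (hd.lt j hj) h1 h2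
  have hN : N < cum T n (k' + k) (num T n) := e2.trans_le (hd.le_of_le hj le_rfl)
  obtain ⟨q, rfl⟩ : ∃ q, N = cum T n (k' + k) j + q := ⟨N - cum T n (k' + k) j, by omega⟩
  have hq : q + 1 ≤ dur T n (k' + k) j := by
    have : cum T n (k' + k) (j + 1) = cum T n (k' + k) j + dur T n (k' + k) j := by
      rw [cum, cum, Finset.sum_range_succ]
    omega
  have b1 := getVert_block T (k := k' + k) (q := q) hj (by omega)
  have b2 := getVert_block T (k := k' + k) (q := q + 1) hj hq
  obtain ⟨s1, s2, s3⟩ := crossing_spec T hj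
  rw [dur, len] at hq
  have hcs : Consistent (shw (crossing T n j).1 (states T)) := (consistent_states T).shw _
  have hch := vl_chain_parts k' k hcs s2 (by simpa [shw] using s3)
  have hlen : q + 1 < (vl (k' + k) (shw (crossing T n j).1 (states T)) (crossing T n j).2.1
      (crossing T n j).2.2 ++ [u (crossing T n j).2.2]).length := by
    rw [List.length_append]
    simp only [List.length_cons, List.length_nil]
    omega
  obtain ⟨x, hx, y, y', hy, hp, hp'⟩ := hch.getElem q hlen
  rw [List.getElem?_map, List.getElem?_eq_getElem (by omega)] at b1
  rw [List.getElem?_map, List.getElem?_eq_getElem hlen] at b2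
  have b1 := Option.some_inj.1 b1
  have b2 := Option.some_inj.1 b2
  rw [hp, ← psiWord_append] at b1
  rw [hp', ← psiWord_append] at b2
  refine ⟨x.1, List.mem_map.2 ⟨x, hx, rfl⟩, ?_⟩
  rw [interpolate_of_mem hN e3 e4, add_assoc (cum T n (k' + k) j), b1, b2, lineMap_psiWord]
  refine ⟨_, lineMap_mem_gasket_of_EG hy ⟨?_, ?_⟩, rfl⟩
  · have := ENNReal.toReal_mono (ne_top_of_le_ne_top (ENNReal.natCast_ne_top _) e4) e3
    rw [ENNReal.toReal_natCast] at this
    exact sub_nonneg.2 this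
  · have := ENNReal.toReal_mono (ENNReal.natCast_ne_top _) e4
    rw [ENNReal.toReal_natCast] at this
    push_cast at this ⊢
    linarith

/-- The crossed sub-parts of level `k` are the same for all finer curves and form a finite union of
closed sets, so the limit stays in it. -/
theorem Xlim_mem_subparts (h : DurationsConverge T) {n j : ℕ} (k : ℕ) (hj : j < num T n) {t : ℝ≥0∞}
    (h1 : Tlim T j n < t) (h2 : t < Tlim T (j + 1) n) :
    ∃ v ∈ subWords T n j k, Xlim T t ∈ psiWord ((crossing T n j).1 ++ v) '' gasket := by
  have hcl : IsClosed (⋃ v ∈ (subWords T n j k).toFinset,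
      psiWord ((crossing T n j).1 ++ v) '' gasket) :=
    (Finset.finite_toSet _).isClosed_biUnion fun v _ => isClosed_part _
  have := Xlim_mem_of_eventually h hj hcl h1 h2 (by
    filter_upwards [eventually_ge_atTop (k + n)] with m hm e1 e2
    obtain ⟨k', rfl⟩ := Nat.exists_eq_add_of_le' hm
    rw [← add_assoc] at e1 e2 ⊢
    obtain ⟨v, hv, hX⟩ := X_mem_subparts hj e1 e2
    exact Set.mem_iUnion₂.2 ⟨v, by simpa using hv, hX⟩)
  obtain ⟨v, hv, hX⟩ := Set.mem_iUnion₂.1 this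
  exact ⟨v, by simpa using hv, hX⟩

/-- Every crossing of a part misses the third corner of the part. -/
def MissesThird (T : LimitTree) : Prop :=
  ∀ n j, j < num T n → ∃ k,
    List.replicate k (third (crossing T n j).2.1 (crossing T n j).2.2) ∉ subWords T n j k

theorem eq_of_ne_third {a b c : Fin 3} (hab : a ≠ b) (hc : c ≠ third a b) : c = a ∨ c = b := by
  revert a b c; decide

theorem subWords_length {n j k : ℕ} (hj : j < num T n) {v : List (Fin 3)}
    (hv : v ∈ subWords T n j k) : v.length = k := by
  obtain ⟨x, hx, rfl⟩ := List.mem_map.1 hv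
  obtain ⟨-, s2, s3⟩ := crossing_spec T hj
  exact (cr_spec k ((consistent_states T).shw _) s2 (by simpa [shw] using s3) x hx).1

theorem entry_eq {n j : ℕ} (hj : j < num T n) :
    psiWord (crossing T n j).1 (u (crossing T n j).2.1) = vert T n j := by
  rw [vert, if_pos hj]; rfl

/-- The limit curve meets the vertices of level `n` only at the ends of its pieces. -/
theorem Xlim_mem_VG (h : DurationsConverge T) (hC : MissesThird T) {n j : ℕ} (hj : j < num T n)
    {t : ℝ≥0∞} (h1 : Tlim T j n ≤ t) (h2 : t ≤ Tlim T (j + 1) n) (hV : Xlim T t ∈ VG n) :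
    Xlim T t = vert T n j ∨ Xlim T t = vert T n (j + 1) := by
  rcases h1.eq_or_lt with rfl | h1
  · left; exact Xlim_Tlim h hj.le
  rcases h2.eq_or_lt with rfl | h2
  · right; exact Xlim_Tlim h hj
  obtain ⟨k, hk⟩ := hC n j hj
  obtain ⟨v, hv, x, hx, hxt⟩ := Xlim_mem_subparts h k hj h1 h2
  obtain ⟨s1, s2, s3⟩ := crossing_spec T hj
  rw [psiWord_append] at hxt
  rw [← hxt] at hV ⊢
  obtain ⟨c, hc⟩ := corner_of_mem (w := (crossing T n j).1) (psiWord_mem_gasket hx v)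
    (by rwa [s1])
  -- A sub-part containing the corner `c` has the constant word of letters `c`; for the third corner
  -- this word is excluded by the choice of `k`.
  have h3 := (psiWord_eq_u hx hc).1
  rw [subWords_length hj hv] at h3
  have h4 : c ≠ third (crossing T n j).2.1 (crossing T n j).2.2 := by
    rintro rfl
    exact hk (h3 ▸ hv)
  rw [hc]
  rcases eq_of_ne_third s2 h4 with e | e
  · left; rw [e]; exact entry_eq hj
  · right; rw [e]; exact exit_eq T hj

/-- The limit curve meets the vertices of level `n` only in the vertices of the path. -/
theorem exists_of_Xlim_mem_VG (h : DurationsConverge T) (hC : MissesThird T) {n : ℕ} {t : ℝ≥0∞}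
    (hV : Xlim T t ∈ VG n) : ∃ j ≤ num T n, Xlim T t = vert T n j := by
  obtain ⟨j, hj, h1, h2⟩ := exists_Tlim_interval h n t
  rcases le_total t (Tlim T (num T n) n) with h3 | h3
  · rcases Xlim_mem_VG h hC hj h1 (h2 h3) hV with e | e
    · exact ⟨j, hj.le, e⟩
    · exact ⟨j + 1, hj, e⟩
  · exact ⟨num T n, le_rfl, by rw [Xlim_of_le h h3, vert_num]⟩

theorem crossing_word_ne {n i j : ℕ} (hi : i < num T n) (hj : j < num T n) (hij : i ≠ j) :
    (crossing T n i).1 ≠ (crossing T n j).1 :=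
  (crossingData T n 0).word_ne i hi j hj hij

/-- Two parts meet only in vertices of level `n`, and each piece of the curve meets such vertices
only at its own ends. The ends of non-consecutive pieces are different. -/
theorem Xlim_disjoint (h : DurationsConverge T) (hC : MissesThird T) {n i j : ℕ} (hij : i + 1 < j)
    (hj : j < num T n) : Xlim T '' Set.Icc (Tlim T i n) (Tlim T (i + 1) n) ∩
      Xlim T '' Set.Icc (Tlim T j n) (Tlim T (j + 1) n) = ∅ := by
  rw [Set.eq_empty_iff_forall_notMem]
  rintro _ ⟨⟨s, hs, rfl⟩, t, ht, hst⟩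
  have hi : i < num T n := by omega
  obtain ⟨x, hx, hxs⟩ := Xlim_mem_part h hi hs.1 hs.2
  obtain ⟨y, hy, hyt⟩ := Xlim_mem_part h hj ht.1 ht.2
  have hl := (crossing_spec T hi).1.trans (crossing_spec T hj).1.symm
  obtain ⟨a, b, rfl, rfl, -⟩ := psiWord_eq_psiWord hl (crossing_word_ne hi hj (by omega)) hx hy
    (hxs.trans (hst.symm.trans hyt.symm))
  have hVs : Xlim T s ∈ VG n := mem_VG_iff.2 ⟨_, (crossing_spec T hi).1, a, hxs.symm⟩
  have hVt : Xlim T t ∈ VG n := mem_VG_iff.2 ⟨_, (crossing_spec T hj).1, b, hyt.symm⟩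
  have h1 := Xlim_mem_VG h hC hi hs.1 hs.2 hVs
  have h2 := Xlim_mem_VG h hC hj ht.1 ht.2 hVt
  rw [hst] at h2
  rcases h1 with h1 | h1 <;> rcases h2 with h2 | h2 <;>
  · have := vert_injective T (by omega) (by omega) (h1.symm.trans h2)
    omega

/-- A point lies in at most two parts of a level. An inner vertex of the path already lies in the
two consecutive parts it separates, and the corners $u_1,u_2$ each lie in only one part. -/
theorem word_of_vert {n j : ℕ} (hj : j ≤ num T n) {w : List (Fin 3)} (hw : w.length = n)
    {c : Fin 3} (hc : vert T n j = psiWord w (u c)) :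
    (j < num T n ∧ w = (crossing T n j).1) ∨
      (∃ i, j = i + 1 ∧ i < num T n ∧ w = (crossing T n i).1) := by
  have hmem : vert T n j ∈ psiWord w '' gasket := ⟨_, u_mem_gasket c, hc.symm⟩
  have first : j = 0 → w = (crossing T n j).1 := by
    rintro rfl
    have h0 := num_pos T n
    rw [vert_zero] at hc
    have e1 := (psiWord_eq_u (u_mem_gasket c) hc.symm).1
    have e2 := (psiWord_eq_u (u_mem_gasket _) ((entry_eq (T := T) (n := n) (j := 0) h0).trans
      (vert_zero T n))).1
    rw [e1, e2, hw, (crossing_spec T h0).1]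
  have last : ∀ i, j = i + 1 → j = num T n → w = (crossing T n i).1 := by
    rintro i rfl hn
    rw [hn, vert_num] at hc
    have hi : i < num T n := by omega
    have e1 := (psiWord_eq_u (u_mem_gasket c) hc.symm).1
    have e3 : psiWord (crossing T n i).1 (u (crossing T n i).2.2) = u 1 := by
      refine (exit_eq T hi).trans ?_
      rw [hn, vert_num]
    have e2 := (psiWord_eq_u (u_mem_gasket _) e3).1
    rw [e1, e2, hw, (crossing_spec T hi).1]
  rcases Nat.eq_zero_or_eq_succ_pred j with h0 | h0
  · left
    exact ⟨by have := num_pos T n; omega, first h0⟩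
  · set i := j.pred
    have h0 : j = i + 1 := h0
    rcases hj.lt_or_eq with h1 | h1
    · have hi : i < num T n := by omega
      have m1 := entry_mem h1
      have m2 := exit_mem hi
      rw [← h0] at m2
      have l1 := (crossing_spec T h1).1
      have l2 := (crossing_spec T hi).1
      rcases eq_or_of_mem_parts (hw.trans l1.symm) (hw.trans l2.symm) hmem m1 m2 with e | e | e
      · left; exact ⟨h1, e⟩
      · right; exact ⟨i, h0, hi, e⟩
      · exact absurd e (crossing_word_ne h1 hi (by omega))
    · right
      exact ⟨i, h0, by omega, last i h0 h1⟩

/-- A visited corner of a part forces the part to be crossed. It is crossed only once, so its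
visited corners are the entry and the exit of this crossing. -/
theorem Xlim_corners (h : DurationsConverge T) (hC : MissesThird T) (w : List (Fin 3)) :
    (Set.range (Xlim T) ∩ psiWord w '' VG 0).encard ≤ 2 := by
  rcases (Set.range (Xlim T) ∩ psiWord w '' VG 0).eq_empty_or_nonempty with he | ⟨x, hx⟩
  · rw [he]; simp
  have key : ∀ x ∈ Set.range (Xlim T) ∩ psiWord w '' VG 0, ∃ q < num T w.length,
      w = (crossing T w.length q).1 ∧ (x = vert T w.length q ∨ x = vert T w.length (q + 1)) := by
    rintro _ ⟨⟨t, rfl⟩, _, ⟨c, rfl⟩, hc⟩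
    obtain ⟨j, hj, e⟩ := exists_of_Xlim_mem_VG h hC (n := w.length)
      (mem_VG_iff.2 ⟨w, rfl, c, hc.symm⟩)
    rcases word_of_vert hj rfl (e.symm.trans hc.symm) with ⟨h1, h2⟩ | ⟨i, rfl, h1, h2⟩
    · exact ⟨j, h1, h2, Or.inl e⟩
    · exact ⟨i, h1, h2, Or.inr e⟩
  obtain ⟨q, hq, hwq, -⟩ := key x hx
  have hsub : Set.range (Xlim T) ∩ psiWord w '' VG 0 ⊆
      {vert T w.length q, vert T w.length (q + 1)} := by
    intro y hy
    obtain ⟨q', hq', hwq', hy⟩ := key y hy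
    obtain rfl : q = q' := by
      by_contra hne
      exact crossing_word_ne hq hq' hne (hwq.symm.trans hwq')
    exact hy
  exact (Set.encard_le_encard hsub).trans (((Set.encard_insert_le _ _).trans (by rw [Set.encard_singleton]; norm_num)))

/-- A peak would visit all three corners of a part. -/
theorem Xlim_no_peak (h : DurationsConverge T) (hC : MissesThird T) (w : List (Fin 3)) (i : Fin 3) :
    ¬ HasPeak (Xlim T) w i := by
  rintro ⟨t₁, t₂, -, -, hne, ⟨x, ⟨hx, hxi⟩, h1⟩, ⟨y, ⟨hy, hyi⟩, h2⟩, h3⟩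
  have h4 : psiWord w (u i) ∈ Xlim T '' Set.Ioo t₁ t₂ ∩ psiWord w '' VG 0 := by rw [h3]; rfl
  obtain ⟨t, -, ht⟩ := h4.1
  have hxy : x ≠ y := by
    rintro rfl
    exact hne (h1.symm.trans h2)
  have hcard : ({psiWord w (u i), Xlim T t₁, Xlim T t₂} : Set Plane).encard = 3 := by
    rw [Set.encard_eq_three]
    refine ⟨_, _, _, ?_, ?_, hne, rfl⟩
    · rw [← h1]
      exact fun e => hxi (psiWord_injective w e).symm
    · rw [← h2]
      exact fun e => hyi (psiWord_injective w e).symm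
  have hsub : ({psiWord w (u i), Xlim T t₁, Xlim T t₂} : Set Plane) ⊆
      Set.range (Xlim T) ∩ psiWord w '' VG 0 := by
    rintro z (rfl | rfl | rfl)
    · exact ⟨⟨t, ht⟩, _, ⟨i, rfl⟩, rfl⟩
    · exact ⟨⟨t₁, rfl⟩, x, hx, h1⟩
    · exact ⟨⟨t₂, rfl⟩, y, hy, h2⟩
  have := (Set.encard_le_encard hsub).trans (Xlim_corners h hC w)
  rw [hcard] at this
  exact absurd this (by norm_num)

/-- The good event holds if the durations converge, their maxima tend to zero, and crossings miss
the third corners. -/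
theorem GoodEvent.of_missesThird (h : DurationsConverge T) (hC : MissesThird T)
    (hmax : Tendsto (fun n => ⨆ j ∈ Set.Icc 1 (numParts n (X T n)), Slim T j n) atTop (𝓝 0)) :
    GoodEvent T where
  durations := h
  no_peak := Xlim_no_peak h hC
  start n := by rw [Xlim_Tlim h (Nat.zero_le _), vert_zero]
  finish n := by rw [numParts_X_self, Xlim_Tlim h le_rfl, vert_num]
  range_inter n := by
    ext x
    constructor
    · rintro ⟨⟨t, rfl⟩, hV⟩
      obtain ⟨j, hj, e⟩ := exists_of_Xlim_mem_VG h hC hV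
      exact ⟨j, by rwa [numParts_X_self], by rw [e, Xlim_Tlim h hj]⟩
    · rintro ⟨j, hj, rfl⟩
      rw [numParts_X_self] at hj
      refine ⟨⟨_, rfl⟩, ?_⟩
      rw [Xlim_Tlim h hj]
      exact vert_mem_VG _ _
  disjoint n i j hi hij hj := by
    rw [numParts_X_self] at hj
    obtain ⟨i, rfl⟩ := Nat.exists_eq_add_of_le' hi
    obtain ⟨j, rfl⟩ := Nat.exists_eq_add_of_le' (show 1 ≤ j by omega)
    exact Xlim_disjoint h hC (by omega) hj
  corners := Xlim_corners h hC
  max_duration := hmax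

/-! ### Averages over configurations -/

/-- The triples of states with a given trace. -/
def Fib (s : St) : Finset (Fin 3 → St) := Finset.univ.filter fun t => tau t = s

theorem mem_Fib {s : St} {t : Fin 3 → St} : t ∈ Fib s ↔ tau t = s := by simp [Fib]

/-- The sum of `f` over all triples with trace `s`, in a form suited to computation. -/
def fibSum (s : St) (f : (Fin 3 → St) → ℕ) : ℕ :=
  ∑ x : St, ∑ y : St, ∑ z : St, if tau ![x, y, z] = s then f ![x, y, z] else 0

/-- Triples as functions. -/
def tripleEquiv (α : Type*) : α × α × α ≃ (Fin 3 → α) where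
  toFun p := ![p.1, p.2.1, p.2.2]
  invFun t := (t 0, t 1, t 2)
  left_inv _ := rfl
  right_inv t := by funext i; fin_cases i <;> rfl

theorem sum_Fib (s : St) (f : (Fin 3 → St) → ℕ) : ∑ t ∈ Fib s, f t = fibSum s f := by
  rw [Fib, Finset.sum_filter, ← (tripleEquiv St).sum_comp, Fintype.sum_prod_type, fibSum]
  refine Finset.sum_congr rfl fun x _ => ?_
  rw [Fintype.sum_prod_type]
  rfl

/-- The number of triples of states with trace `s`. -/
def cardTable (s : St) : ℕ := if isTree s then 18 else if s = 0 then 50 else 30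

theorem fibSum_one : ∀ s : St, s ≠ 7 → fibSum s (fun _ => 1) = cardTable s := by decide +kernel

theorem card_Fib {s : St} (hs : s ≠ 7) : (Fib s).card = cardTable s := by
  rw [Finset.card_eq_sum_ones, sum_Fib, fibSum_one s hs]

theorem cardTable_pos (s : St) : 0 < cardTable s := by
  unfold cardTable; split_ifs <;> norm_num

theorem ne_seven_of_mem_Fib {s : St} (hs : s ≠ 7) {t : Fin 3 → St} (ht : t ∈ Fib s) (i : Fin 3) :
    t i ≠ 7 := by
  rw [mem_Fib] at ht
  exact ((tau_ne_iff t).1 (ht ▸ hs)).1 i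

instance instFintypeCfg : (n : ℕ) → Fintype (Cfg n)
  | 0 => inferInstanceAs (Fintype (Fin 8))
  | n + 1 => @Pi.instFintype (Fin 3) (fun _ => Cfg n) _ _ fun _ => instFintypeCfg n

/-- The configuration with given pieces. -/
def node {k : ℕ} (x y z : Cfg k) : Cfg (k + 1) := ![x, y, z]

theorem root_node {k : ℕ} {x y z : Cfg k} {t : Fin 3 → St} (hx : root k x = t 0) (hy : root k y = t 1)
    (hz : root k z = t 2) : (fun i => root k (node x y z i)) = t := by
  funext i
  fin_cases i
  · exact hx
  · exact hy
  · exact hz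

/-- The average of `f` over all configurations of level `k` with root `s`. -/
noncomputable def avg : (k : ℕ) → St → (Cfg k → ℝ) → ℝ
  | 0, s, f => f s
  | k + 1, s, f => ((Fib s).card : ℝ)⁻¹ * ∑ t ∈ Fib s, avg k (t 0) fun x => avg k (t 1) fun y =>
      avg k (t 2) fun z => f (node x y z)

theorem avg_mono : ∀ (k : ℕ) {s : St} {f g : Cfg k → ℝ}, (∀ c, root k c = s → f c ≤ g c) →
    avg k s f ≤ avg k s g
  | 0, s, _, _, h => h s rfl
  | k + 1, s, f, g, h => by
    rw [avg, avg]
    refine mul_le_mul_of_nonneg_left (Finset.sum_le_sum fun t ht => ?_) (by positivity)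
    refine avg_mono k fun x hx => avg_mono k fun y hy => avg_mono k fun z hz => h _ ?_
    rw [root, root_node hx hy hz, mem_Fib.1 ht]

theorem avg_congr {k : ℕ} {s : St} {f g : Cfg k → ℝ} (h : ∀ c, root k c = s → f c = g c) :
    avg k s f = avg k s g :=
  le_antisymm (avg_mono k fun c hc => (h c hc).le) (avg_mono k fun c hc => (h c hc).ge)

theorem avg_add : ∀ (k : ℕ) (s : St) (f g : Cfg k → ℝ),
    avg k s (fun c => f c + g c) = avg k s f + avg k s g
  | 0, _, _, _ => rfl
  | k + 1, s, f, g => by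
    simp only [avg, avg_add k, Finset.sum_add_distrib, mul_add]

theorem avg_const_mul : ∀ (k : ℕ) (s : St) (r : ℝ) (f : Cfg k → ℝ),
    avg k s (fun c => r * f c) = r * avg k s f
  | 0, _, _, _ => rfl
  | k + 1, s, r, f => by
    simp only [avg, avg_const_mul k, ← Finset.mul_sum]
    ring

theorem avg_const : ∀ (k : ℕ) {s : St}, s ≠ 7 → ∀ r : ℝ, avg k s (fun _ => r) = r
  | 0, _, _, _ => rfl
  | k + 1, s, hs, r => by
    rw [avg]
    have : ∀ t ∈ Fib s, (avg k (t 0) fun _ => avg k (t 1) fun _ => avg k (t 2) fun _ => r) = r := by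
      intro t ht
      rw [avg_const k (ne_seven_of_mem_Fib hs ht 2), avg_const k (ne_seven_of_mem_Fib hs ht 1),
        avg_const k (ne_seven_of_mem_Fib hs ht 0)]
    rw [Finset.sum_congr rfl this, Finset.sum_const, nsmul_eq_mul, ← mul_assoc, inv_mul_cancel₀,
      one_mul]
    rw [card_Fib hs]
    exact_mod_cast (cardTable_pos s).ne'

theorem avg_sub (k : ℕ) (s : St) (f g : Cfg k → ℝ) :
    avg k s (fun c => f c - g c) = avg k s f - avg k s g := by
  have h := avg_add k s f fun c => -1 * g c
  rw [avg_const_mul] at h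
  have : (fun c => f c - g c) = fun c => f c + -1 * g c := by funext c; ring
  rw [this, h]; ring

theorem avg_nonneg (k : ℕ) {s : St} (hs : s ≠ 7) {f : Cfg k → ℝ} (h : ∀ c, root k c = s → 0 ≤ f c) :
    0 ≤ avg k s f := by
  have := avg_mono k (f := fun _ => 0) h
  rwa [avg_const k hs] at this

/-- The number of edges of a state. -/
def edges (s : St) : ℕ := (has s 0).toNat + (has s 1).toNat + (has s 2).toNat

/-- Gluing gives a forest on six vertices, the trace a forest on three, with equally many
components; the numbers of edges differ by three. -/
theorem edges_tau (t : Fin 3 → St) : tau t ≠ 7 →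
    edges (t 0) + edges (t 1) + edges (t 2) = edges (tau t) + 3 :=
  forall_triple (p := fun t => tau t ≠ 7 →
    edges (t 0) + edges (t 1) + edges (t 2) = edges (tau t) + 3) (by decide +kernel) t

/-- Fiber sizes $50$, $30$, $18$ for zero, one and two edges form a geometric sequence of ratio
$3/5$. Together with `edges_tau` this makes the uniform law Markovian from level to level. -/
theorem cardTable_eq : ∀ s : St, s ≠ 7 → cardTable s * 5 ^ edges s = 50 * 3 ^ edges s := by decide

theorem sum_triple {k : ℕ} (t : Fin 3 → St) (f : Cfg (k + 1) → ℝ) :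
    ∑ c : Cfg (k + 1) with (fun i => root k (c i)) = t, f c =
      ∑ x with root k x = t 0, ∑ y with root k y = t 1, ∑ z with root k z = t 2, f (node x y z) := by
  have h : ∑ c : Cfg (k + 1) with (fun i => root k (c i)) = t, f c =
      ∑ p : Cfg k × Cfg k × Cfg k,
        if (fun i => root k (node p.1 p.2.1 p.2.2 i)) = t then f (node p.1 p.2.1 p.2.2) else 0 := by
    rw [Finset.sum_filter]
    exact ((tripleEquiv (Cfg k)).sum_comp
      (fun c : Cfg (k + 1) => if (fun i => root k (c i)) = t then f c else 0)).symm
  rw [h, Fintype.sum_prod_type, Finset.sum_filter]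
  refine Finset.sum_congr rfl fun x _ => ?_
  rw [Fintype.sum_prod_type]
  split_ifs with hx
  · rw [Finset.sum_filter]
    refine Finset.sum_congr rfl fun y _ => ?_
    split_ifs with hy
    · rw [Finset.sum_filter]
      refine Finset.sum_congr rfl fun z _ => ?_
      by_cases hz : root k z = t 2
      · rw [if_pos hz, if_pos (root_node hx hy hz)]
      · rw [if_neg hz, if_neg fun e => hz (congrFun e 2)]
    · exact Finset.sum_eq_zero fun z _ => if_neg fun e => hy (congrFun e 1)
  · exact Finset.sum_eq_zero fun y _ => Finset.sum_eq_zero fun z _ =>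
      if_neg fun e => hx (congrFun e 0)

theorem sum_root_zero (s : St) (f : Cfg 0 → ℝ) : ∑ c with root 0 c = s, f c = f s := by
  rw [Finset.sum_filter]
  exact (Finset.sum_ite_eq' (Finset.univ : Finset (Fin 8)) s f).trans (if_pos (Finset.mem_univ _))

/-- Sums over all configurations with root `s` are multiples of averages. -/
theorem exists_sum_eq_avg : ∀ k : ℕ, ∃ A : ℝ, 0 < A ∧ ∀ s : St, s ≠ 7 → ∀ f : Cfg k → ℝ,
    ∑ c with root k c = s, f c = A * (3 / 5) ^ (k * edges s) * avg k s f
  | 0 => by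
    refine ⟨1, one_pos, fun s _ f => ?_⟩
    rw [sum_root_zero]
    simp [avg]
  | k + 1 => by
    obtain ⟨A, hA, ih⟩ := exists_sum_eq_avg k
    refine ⟨50 * A ^ 3 * (3 / 5) ^ (k * 3), by positivity, fun s hs f => ?_⟩
    have h1 : ∑ c : Cfg (k + 1) with root (k + 1) c = s, f c =
        ∑ t ∈ Fib s, ∑ c : Cfg (k + 1) with (fun i => root k (c i)) = t, f c := by
      rw [← Finset.sum_fiberwise_of_maps_to (t := Fib s)
        (g := fun c : Cfg (k + 1) => fun i => root k (c i))]
      · refine Finset.sum_congr rfl fun t ht => Finset.sum_congr ?_ fun _ _ => rfl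
        ext c
        simp only [Finset.mem_filter, Finset.mem_univ, true_and, and_iff_right_iff_imp]
        rintro rfl
        exact mem_Fib.1 ht
      · intro c hc
        exact mem_Fib.2 (Finset.mem_filter.1 hc).2
    -- By `edges_tau` the product of the weights of the three pieces is the same for all triples
    -- above `s`, so every triple carries the same number of configurations.
    have h2 : ∀ t ∈ Fib s, ∑ c : Cfg (k + 1) with (fun i => root k (c i)) = t, f c =
        A ^ 3 * (3 / 5) ^ (k * (edges s + 3)) * avg k (t 0) fun x => avg k (t 1) fun y =>
          avg k (t 2) fun z => f (node x y z) := by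
      intro t ht
      have h7 := ne_seven_of_mem_Fib hs ht
      have he := edges_tau t (by rw [mem_Fib.1 ht]; exact hs)
      rw [mem_Fib.1 ht] at he
      rw [sum_triple]
      simp only [ih _ (h7 2), ← Finset.mul_sum]
      simp only [ih _ (h7 1), ← Finset.mul_sum]
      rw [ih _ (h7 0), ← he, mul_add, mul_add, pow_add, pow_add]
      ring
    rw [h1, Finset.sum_congr rfl h2, ← Finset.mul_sum, avg, card_Fib hs]
    have hc : (cardTable s : ℝ) * 5 ^ edges s = 50 * 3 ^ edges s := by
      exact_mod_cast cardTable_eq s hs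
    have hc' : (cardTable s : ℝ) = 50 * (3 / 5) ^ edges s := by
      rw [div_pow]; field_simp; exact hc
    have hc0 : (cardTable s : ℝ) ≠ 0 := by exact_mod_cast (cardTable_pos s).ne'
    generalize (∑ t ∈ Fib s, avg k (t 0) fun x => avg k (t 1) fun y =>
          avg k (t 2) fun z => f (node x y z)) = S
    have e1 : (50 * A ^ 3 * (3 / 5) ^ (k * 3) * (3 / 5) ^ ((k + 1) * edges s) : ℝ) =
        A ^ 3 * (3 / 5) ^ (k * (edges s + 3)) * cardTable s := by
      rw [hc', add_mul, one_mul, mul_add, pow_add, pow_add]; ring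
    rw [e1]
    field_simp

theorem sum_le_of_avg_le (k : ℕ) {s : St} (hs : s ≠ 7) {f : Cfg k → ℝ} {B : ℝ} (h : avg k s f ≤ B) :
    ∑ c with root k c = s, f c ≤ B * (Finset.univ.filter fun c : Cfg k => root k c = s).card := by
  obtain ⟨A, hA, hsum⟩ := exists_sum_eq_avg k
  have h1 := hsum s hs fun _ => 1
  rw [avg_const k hs, Finset.sum_const, nsmul_eq_mul, mul_one, mul_one] at h1
  rw [hsum s hs f, h1, mul_comm B]
  gcongr

/-! ### Additive functionals of paths -/

/-- Entry and exit of the path from `a` to `b` in the `i`-th piece, if it is crossed. -/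
def leg (t : Fin 3 → St) (a b i : Fin 3) : Option (Fin 3 × Fin 3) :=
  if i = a then some (a, if direct t a b then b else third a b)
  else if i = b then some (if direct t a b then a else third a b, b)
  else if direct t a b then none else some (a, b)

theorem univ_eq_corners {a b : Fin 3} (hab : a ≠ b) :
    (Finset.univ : Finset (Fin 3)) = {a, b, third a b} := by
  revert a b; decide

/-- Indexing by all three pieces instead of the route gives the sum a fixed shape, to which the
independence of the pieces can be applied. -/
theorem sum_route {M : Type*} [AddCommMonoid M] (t : Fin 3 → St) {a b : Fin 3} (hab : a ≠ b)
    (f : Fin 3 × Fin 3 × Fin 3 → M) : ((route t a b).map f).sum =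
      ∑ i, (leg t a b i).elim 0 fun x => f (i, x) := by
  obtain ⟨-, -, h1, h2⟩ := third_spec a b hab
  rw [univ_eq_corners hab, Finset.sum_insert (by simp [hab, h1]), Finset.sum_insert
    (by simpa using h2.symm), Finset.sum_singleton]
  unfold route leg
  by_cases h : direct t a b
  · simp [h, hab.symm, h1.symm, h2]
  · simp [h, hab.symm, h1.symm, h2, add_comm]

/-- The corners `a` and `b` are different and connected in the forest `s`. -/
structure Valid (s : St) (a b : Fin 3) : Prop where
  ne_seven : s ≠ 7
  ne : a ≠ b
  conn : conn s a b

theorem leg_spec (t : Fin 3 → St) : tau t ≠ 7 → ∀ a b, a ≠ b → conn (tau t) a b →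
    ∀ i x, leg t a b i = some x → t i ≠ 7 ∧ x.1 ≠ x.2 ∧ conn (t i) x.1 x.2 :=
  forall_triple (p := fun t => tau t ≠ 7 → ∀ a b, a ≠ b → conn (tau t) a b →
    ∀ i x, leg t a b i = some x → t i ≠ 7 ∧ x.1 ≠ x.2 ∧ conn (t i) x.1 x.2) (by decide +kernel) t

theorem Valid.leg {s : St} {a b : Fin 3} (h : Valid s a b) {t : Fin 3 → St} (ht : t ∈ Fib s)
    {i : Fin 3} {x : Fin 3 × Fin 3} (hx : leg t a b i = some x) : Valid (t i) x.1 x.2 := by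
  rw [mem_Fib] at ht
  subst ht
  obtain ⟨h1, h2, h3⟩ := leg_spec t h.1 a b h.2 h.3 i x hx
  exact ⟨h1, h2, h3⟩

/-- The functional on configurations of level `k + 1` that sums up `F` over the crossed pieces. -/
noncomputable def lift {k : ℕ} (F : Cfg k → Fin 3 → Fin 3 → ℝ) (ρ : Cfg (k + 1)) (a b : Fin 3) : ℝ :=
  ∑ i, (leg (fun i => root k (ρ i)) a b i).elim 0 fun x => F (ρ i) x.1 x.2

/-- The additive functional with given values on single edges. -/
noncomputable def addf (φ : St → Fin 3 → Fin 3 → ℝ) : (k : ℕ) → Cfg k → Fin 3 → Fin 3 → ℝ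
  | 0 => φ
  | k + 1 => lift (addf φ k)

theorem avg_elim (k : ℕ) {s : St} (hs : s ≠ 7) (o : Option (Fin 3 × Fin 3))
    (F : Cfg k → Fin 3 → Fin 3 → ℝ) : avg k s (fun c => o.elim 0 fun x => F c x.1 x.2) =
      o.elim 0 fun x => avg k s fun c => F c x.1 x.2 := by
  cases o with
  | none => exact avg_const k hs 0
  | some x => rfl

/-- The first step decomposition of averages of sums over pieces. -/
theorem avg_lift_comp {k : ℕ} {s : St} (F : Cfg k → Fin 3 → Fin 3 → ℝ) (a b : Fin 3)
    (G : ℝ → ℝ) : avg (k + 1) s (fun ρ => G (lift F ρ a b)) = ((Fib s).card : ℝ)⁻¹ *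
      ∑ t ∈ Fib s, avg k (t 0) fun x => avg k (t 1) fun y => avg k (t 2) fun z =>
        G (((leg t a b 0).elim 0 fun p => F x p.1 p.2) + ((leg t a b 1).elim 0 fun p => F y p.1 p.2)
          + (leg t a b 2).elim 0 fun p => F z p.1 p.2) := by
  rw [avg]
  congr 1
  refine Finset.sum_congr rfl fun t _ => avg_congr fun x hx => avg_congr fun y hy =>
    avg_congr fun z hz => ?_
  rw [lift, root_node hx hy hz, Fin.sum_univ_three]
  rfl

theorem avg_add_const (k : ℕ) {s : St} (hs : s ≠ 7) (f : Cfg k → ℝ) (r : ℝ) :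
    avg k s (fun c => r + f c) = r + avg k s f := by
  rw [avg_add k s (fun _ => r) f, avg_const k hs]

theorem avg_triple (k : ℕ) {s₀ s₁ s₂ : St} (h₀ : s₀ ≠ 7) (h₁ : s₁ ≠ 7) (h₂ : s₂ ≠ 7)
    (f g h : Cfg k → ℝ) : (avg k s₀ fun x => avg k s₁ fun y => avg k s₂ fun z => f x + g y + h z) =
      avg k s₀ f + avg k s₁ g + avg k s₂ h := by
  have e : ∀ {s : St}, s ≠ 7 → ∀ (f : Cfg k → ℝ) (r d : ℝ),
      avg k s (fun c => r + f c + d) = r + avg k s f + d := by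
    intro s hs f r d
    have : (fun c => r + f c + d) = fun c => (r + d) + f c := by funext c; ring
    rw [this, avg_add_const k hs]; ring
  have e0 : (fun x => f x + avg k s₁ g + avg k s₂ h) =
      fun x => 0 + f x + (avg k s₁ g + avg k s₂ h) := by funext x; ring
  simp only [avg_add_const k h₂, e h₁]
  rw [e0, e h₀]; ring

theorem avg_lift {k : ℕ} {s : St} (hs : s ≠ 7) (F : Cfg k → Fin 3 → Fin 3 → ℝ) (a b : Fin 3) :
    avg (k + 1) s (fun ρ => lift F ρ a b) = ((Fib s).card : ℝ)⁻¹ *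
      ∑ t ∈ Fib s, ∑ i, (leg t a b i).elim 0 fun x => avg k (t i) fun c => F c x.1 x.2 := by
  rw [avg_lift_comp F a b fun x => x]
  congr 1
  refine Finset.sum_congr rfl fun t ht => ?_
  have h7 := ne_seven_of_mem_Fib hs ht
  rw [avg_triple k (h7 0) (h7 1) (h7 2), Fin.sum_univ_three]
  simp only [avg_elim k (h7 _)]

theorem avg_quad (k : ℕ) {s : St} (hs : s ≠ 7) (f : Cfg k → ℝ) (r c d : ℝ) :
    avg k s (fun z => (r + f z) ^ 2 + c * (r + f z) + d) =
      r ^ 2 + 2 * r * avg k s f + avg k s (fun z => f z ^ 2) + c * (r + avg k s f) + d := by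
  have h : (fun z => (r + f z) ^ 2 + c * (r + f z) + d) =
      fun z => (r ^ 2 + c * r + d) + ((2 * r + c) * f z + f z ^ 2) := by
    funext z; ring
  rw [h, avg_add_const k hs, avg_add, avg_const_mul]
  ring

/-- Averages of squares of sums of independent terms. -/
theorem avg_sq_triple (k : ℕ) {s₀ s₁ s₂ : St} (h₀ : s₀ ≠ 7) (h₁ : s₁ ≠ 7) (h₂ : s₂ ≠ 7)
    (f g h : Cfg k → ℝ) :
    (avg k s₀ fun x => avg k s₁ fun y => avg k s₂ fun z => (f x + g y + h z) ^ 2) =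
      avg k s₀ (fun x => f x ^ 2) + avg k s₁ (fun x => g x ^ 2) + avg k s₂ (fun x => h x ^ 2) +
        2 * (avg k s₀ f * avg k s₁ g + avg k s₀ f * avg k s₂ h + avg k s₁ g * avg k s₂ h) := by
  have e1 : ∀ x y, avg k s₂ (fun z => (f x + g y + h z) ^ 2) = (f x + g y) ^ 2 +
      (2 * avg k s₂ h) * (f x + g y) + avg k s₂ (fun z => h z ^ 2) := by
    intro x y
    have := avg_quad k h₂ h (f x + g y) 0 0
    simp only [zero_mul, add_zero] at this
    rw [this]; ring
  have e2 : ∀ x, avg k s₁ (fun y => avg k s₂ fun z => (f x + g y + h z) ^ 2) = (0 + f x) ^ 2 +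
      (2 * avg k s₁ g + 2 * avg k s₂ h) * (0 + f x) + (avg k s₁ (fun z => g z ^ 2) +
        2 * avg k s₂ h * avg k s₁ g + avg k s₂ (fun z => h z ^ 2)) := by
    intro x
    simp only [e1]
    rw [avg_quad k h₁]; ring
  simp only [e2]
  rw [avg_quad k h₀]; ring

/-- Given the triple of states the pieces are independent, so the square of a sum of at most three
terms yields three second moments and twice three products of means. -/
theorem avg_lift_sq_le {k : ℕ} {F : Cfg k → Fin 3 → Fin 3 → ℝ} {V m : ℝ} (hV0 : 0 ≤ V) (hm0 : 0 ≤ m)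
    (hV : ∀ s a b, Valid s a b → avg k s (fun c => F c a b ^ 2) ≤ V)
    (hm : ∀ s a b, Valid s a b → |avg k s fun c => F c a b| ≤ m) {s : St} {a b : Fin 3}
    (h : Valid s a b) : avg (k + 1) s (fun ρ => lift F ρ a b ^ 2) ≤ 3 * V + 6 * m ^ 2 := by
  rw [avg_lift_comp F a b fun x => x ^ 2, inv_mul_le_iff₀ (by
    rw [card_Fib h.1]; exact_mod_cast cardTable_pos s), ← nsmul_eq_mul]
  refine Finset.sum_le_card_nsmul _ _ _ fun t ht => ?_
  have h7 := ne_seven_of_mem_Fib h.1 ht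
  rw [avg_sq_triple k (h7 0) (h7 1) (h7 2)]
  have e1 : ∀ i, avg k (t i) (fun c => ((leg t a b i).elim 0 fun p => F c p.1 p.2) ^ 2) ≤ V := by
    intro i
    rcases hx : leg t a b i with _ | x
    · simpa [avg_const k (h7 i)] using hV0
    · exact hV _ _ _ (h.leg ht hx)
  have e2 : ∀ i, |avg k (t i) fun c => (leg t a b i).elim 0 fun p => F c p.1 p.2| ≤ m := by
    intro i
    rcases hx : leg t a b i with _ | x
    · simpa [avg_const k (h7 i)] using hm0
    · exact hm _ _ _ (h.leg ht hx)
  have e3 : ∀ {p q : ℝ}, |p| ≤ m → |q| ≤ m → p * q ≤ m ^ 2 := by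
    intro p q hp hq
    rw [sq]
    exact (le_abs_self _).trans (abs_mul p q ▸ mul_le_mul hp hq (abs_nonneg _) hm0)
  linarith [e1 0, e1 1, e1 2, e3 (e2 0) (e2 1), e3 (e2 0) (e2 2), e3 (e2 1) (e2 2)]

/-! ### The mean matrix -/

/-- The class of a crossing: along an edge of a tree, along the edge of a forest with two
components, or along two edges. -/
def cls (s : St) (a b : Fin 3) : Fin 3 :=
  if has s (third a b) then (if isTree s then 0 else 1) else 2

/-- The total numbers of crossings of each class for each class of the parent. -/
def meanTable : Fin 3 → Fin 3 → ℕ := ![![18, 9, 9], ![24, 30, 12], ![24, 18, 12]]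

/-- The cardinalities of the fibers by class. -/
def classCard : Fin 3 → ℕ := ![18, 30, 18]

set_option maxRecDepth 10000 in
theorem fibSum_cls : ∀ s : St, s ≠ 7 → ∀ a b, a ≠ b → conn s a b → ∀ c,
    fibSum s (fun t => ∑ i, (leg t a b i).elim 0 fun x => if cls (t i) x.1 x.2 = c then 1 else 0) =
      meanTable (cls s a b) c := by decide +kernel

theorem cardTable_cls : ∀ s : St, s ≠ 7 → ∀ a b, a ≠ b → conn s a b →
    cardTable s = classCard (cls s a b) := by decide

theorem sum_legs_cls {s : St} {a b : Fin 3} (h : Valid s a b) (v : Fin 3 → ℝ) :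
    ∑ t ∈ Fib s, ∑ i, ((leg t a b i).elim 0 fun x => v (cls (t i) x.1 x.2)) =
      ∑ c, meanTable (cls s a b) c * v c := by
  have h1 : ∀ (t : Fin 3 → St) (i : Fin 3), ((leg t a b i).elim 0 fun x => v (cls (t i) x.1 x.2)) =
      ∑ c, (((leg t a b i).elim 0 fun x => if cls (t i) x.1 x.2 = c then 1 else 0 : ℕ) : ℝ) * v c := by
    intro t i
    rcases leg t a b i with _ | x
    · simp
    · simp
  have h2 : ∀ c, (meanTable (cls s a b) c : ℝ) = ∑ t ∈ Fib s, ∑ i,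
      (((leg t a b i).elim 0 fun x => if cls (t i) x.1 x.2 = c then 1 else 0 : ℕ) : ℝ) := by
    intro c
    rw [← fibSum_cls s h.1 a b h.2 h.3 c, ← sum_Fib]
    push_cast
    rfl
  simp only [h1, h2, Finset.sum_mul]
  exact (Finset.sum_congr rfl fun t _ => Finset.sum_comm).trans Finset.sum_comm

/-! ### Moments of additive functionals -/

/-- `v` is a right eigenvector of the mean matrix of the crossing classes. -/
def IsEigen (r : ℝ) (v : Fin 3 → ℝ) : Prop :=
  ∀ κ, ∑ c, meanTable κ c * v c = r * (classCard κ * v κ)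

/-- The values of a function of classes on crossings. -/
def onCls (v : Fin 3 → ℝ) (s : St) (a b : Fin 3) : ℝ := v (cls s a b)

/-- Conditioning on the first subdivision applies the mean matrix to the class function, which
multiplies an eigenvector by its eigenvalue. -/
theorem avg_addf {r : ℝ} {v : Fin 3 → ℝ} (hv : IsEigen r v) : ∀ (k : ℕ) {s : St} {a b : Fin 3},
    Valid s a b → avg k s (fun c => addf (onCls v) k c a b) = r ^ k * onCls v s a b
  | 0, s, a, b, _ => by rw [pow_zero, one_mul]; rfl
  | k + 1, s, a, b, h => by
    have h1 : ∀ t ∈ Fib s, ∀ i, ((leg t a b i).elim 0 fun x =>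
        avg k (t i) fun c => addf (onCls v) k c x.1 x.2) =
        r ^ k * (leg t a b i).elim 0 fun x => v (cls (t i) x.1 x.2) := by
      intro t ht i
      rcases hx : leg t a b i with _ | x
      · simp
      · exact avg_addf hv k (h.leg ht hx)
    have hc : ((Fib s).card : ℝ) = classCard (cls s a b) := by
      rw [card_Fib h.1, cardTable_cls s h.1 a b h.2 h.3]
    have hc0 : ((Fib s).card : ℝ) ≠ 0 := by
      rw [card_Fib h.1]; exact_mod_cast (cardTable_pos s).ne'
    show avg (k + 1) s (fun c => lift (addf (onCls v) k) c a b) = _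
    rw [avg_lift h.1, Finset.sum_congr rfl fun t ht => Finset.sum_congr rfl fun i _ => h1 t ht i]
    simp only [← Finset.mul_sum]
    rw [sum_legs_cls h, hv, ← hc, onCls]
    field_simp
    ring

theorem exists_bound (φ : St → Fin 3 → Fin 3 → ℝ) : ∃ M, 0 ≤ M ∧ ∀ s a b, |φ s a b| ≤ M := by
  refine ⟨∑ s, ∑ a, ∑ b, |φ s a b|, by positivity, fun s a b => ?_⟩
  have h1 := Finset.single_le_sum (f := fun s => ∑ a, ∑ b, |φ s a b|) (fun _ _ => by positivity)
    (Finset.mem_univ s)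
  have h2 := Finset.single_le_sum (f := fun a => ∑ b, |φ s a b|) (fun _ _ => by positivity)
    (Finset.mem_univ a)
  have h3 := Finset.single_le_sum (f := fun b => |φ s a b|) (fun _ _ => by positivity)
    (Finset.mem_univ b)
  exact h3.trans (h2.trans h1)

theorem avg_addf_sq_le {r : ℝ} {v : Fin 3 → ℝ} (hv : IsEigen r v) (hr : 5 ≤ r ^ 2) :
    ∃ C, 0 ≤ C ∧ ∀ (k : ℕ) (s : St) (a b : Fin 3), Valid s a b →
      avg k s (fun c => addf (onCls v) k c a b ^ 2) ≤ C * (r ^ 2) ^ k := by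
  obtain ⟨M, hM0, hM⟩ := exists_bound (onCls v)
  -- The constant closes the induction for $r^2\ge5$: $3\cdot3M^2+6M^2=5\cdot3M^2$.
  refine ⟨3 * M ^ 2, by positivity, fun k => ?_⟩
  induction k with
  | zero =>
    intro s a b _
    have := sq_le_sq' (abs_le.1 (hM s a b)).1 (abs_le.1 (hM s a b)).2
    show onCls v s a b ^ 2 ≤ _
    rw [pow_zero]
    nlinarith [sq_nonneg M]
  | succ k ih =>
    intro s a b h
    refine (avg_lift_sq_le (F := addf (onCls v) k) (m := |r| ^ k * M) (by positivity)
      (by positivity) ih ?_ h).trans ?_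
    · intro s a b h
      rw [avg_addf hv k h, abs_mul, abs_pow]
      exact mul_le_mul_of_nonneg_left (hM s a b) (by positivity)
    · have e : (|r| ^ k * M) ^ 2 = (r ^ 2) ^ k * M ^ 2 := by
        rw [mul_pow, ← pow_mul, mul_comm k 2, pow_mul, sq_abs]
      rw [e, pow_succ (r ^ 2)]
      have : 0 ≤ (r ^ 2) ^ k * M ^ 2 := by positivity
      nlinarith

/-- The error of the approximate linear recursion for an additive functional. -/
noncomputable def defect (r : ℝ) (φ : St → Fin 3 → Fin 3 → ℝ) (k : ℕ) (ρ : Cfg (k + 1))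
    (a b : Fin 3) : ℝ := addf φ (k + 1) ρ a b - r * addf φ k (tr k ρ) a b

/-- The trace commutes with passing to pieces and preserves their roots, hence also the legs. The
error is thus itself additive over the crossed pieces. -/
theorem defect_succ (r : ℝ) (φ : St → Fin 3 → Fin 3 → ℝ) (k : ℕ) :
    defect r φ (k + 1) = lift (defect r φ k) := by
  funext ρ a b
  have h : (fun i => root k (tr (k + 1) ρ i)) = fun i => root (k + 1) (ρ i) :=
    funext fun i => root_tr k (ρ i)
  show lift (addf φ (k + 1)) ρ a b - r * lift (addf φ k) (tr (k + 1) ρ) a b = _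
  simp only [lift, h]
  rw [Finset.mul_sum, ← Finset.sum_sub_distrib]
  refine Finset.sum_congr rfl fun i _ => ?_
  cases leg (fun i => root (k + 1) (ρ i)) a b i with
  | none => simp
  | some x => rfl

theorem avg_defect {r : ℝ} {v : Fin 3 → ℝ} (hv : IsEigen r v) : ∀ (k : ℕ) {s : St} {a b : Fin 3},
    Valid s a b → avg (k + 1) s (fun c => defect r (onCls v) k c a b) = 0
  | 0, s, a, b, h => by
    have h1 := avg_addf hv 1 h
    have h2 : avg 1 s (fun c => r * addf (onCls v) 0 (tr 0 c) a b) = r * onCls v s a b := by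
      rw [avg_congr (g := fun _ => r * onCls v s a b), avg_const 1 h.1]
      intro c hc
      rw [← hc]; rfl
    show avg 1 s (fun c => addf (onCls v) 1 c a b - r * addf (onCls v) 0 (tr 0 c) a b) = 0
    rw [avg_sub, h1, h2]
    ring
  | k + 1, s, a, b, h => by
    rw [defect_succ, avg_lift h.1]
    refine mul_eq_zero_of_right _ (Finset.sum_eq_zero fun t ht => Finset.sum_eq_zero fun i _ => ?_)
    rcases hx : leg t a b i with _ | x
    · rfl
    · exact avg_defect hv k (h.leg ht hx)

/-- The errors have mean zero, so the mixed terms vanish and the second moment grows at most by the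
number of pieces, whatever the eigenvalue. -/
theorem avg_defect_sq_le {r : ℝ} {v : Fin 3 → ℝ} (hv : IsEigen r v) :
    ∃ C, 0 ≤ C ∧ ∀ (k : ℕ) (s : St) (a b : Fin 3), Valid s a b →
      avg (k + 1) s (fun c => defect r (onCls v) k c a b ^ 2) ≤ C * 3 ^ k := by
  have h0 : ∃ M, 0 ≤ M ∧ ∀ c a b, |defect r (onCls v) 0 c a b| ≤ M := by
    refine ⟨∑ c, ∑ a, ∑ b, |defect r (onCls v) 0 c a b|, by positivity, fun s a b => ?_⟩
    have h1 := Finset.single_le_sum (f := fun s => ∑ a, ∑ b, |defect r (onCls v) 0 s a b|)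
      (fun _ _ => by positivity) (Finset.mem_univ s)
    have h2 := Finset.single_le_sum (f := fun a => ∑ b, |defect r (onCls v) 0 s a b|)
      (fun _ _ => by positivity) (Finset.mem_univ a)
    have h3 := Finset.single_le_sum (f := fun b => |defect r (onCls v) 0 s a b|)
      (fun _ _ => by positivity) (Finset.mem_univ b)
    exact h3.trans (h2.trans h1)
  obtain ⟨M, hM0, hM⟩ := h0
  refine ⟨M ^ 2, by positivity, fun k => ?_⟩
  induction k with
  | zero =>
    intro s a b h
    rw [pow_zero, mul_one]
    refine (avg_mono 1 (g := fun _ => M ^ 2) fun c _ => ?_).trans (avg_const 1 h.1 _).le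
    exact sq_le_sq' (abs_le.1 (hM c a b)).1 (abs_le.1 (hM c a b)).2
  | succ k ih =>
    intro s a b h
    rw [defect_succ]
    refine (avg_lift_sq_le (m := 0) (by positivity) le_rfl ih ?_ h).trans (le_of_eq (by ring))
    intro s a b h
    rw [avg_defect hv k h, abs_zero]

theorem addf_add (φ ψ : St → Fin 3 → Fin 3 → ℝ) : ∀ (k : ℕ) (ρ : Cfg k) (a b : Fin 3),
    addf (fun s a b => φ s a b + ψ s a b) k ρ a b = addf φ k ρ a b + addf ψ k ρ a b
  | 0, _, _, _ => rfl
  | k + 1, ρ, a, b => by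
    simp only [addf, lift]
    rw [← Finset.sum_add_distrib]
    refine Finset.sum_congr rfl fun i _ => ?_
    cases leg (fun i => root k (ρ i)) a b i with
    | none => simp
    | some x => exact addf_add φ ψ k (ρ i) x.1 x.2

theorem addf_mul (r : ℝ) (φ : St → Fin 3 → Fin 3 → ℝ) : ∀ (k : ℕ) (ρ : Cfg k) (a b : Fin 3),
    addf (fun s a b => r * φ s a b) k ρ a b = r * addf φ k ρ a b
  | 0, _, _, _ => rfl
  | k + 1, ρ, a, b => by
    simp only [addf, lift]
    rw [Finset.mul_sum]
    refine Finset.sum_congr rfl fun i _ => ?_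
    cases leg (fun i => root k (ρ i)) a b i with
    | none => simp
    | some x => exact addf_mul r φ k (ρ i) x.1 x.2

theorem addf_mono {φ ψ : St → Fin 3 → Fin 3 → ℝ} (hφ : ∀ s a b, φ s a b ≤ ψ s a b) :
    ∀ (k : ℕ) (ρ : Cfg k) (a b : Fin 3), addf φ k ρ a b ≤ addf ψ k ρ a b
  | 0, _, _, _ => hφ _ _ _
  | k + 1, ρ, a, b => by
    simp only [addf, lift]
    refine Finset.sum_le_sum fun i _ => ?_
    cases leg (fun i => root k (ρ i)) a b i with
    | none => exact le_rfl
    | some x => exact addf_mono hφ k (ρ i) x.1 x.2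

theorem addf_nonneg {φ : St → Fin 3 → Fin 3 → ℝ} (hφ : ∀ s a b, 0 ≤ φ s a b) :
    ∀ (k : ℕ) (ρ : Cfg k) (a b : Fin 3), 0 ≤ addf φ k ρ a b
  | 0, _, _, _ => hφ _ _ _
  | k + 1, ρ, a, b => by
    simp only [addf, lift]
    refine Finset.sum_nonneg fun i _ => ?_
    cases leg (fun i => root k (ρ i)) a b i with
    | none => exact le_rfl
    | some x => exact addf_nonneg hφ k (ρ i) x.1 x.2

/-! ### The eigenvalues -/

/-- The second largest eigenvalue of the mean matrix. -/
noncomputable def alpha₂ : ℝ := 4 / 3 - Real.sqrt 205 / 15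

/-- The eigenvector of the mean matrix for an eigenvalue. -/
noncomputable def eig (r : ℝ) : Fin 3 → ℝ := ![15 * r - 9, 12 * r, 20 * r - 8]

/-- The kernel of the mean matrix. -/
noncomputable def ker : Fin 3 → ℝ := ![1, 0, -2]

theorem isEigen_eig {r : ℝ} (hr : r ^ 2 = 8 / 3 * r - 13 / 15) : IsEigen r (eig r) := by
  intro κ
  rw [Fin.sum_univ_three]
  fin_cases κ <;> simp [meanTable, classCard, eig] <;> linarith

theorem isEigen_ker : IsEigen 0 ker := by
  intro κ
  rw [Fin.sum_univ_three]
  fin_cases κ <;> simp [meanTable, ker] <;> norm_num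

theorem sq_sqrt_205 : Real.sqrt 205 ^ 2 = 205 := Real.sq_sqrt (by norm_num)

theorem isEigen_alpha : IsEigen alpha (eig alpha) :=
  isEigen_eig (by unfold alpha; linarith [sq_sqrt_205, show (4 / 3 + Real.sqrt 205 / 15) ^ 2 =
    16 / 9 + 8 / 45 * Real.sqrt 205 + Real.sqrt 205 ^ 2 / 225 by ring])

theorem isEigen_alpha₂ : IsEigen alpha₂ (eig alpha₂) :=
  isEigen_eig (by unfold alpha₂; linarith [sq_sqrt_205, show (4 / 3 - Real.sqrt 205 / 15) ^ 2 =
    16 / 9 - 8 / 45 * Real.sqrt 205 + Real.sqrt 205 ^ 2 / 225 by ring])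

theorem sqrt_205_bounds : 14 < Real.sqrt 205 ∧ Real.sqrt 205 < 15 :=
  ⟨(Real.lt_sqrt (by norm_num)).2 (by norm_num), (Real.sqrt_lt' (by norm_num)).2 (by norm_num)⟩

theorem alpha_bounds : 9 / 4 < alpha ∧ alpha < 7 / 3 := by
  have := sqrt_205_bounds
  unfold alpha
  constructor <;> linarith

theorem alpha₂_bounds : 0 ≤ alpha₂ ∧ alpha₂ ≤ 1 := by
  have := sqrt_205_bounds
  unfold alpha₂
  constructor <;> linarith

theorem five_le_alpha_sq : 5 ≤ alpha ^ 2 := by nlinarith [alpha_bounds.1]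

/-- The lengths of the crossings of the three classes. -/
def clsLen : Fin 3 → ℝ := ![1, 1, 2]

/-- Expansion of the lengths in the three eigenvectors, so that convergence can be proved for each
eigenvector separately. The number `d` is fixed by the value at class 1, where `ker` vanishes. -/
theorem clsLen_eq : ∃ c₀ c₁ c₂ : ℝ, ∀ κ, clsLen κ =
    c₀ * ker κ + (c₁ * eig alpha κ + c₂ * eig alpha₂ κ) := by
  have h0 : Real.sqrt 205 ≠ 0 := by positivity
  set d : ℝ := (1 / 12 - alpha / 156) / (2 * (Real.sqrt 205 / 15)) with hd
  have hd' : d * (alpha - alpha₂) = 1 / 12 - alpha / 156 := by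
    rw [hd, alpha₂, alpha]; field_simp; ring
  refine ⟨-1 / 4 + 9 / 156, d + 1 / 156, -d, fun κ => ?_⟩
  fin_cases κ <;> simp [clsLen, ker, eig]
  · linear_combination -15 * hd'
  · linear_combination -12 * hd'
  · linear_combination -20 * hd'

theorem eig_le_clsLen (κ : Fin 3) : 1 / 30 * eig alpha κ ≤ clsLen κ ∧
    clsLen κ ≤ 1 / 18 * eig alpha κ ∧ 18 ≤ eig alpha κ := by
  have := alpha_bounds
  fin_cases κ <;> simp [clsLen, eig] <;> refine ⟨?_, ?_, ?_⟩ <;> linarith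

/-! ### The length functional -/

/-- The length of the path from `a` to `b`. -/
noncomputable def lenf (k : ℕ) (ρ : Cfg k) (a b : Fin 3) : ℝ := addf (onCls clsLen) k ρ a b

theorem lenf_nonneg (k : ℕ) (ρ : Cfg k) (a b : Fin 3) : 0 ≤ lenf k ρ a b :=
  addf_nonneg (fun s a b => by
    have := eig_le_clsLen (cls s a b)
    rw [onCls]; linarith) k ρ a b

theorem lenf_le (k : ℕ) (ρ : Cfg k) (a b : Fin 3) :
    lenf k ρ a b ≤ 1 / 18 * addf (onCls (eig alpha)) k ρ a b := by
  rw [← addf_mul]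
  exact addf_mono (fun s a b => (eig_le_clsLen (cls s a b)).2.1) k ρ a b

theorem le_lenf (k : ℕ) (ρ : Cfg k) (a b : Fin 3) :
    1 / 30 * addf (onCls (eig alpha)) k ρ a b ≤ lenf k ρ a b := by
  rw [← addf_mul]
  exact addf_mono (fun s a b => (eig_le_clsLen (cls s a b)).1) k ρ a b

theorem avg_lenf_sq_le : ∃ C, 0 < C ∧ ∀ (k : ℕ) (s : St) (a b : Fin 3), Valid s a b →
    avg k s (fun c => lenf k c a b ^ 2) ≤ C * (alpha ^ 2) ^ k := by
  obtain ⟨C, hC0, hC⟩ := avg_addf_sq_le isEigen_alpha five_le_alpha_sq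
  refine ⟨C + 1, by linarith, fun k s a b h => ?_⟩
  refine (avg_mono k fun c _ => ?_).trans ((hC k s a b h).trans ?_)
  · have h1 := lenf_nonneg k c a b
    have h2 := lenf_le k c a b
    exact pow_le_pow_left₀ h1 (by linarith) 2
  · have : 0 ≤ (alpha ^ 2) ^ k := by positivity
    nlinarith

theorem le_avg_lenf (k : ℕ) {s : St} {a b : Fin 3} (h : Valid s a b) :
    1 / 2 * alpha ^ k ≤ avg k s fun c => lenf k c a b := by
  have h1 : avg k s (fun c => 1 / 30 * addf (onCls (eig alpha)) k c a b) ≤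
      avg k s fun c => lenf k c a b := avg_mono k fun c _ => le_lenf k c a b
  rw [avg_const_mul, avg_addf isEigen_alpha k h] at h1
  refine le_trans ?_ h1
  have h2 : (18 : ℝ) ≤ onCls (eig alpha) s a b := (eig_le_clsLen _).2.2
  have h3 : 0 < alpha ^ k := pow_pos alpha_pos k
  nlinarith

open Classical in
/-- Small lengths have probability bounded away from `1`. -/
theorem exists_avg_small_le : ∃ ε θ : ℝ, 0 < ε ∧ 0 ≤ θ ∧ θ < 1 ∧ ∀ (k : ℕ) (s : St) (a b : Fin 3),
    Valid s a b → avg k s (fun c => if lenf k c a b ≤ ε * alpha ^ k then 1 else 0) ≤ θ := by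
  obtain ⟨C, hC0, hC⟩ := avg_lenf_sq_le
  set C' := C + 1 with hC'
  -- Balances the gain $\eta$ from the first moment against the cost $\eta^2C'=\eta/4$ from the
  -- second.
  set η : ℝ := 1 / (4 * C') with hη
  have hη0 : 0 < η := by positivity
  refine ⟨1 / 4, 1 - η / 4, by norm_num, ?_, by linarith, fun k s a b h => ?_⟩
  · have : η ≤ 1 := by rw [hη, div_le_one (by positivity)]; linarith
    linarith
  set A := alpha ^ k with hA
  have hA0 : 0 < A := pow_pos alpha_pos k
  -- A quadratic majorant of the indicator: for small lengths the linear term costs at most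
  -- $\eta/2$, and elsewhere the right side is a square plus $\eta/2$. Its average is at most
  -- $1+\eta/2-\eta+\eta/4$.
  have h1 : ∀ c, (if lenf k c a b ≤ 1 / 4 * A then 1 else 0 : ℝ) ≤
      (1 + η / 2) + ((-(2 * η / A)) * lenf k c a b + (η / A) ^ 2 * lenf k c a b ^ 2) := by
    intro c
    have e : (1 + η / 2) + ((-(2 * η / A)) * lenf k c a b + (η / A) ^ 2 * lenf k c a b ^ 2) =
        (1 - η / A * lenf k c a b) ^ 2 + η / 2 := by ring
    split_ifs with hc
    · have h2 : 2 * η / A * lenf k c a b ≤ η / 2 := by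
        calc 2 * η / A * lenf k c a b ≤ 2 * η / A * (1 / 4 * A) := by gcongr
          _ = η / 2 := by field_simp; ring
      have : 0 ≤ (η / A) ^ 2 * lenf k c a b ^ 2 := by positivity
      linarith
    · rw [e]; positivity
  refine (avg_mono k fun c _ => h1 c).trans ?_
  rw [avg_add_const k h.1, avg_add, avg_const_mul, avg_const_mul]
  have h2 : 2 * η / A * (1 / 2 * A) ≤ 2 * η / A * avg k s fun c => lenf k c a b :=
    mul_le_mul_of_nonneg_left (le_avg_lenf k h) (by positivity)
  have h3 : (η / A) ^ 2 * avg k s (fun c => lenf k c a b ^ 2) ≤ (η / A) ^ 2 * (C' * A ^ 2) := by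
    refine mul_le_mul_of_nonneg_left ((hC k s a b h).trans ?_) (by positivity)
    rw [← pow_mul, mul_comm 2 k, pow_mul]
    gcongr
    linarith
  have h4 : 2 * η / A * (1 / 2 * A) = η := by field_simp
  have h5 : (η / A) ^ 2 * (C' * A ^ 2) = η / 4 := by
    rw [hη]; field_simp
  rw [h4] at h2
  rw [h5] at h3
  linarith

theorem avg_mul_const (k : ℕ) (s : St) (f : Cfg k → ℝ) (r : ℝ) :
    avg k s (fun c => f c * r) = avg k s f * r := by
  simp only [mul_comm _ r, avg_const_mul]

theorem avg_prod_triple (k : ℕ) (t : Fin 3 → St) (f : Fin 3 → Cfg k → ℝ) :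
    (avg k (t 0) fun x => avg k (t 1) fun y => avg k (t 2) fun z => f 0 x * f 1 y * f 2 z) =
      ∏ i, avg k (t i) (f i) := by
  simp only [avg_const_mul, avg_mul_const]
  rw [Fin.prod_univ_three]

-- Every path crosses at least the pieces of its two end corners, which are conditionally
-- independent. A short total forces both crossings to be short, which squares the probability.
open Classical in
theorem avg_small_succ {k : ℕ} {x q : ℝ} (hq0 : 0 ≤ q) (hq1 : q ≤ 1) (hq : ∀ s a b, Valid s a b →
    avg k s (fun c => if lenf k c a b ≤ x then 1 else 0) ≤ q) {s : St} {a b : Fin 3}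
    (h : Valid s a b) :
    avg (k + 1) s (fun c => if lenf (k + 1) c a b ≤ x then 1 else 0) ≤ q ^ 2 := by
  refine le_of_eq_of_le (avg_lift_comp (lenf k) a b fun r => if r ≤ x then 1 else 0) ?_
  rw [inv_mul_le_iff₀ (by
    rw [card_Fib h.1]; exact_mod_cast cardTable_pos s), ← nsmul_eq_mul]
  refine Finset.sum_le_card_nsmul _ _ _ fun t ht => ?_
  have h7 := ne_seven_of_mem_Fib h.1 ht
  set f : Fin 3 → Cfg k → ℝ := fun i c =>
    (leg t a b i).elim 1 fun p => if lenf k c p.1 p.2 ≤ x then 1 else 0 with hf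
  have hle : ∀ c d e : Cfg k, (if ((leg t a b 0).elim 0 fun p => lenf k c p.1 p.2) +
      ((leg t a b 1).elim 0 fun p => lenf k d p.1 p.2) +
      ((leg t a b 2).elim 0 fun p => lenf k e p.1 p.2) ≤ x then (1 : ℝ) else 0) ≤
      f 0 c * f 1 d * f 2 e := by
    intro c d e
    have nn : ∀ (i : Fin 3) (c : Cfg k), 0 ≤ (leg t a b i).elim 0 fun p => lenf k c p.1 p.2 := by
      intro i c
      cases leg t a b i with
      | none => exact le_rfl
      | some p => exact lenf_nonneg k c p.1 p.2
    have f0 : ∀ i c, 0 ≤ f i c := by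
      intro i c
      simp only [hf]
      cases leg t a b i with
      | none => exact zero_le_one
      | some p => simp only [Option.elim]; split_ifs <;> norm_num
    have f1 : ∀ (i : Fin 3) (c : Cfg k),
        ((leg t a b i).elim 0 fun p => lenf k c p.1 p.2) ≤ x → f i c = 1 := by
      intro i c hc
      simp only [hf]
      revert hc
      cases leg t a b i with
      | none => exact fun _ => rfl
      | some p => exact fun hc => if_pos hc
    split_ifs with hx
    · have n0 := nn 0 c
      have n1 := nn 1 d
      have n2 := nn 2 e
      rw [f1 0 c (by linarith), f1 1 d (by linarith), f1 2 e (by linarith)]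
      norm_num
    · exact mul_nonneg (mul_nonneg (f0 _ _) (f0 _ _)) (f0 _ _)
  refine (avg_mono k fun c _ => avg_mono k fun d _ => avg_mono k fun e _ => hle c d e).trans ?_
  rw [avg_prod_triple]
  have g0 : ∀ i, 0 ≤ avg k (t i) (f i) := by
    intro i
    refine avg_nonneg k (h7 i) fun c _ => ?_
    simp only [hf]
    cases leg t a b i with
    | none => exact zero_le_one
    | some p => simp only [Option.elim]; split_ifs <;> norm_num
  have g1 : ∀ i p, leg t a b i = some p → avg k (t i) (f i) ≤ q := by
    intro i p hp
    simp only [hf, hp, Option.elim]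
    exact hq _ _ _ (h.leg ht hp)
  have g2 : avg k (t (third a b)) (f (third a b)) ≤ 1 := by
    rcases hp : leg t a b (third a b) with _ | p
    · simp only [hf, hp, Option.elim]
      exact (avg_const k (h7 _) 1).le
    · exact (g1 _ p hp).trans hq1
  obtain ⟨-, -, d1, d2⟩ := third_spec a b h.2
  rw [univ_eq_corners h.2, Finset.prod_insert (by simp [h.2, d1]), Finset.prod_insert
    (by simpa using d2.symm), Finset.prod_singleton]
  have ga := g1 a _ (if_pos rfl)
  have gb := g1 b _ ((if_neg h.2.symm).trans (if_pos rfl))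
  calc avg k (t a) (f a) * (avg k (t b) (f b) * avg k (t (third a b)) (f (third a b)))
      ≤ q * (q * 1) := by
        refine mul_le_mul ga (mul_le_mul gb g2 (g0 _) hq0) (mul_nonneg (g0 _) (g0 _)) hq0
    _ = q ^ 2 := by ring

open Classical in
/-- Lengths of much smaller order than expected are very unlikely. -/
theorem exists_avg_very_small_le : ∃ ε θ : ℝ, 0 < ε ∧ 0 ≤ θ ∧ θ < 1 ∧
    ∀ (j k : ℕ) (s : St) (a b : Fin 3), Valid s a b →
      avg (k + j) s (fun c => if lenf (k + j) c a b ≤ ε * alpha ^ k then 1 else 0) ≤ θ ^ 2 ^ j := by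
  obtain ⟨ε, θ, hε, hθ0, hθ1, h⟩ := exists_avg_small_le
  refine ⟨ε, θ, hε, hθ0, hθ1, fun j k => ?_⟩
  induction j with
  | zero =>
    rw [pow_zero, pow_one]
    exact h k
  | succ j ih =>
    intro s a b hs
    rw [pow_succ, pow_mul]
    exact avg_small_succ (by positivity) (pow_le_one₀ hθ0 hθ1.le) ih hs

/-! ### The third corner -/

/-- The path from `a` to `b` enters the piece of level `k` at the third corner. -/
def HitsThird : (k : ℕ) → Cfg k → Fin 3 → Fin 3 → Prop
  | 0, _, _, _ => True
  | k + 1, ρ, a, b => ¬ direct (fun i => root k (ρ i)) a b ∧ HitsThird k (ρ (third a b)) a b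

/-- The weights of the classes for the probability of reaching the third corner. -/
def wt (c : Fin 3) : ℕ := if c = 2 then 4 else 1

/-- The weights form a supersolution: one subdivision at least halves the expected weight of the
crossing at the third corner. The class with two edges weighs more because its path visits the third
corner in the state itself. -/
theorem fibSum_third : ∀ s : St, s ≠ 7 → ∀ a b, a ≠ b → conn s a b →
    2 * fibSum s (fun t => if direct t a b then 0 else wt (cls (t (third a b)) a b)) ≤
      cardTable s * wt (cls s a b) := by decide +kernel

theorem avg_node_apply (k : ℕ) {t : Fin 3 → St} (h7 : ∀ i, t i ≠ 7) (i : Fin 3) (f : Cfg k → ℝ) :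
    (avg k (t 0) fun x => avg k (t 1) fun y => avg k (t 2) fun z => f (node x y z i)) =
      avg k (t i) f := by
  fin_cases i
  · show (avg k (t 0) fun x => avg k (t 1) fun y => avg k (t 2) fun z => f x) = _
    simp only [avg_const k (h7 _)]; rfl
  · show (avg k (t 0) fun x => avg k (t 1) fun y => avg k (t 2) fun z => f y) = _
    simp only [avg_const k (h7 _)]; rfl
  · show (avg k (t 0) fun x => avg k (t 1) fun y => avg k (t 2) fun z => f z) = _
    simp only [avg_const k (h7 _)]; rfl

open Classical in
theorem avg_hitsThird_le : ∀ (k : ℕ) {s : St} {a b : Fin 3}, Valid s a b →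
    avg k s (fun c => if HitsThird k c a b then 1 else 0) ≤ wt (cls s a b) * (1 / 2) ^ k
  | 0, s, a, b, h => by
    refine (avg_mono 0 (g := fun _ => 1) fun c _ => ?_).trans ((avg_const 0 h.1 1).trans_le ?_)
    · split_ifs <;> norm_num
    · rw [pow_zero, mul_one]
      unfold wt; split_ifs <;> norm_num
  | k + 1, s, a, b, h => by
    have hcard : (0 : ℝ) < (Fib s).card := by
      rw [card_Fib h.1]; exact_mod_cast cardTable_pos s
    rw [avg, inv_mul_le_iff₀ hcard]
    have key : ∀ t ∈ Fib s, (avg k (t 0) fun x => avg k (t 1) fun y => avg k (t 2) fun z =>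
        if HitsThird (k + 1) (node x y z) a b then (1 : ℝ) else 0) ≤
        (1 / 2) ^ k * ((if direct t a b then 0 else wt (cls (t (third a b)) a b) : ℕ) : ℝ) := by
      intro t ht
      have h7 := ne_seven_of_mem_Fib h.1 ht
      by_cases hd : direct t a b
      · refine le_of_eq ?_
        rw [if_pos hd, Nat.cast_zero, mul_zero]
        have : (avg k (t 0) fun x => avg k (t 1) fun y => avg k (t 2) fun z =>
            if HitsThird (k + 1) (node x y z) a b then (1 : ℝ) else 0) =
            avg k (t 0) fun x => avg k (t 1) fun y => avg k (t 2) fun z => (0 : ℝ) := by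
          refine avg_congr fun x hx => avg_congr fun y hy => avg_congr fun z hz => if_neg ?_
          rw [HitsThird, root_node hx hy hz]
          exact fun e => e.1 hd
        rw [this]
        simp only [avg_const k (h7 _)]
      · have : (avg k (t 0) fun x => avg k (t 1) fun y => avg k (t 2) fun z =>
            if HitsThird (k + 1) (node x y z) a b then (1 : ℝ) else 0) =
            avg k (t 0) fun x => avg k (t 1) fun y => avg k (t 2) fun z =>
              if HitsThird k (node x y z (third a b)) a b then (1 : ℝ) else 0 := by
          refine avg_congr fun x hx => avg_congr fun y hy => avg_congr fun z hz => if_congr ?_ rfl rfl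
          rw [HitsThird, root_node hx hy hz]
          exact and_iff_right hd
        rw [this, avg_node_apply k h7 (third a b) fun c => if HitsThird k c a b then (1 : ℝ) else 0,
          if_neg hd, mul_comm]
        have hleg : leg t a b (third a b) = some (a, b) := by
          obtain ⟨-, -, d1, d2⟩ := third_spec a b h.2
          rw [leg, if_neg d1.symm, if_neg d2, if_neg hd]
        exact avg_hitsThird_le k (h.leg ht hleg)
    refine (Finset.sum_le_sum key).trans ?_
    rw [← Finset.mul_sum, ← Nat.cast_sum, sum_Fib, card_Fib h.1]
    have h3 : (2 : ℝ) * (fibSum s fun t => if direct t a b then 0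
        else wt (cls (t (third a b)) a b) : ℕ) ≤ cardTable s * wt (cls s a b) := by
      exact_mod_cast fibSum_third s h.1 a b h.2 h.3
    have h4 : (0 : ℝ) < (1 / 2) ^ k := by positivity
    rw [pow_succ]
    nlinarith

/-! ### Lengths and corners in terms of configurations -/

theorem tr_cfgOf : ∀ (k : ℕ) {σ : List (Fin 3) → St}, Consistent σ →
    tr k (cfgOf (k + 1) σ) = cfgOf k σ
  | 0, _, h => h.tau_eq
  | k + 1, _, h => funext fun i => tr_cfgOf k (h.sh i)

theorem root_pieces (k : ℕ) {σ : List (Fin 3) → St} (h : Consistent σ) :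
    (fun i => root k (cfgOf (k + 1) σ i)) = fun i => σ [i] :=
  funext fun i => root_cfgOf k (h.sh i)

theorem len_eq_lenf : ∀ (k : ℕ) {σ : List (Fin 3) → St}, Consistent σ → ∀ {a b : Fin 3},
    Valid (σ []) a b → (len k σ a b : ℝ) = lenf k (cfgOf k σ) a b
  | 0, σ, _, a, b, _ => by
    show (((if has (σ []) (third a b) then [u a] else [u a, u (third a b)]).length : ℕ) : ℝ) =
      clsLen (cls (σ []) a b)
    unfold cls
    split_ifs <;> simp [clsLen]
  | k + 1, σ, h, a, b, hv => by
    have h1 : len (k + 1) σ a b = ((route (fun i => σ [i]) a b).map fun x =>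
        len k (sh x.1 σ) x.2.1 x.2.2).sum := by
      rw [len, vl, List.length_flatMap]
      simp [len]
    rw [h1, sum_route _ hv.2]
    show _ = lift (lenf k) (cfgOf (k + 1) σ) a b
    rw [lift, root_pieces k h]
    push_cast
    refine Finset.sum_congr rfl fun i _ => ?_
    rcases hx : leg (fun i => σ [i]) a b i with _ | x
    · simp
    · exact len_eq_lenf k (h.sh i) (hv.leg (mem_Fib.2 h.tau_eq) hx)

/-- Only a detour uses the piece at the third corner; there it again goes from corner `a` to corner
`b`, so the same question recurs. -/
theorem hitsThird_of_mem : ∀ (k : ℕ) {σ : List (Fin 3) → St}, Consistent σ → ∀ {a b : Fin 3},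
    a ≠ b → List.replicate k (third a b) ∈ (cr k σ a b).map Prod.fst → HitsThird k (cfgOf k σ) a b
  | 0, _, _, _, _, _, _ => trivial
  | k + 1, σ, h, a, b, hab, hmem => by
    obtain ⟨x, hx, hxe⟩ := List.mem_map.1 hmem
    rw [cr, List.mem_flatMap] at hx
    obtain ⟨y, hy, hx⟩ := hx
    obtain ⟨z, hz, rfl⟩ := List.mem_map.1 hx
    rw [List.replicate_succ, List.cons.injEq] at hxe
    obtain ⟨-, -, d1, d2⟩ := third_spec a b hab
    rw [HitsThird, root_pieces k h]
    rcases route_cases (fun i => σ [i]) a b with ⟨-, hrt⟩ | ⟨hd, hrt⟩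
    · rw [hrt] at hy
      simp only [List.mem_cons, List.not_mem_nil, or_false] at hy
      rcases hy with rfl | rfl
      · exact absurd hxe.1 d1
      · exact absurd hxe.1.symm d2
    · rw [hrt] at hy
      simp only [List.mem_cons, List.not_mem_nil, or_false] at hy
      rcases hy with rfl | rfl | rfl
      · exact absurd hxe.1 d1
      · exact ⟨hd, hitsThird_of_mem k (h.sh _) hab (List.mem_map.2 ⟨z, hz, hxe.2⟩)⟩
      · exact absurd hxe.1.symm d2

/-! ### The law of the configuration in a part -/

section Law

variable {Ω : Type*} [MeasurableSpace Ω] {P : Measure Ω}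

/-- A random configuration whose probabilities depend on the root only. -/
structure Balanced (P : Measure Ω) (k : ℕ) (ρ : Ω → Cfg k) : Prop where
  measurableSet : ∀ c, MeasurableSet {ω | ρ ω = c}
  eq : ∀ c c', root k c = root k c' → P {ω | ρ ω = c} = P {ω | ρ ω = c'}

/-- Replace a piece of a configuration. -/
def replace {k : ℕ} (i : Fin 3) (c : Cfg k) (d : Cfg (k + 1)) : Cfg (k + 1) :=
  fun j => if j = i then c else d j

theorem replace_same {k : ℕ} (i : Fin 3) (c : Cfg k) (d : Cfg (k + 1)) : replace i c d i = c :=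
  if_pos rfl

theorem replace_ne {k : ℕ} {i j : Fin 3} (h : j ≠ i) (c : Cfg k) (d : Cfg (k + 1)) :
    replace i c d j = d j :=
  if_neg h

theorem replace_replace {k : ℕ} {i : Fin 3} {c c' : Cfg k} {d : Cfg (k + 1)} (h : d i = c) :
    replace i c (replace i c' d) = d := by
  funext j
  by_cases hj : j = i
  · subst hj
    rw [replace_same, h]
  · rw [replace_ne hj, replace_ne hj]

/-- Exchanging the piece `i` for another with the same root leaves the root of the whole unchanged,
so it is a bijection between equally likely configurations. -/
theorem Balanced.piece {k : ℕ} {ρ : Ω → Cfg (k + 1)} (h : Balanced P (k + 1) ρ) (i : Fin 3) :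
    Balanced P k fun ω => ρ ω i := by
  classical
  have hU : ∀ c : Cfg k, {ω | ρ ω i = c} =
      ⋃ d ∈ (Finset.univ.filter fun d : Cfg (k + 1) => d i = c), {ω | ρ ω = d} := by
    intro c
    ext ω
    simp
  have hP : ∀ c : Cfg k, P {ω | ρ ω i = c} =
      ∑ d ∈ (Finset.univ.filter fun d : Cfg (k + 1) => d i = c), P {ω | ρ ω = d} := by
    intro c
    rw [hU, measure_biUnion_finset _ fun d _ => h.measurableSet d]
    intro d _ d' _ hdd
    exact Set.disjoint_left.2 fun ω h1 h2 => hdd (Eq.trans (Eq.symm h1) h2)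
  refine ⟨fun c => ?_, fun c c' hc => ?_⟩
  · rw [hU]
    exact Finset.measurableSet_biUnion _ fun d _ => h.measurableSet d
  · rw [hP, hP]
    refine Finset.sum_nbij' (replace i c') (replace i c) ?_ ?_ ?_ ?_ ?_
    · exact fun d _ => Finset.mem_filter.2 ⟨Finset.mem_univ _, replace_same i c' d⟩
    · exact fun d _ => Finset.mem_filter.2 ⟨Finset.mem_univ _, replace_same i c d⟩
    · exact fun d hd => replace_replace (Finset.mem_filter.1 hd).2
    · exact fun d hd => replace_replace (Finset.mem_filter.1 hd).2
    · intro d hd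
      refine h.eq _ _ (congrArg tau (funext fun j => ?_))
      by_cases hj : j = i
      · subst hj
        rw [replace_same, (Finset.mem_filter.1 hd).2, hc]
      · rw [replace_ne hj]

theorem balanced_shw {σ : Ω → List (Fin 3) → St} (h : ∀ k, Balanced P k fun ω => cfgOf k (σ ω))
    (w : List (Fin 3)) (k : ℕ) : Balanced P k fun ω => cfgOf k (shw w (σ ω)) := by
  induction w generalizing σ with
  | nil => exact h k
  | cons i w ih => exact ih (σ := fun ω => sh i (σ ω)) fun k => (h (k + 1)).piece i

theorem Balanced.measurable {k : ℕ} {ρ : Ω → Cfg k} (h : Balanced P k ρ) (f : Cfg k → ℝ≥0∞) :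
    Measurable fun ω => f (ρ ω) := by
  let : MeasurableSpace (Cfg k) := ⊤
  have h1 : Measurable ρ := measurable_to_countable' h.measurableSet
  exact measurable_from_top.comp h1

/-- Given the root, the configuration is uniform. The expectation is therefore a mixture of averages
`avg k s f`, each at most `B`. -/
theorem Balanced.lintegral_le [IsProbabilityMeasure P] {k : ℕ} {ρ : Ω → Cfg k}
    (h : Balanced P k ρ) (h7 : ∀ ω, root k (ρ ω) ≠ 7) {f : Cfg k → ℝ} (hf : ∀ c, 0 ≤ f c) {B : ℝ}
    (hB : ∀ s, s ≠ 7 → avg k s f ≤ B) : ∫⁻ ω, ENNReal.ofReal (f (ρ ω)) ∂P ≤ ENNReal.ofReal B := by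
  classical
  have hB0 : 0 ≤ B := (avg_nonneg k (s := 0) (by decide) fun c _ => hf c).trans (hB 0 (by decide))
  have hlin : ∀ g : Cfg k → ℝ≥0∞, ∫⁻ ω, g (ρ ω) ∂P = ∑ c, g c * P {ω | ρ ω = c} := by
    intro g
    have : ∀ ω, g (ρ ω) = ∑ c, ({ω | ρ ω = c} : Set Ω).indicator (fun _ => g c) ω := by
      intro ω
      rw [Finset.sum_eq_single (ρ ω)]
      · simp
      · intro c _ hc
        exact Set.indicator_of_notMem (fun h => hc (Eq.symm h)) _
      · simp
    simp only [this]
    rw [lintegral_finsetSum _ fun c _ => measurable_const.indicator (h.measurableSet c)]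
    refine Finset.sum_congr rfl fun c _ => ?_
    rw [lintegral_indicator (h.measurableSet c), setLIntegral_const]
  have hone := hlin fun _ => 1
  rw [lintegral_const, measure_univ, one_mul] at hone
  have hfib : ∀ g : Cfg k → ℝ≥0∞, ∑ c, g c * P {ω | ρ ω = c} =
      ∑ s, ∑ c with root k c = s, g c * P {ω | ρ ω = c} := fun g =>
    (Finset.sum_fiberwise _ _ _).symm
  rw [hlin fun c => ENNReal.ofReal (f c)]
  have hB1 : ENNReal.ofReal B = ENNReal.ofReal B * ∑ c, 1 * P {ω | ρ ω = c} := by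
    rw [← hone, mul_one]
  rw [hB1, hfib, hfib fun _ => 1, Finset.mul_sum]
  refine Finset.sum_le_sum fun s _ => ?_
  rcases (Finset.univ.filter fun c : Cfg k => root k c = s).eq_empty_or_nonempty with he | ⟨c₀, hc₀⟩
  · rw [he]; simp
  have hc₀ := (Finset.mem_filter.1 hc₀).2
  have hg : ∀ c ∈ Finset.univ.filter fun c : Cfg k => root k c = s,
      P {ω | ρ ω = c} = P {ω | ρ ω = c₀} := fun c hc =>
    h.eq _ _ ((Finset.mem_filter.1 hc).2.trans hc₀.symm)
  have hg' : ∀ g : Cfg k → ℝ≥0∞, ∑ c with root k c = s, g c * P {ω | ρ ω = c} =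
      (∑ c with root k c = s, g c) * P {ω | ρ ω = c₀} := by
    intro g
    rw [Finset.sum_mul]
    exact Finset.sum_congr rfl fun c hc => by rw [hg c hc]
  rw [hg', hg' fun _ => 1, ← mul_assoc]
  -- The averages are controlled only for roots other than `7`; the root `7` has probability zero.
  by_cases hs : s = 7
  · have : {ω | ρ ω = c₀} = ∅ := by
      ext ω
      simp only [Set.mem_ofPred_eq, Set.mem_empty_iff_false, iff_false]
      rintro rfl
      exact h7 ω (hc₀.trans hs)
    rw [this]; simp
  · refine mul_le_mul_left ?_ _
    rw [← ENNReal.ofReal_sum_of_nonneg fun c _ => hf c, Finset.sum_const, nsmul_eq_mul, mul_one,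
      ← ENNReal.ofReal_natCast, ← ENNReal.ofReal_mul hB0]
    exact ENNReal.ofReal_le_ofReal (sum_le_of_avg_le k hs (hB s hs))

theorem Balanced.ae_summable [IsProbabilityMeasure P] {e : ℕ → ℕ} {ρ : ∀ k, Ω → Cfg (e k)}
    (h : ∀ k, Balanced P (e k) (ρ k)) (h7 : ∀ k ω, root (e k) (ρ k ω) ≠ 7) {f : ∀ k, Cfg (e k) → ℝ}
    (hf : ∀ k c, 0 ≤ f k c) {C r : ℝ} (hr0 : 0 ≤ r) (hr1 : r < 1)
    (hB : ∀ k s, s ≠ 7 → avg (e k) s (f k) ≤ C * r ^ k) :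
    ∀ᵐ ω ∂P, Summable fun k => f k (ρ k ω) := by
  have hsum : Summable fun k => C * r ^ k := (summable_geometric_of_lt_one hr0 hr1).mul_left C
  have hfin : ∫⁻ ω, ∑' k, ENNReal.ofReal (f k (ρ k ω)) ∂P ≠ ∞ := by
    rw [lintegral_tsum fun k => ((h k).measurable fun c => ENNReal.ofReal (f k c)).aemeasurable]
    refine ne_top_of_le_ne_top hsum.tsum_ofReal_ne_top (ENNReal.tsum_le_tsum fun k => ?_)
    exact (h k).lintegral_le (h7 k) (hf k) (hB k)
  filter_upwards [ae_lt_top' (AEMeasurable.tsum fun k =>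
    ((h k).measurable fun c => ENNReal.ofReal (f k c)).aemeasurable) hfin] with ω hω
  have := ENNReal.summable_toReal hω.ne
  exact this.congr fun k => ENNReal.toReal_ofReal (hf k _)

variable {T : Ω → LimitTree}

theorem measurable_proj (n : ℕ) : Measurable fun t : LimitTree => t.proj n :=
  measurable_iff_comap_le.2 (le_iSup (fun n => MeasurableSpace.comap
    (fun t : LimitTree => t.proj n) inferInstance) n)

theorem balanced_code (hT : IsUniformLimitTree P T) (n : ℕ) :
    Balanced P n fun ω => code ((T ω).proj n) := by
  have hm : Measurable fun ω => (T ω).proj n := (measurable_proj n).comp hT.1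
  have hpt : ∀ t : SpanTree n, P {ω | (T ω).proj n = t} = (Measure.count (Set.univ : Set (SpanTree n)))⁻¹ := by
    intro t
    have ht : MeasurableSet ({t} : Set (SpanTree n)) := trivial
    have h1 := congrArg (fun μ => μ {t}) (hT.2 n)
    rw [Measure.map_apply hm ht, uniformOn, cond_apply MeasurableSet.univ, Set.univ_inter,
      Measure.count_singleton' ht, mul_one] at h1
    exact h1
  have hcode : ∀ c : Cfg n, isTree (root n c) → ∃ t, ∀ ω, code ((T ω).proj n) = c ↔ (T ω).proj n = t := by
    intro c hc
    refine ⟨(codeEquiv n).symm ⟨c, hc⟩, fun ω => ?_⟩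
    rw [Equiv.eq_symm_apply, Subtype.ext_iff]
    rfl
  refine ⟨fun c => ?_, fun c c' hc => ?_⟩
  · exact hm (t := {t | code t = c}) trivial
  · by_cases h : isTree (root n c)
    · obtain ⟨t, ht⟩ := hcode c h
      obtain ⟨t', ht'⟩ := hcode c' (hc ▸ h)
      simp only [ht, ht', hpt]
    -- Configurations whose root is not a tree are not codes of spanning trees, so both
    -- probabilities are zero.
    · have he : ∀ c, ¬ isTree (root n c) → {ω | code ((T ω).proj n) = c} = ∅ := by
        intro c hc
        ext ω
        simp only [Set.mem_ofPred_eq, Set.mem_empty_iff_false, iff_false]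
        rintro rfl
        exact hc (isTree_code _)
      rw [he c h, he c' (hc ▸ h)]

/-- The configuration of level `k` in the part with word `w`. -/
noncomputable def part (T : LimitTree) (w : List (Fin 3)) (k : ℕ) : Cfg k := cfgOf k (shw w (states T))

theorem root_part (T : LimitTree) (w : List (Fin 3)) (k : ℕ) : root k (part T w k) = states T w := by
  rw [part, root_cfgOf k ((consistent_states T).shw w), shw, List.append_nil]

theorem balanced_part (hT : IsUniformLimitTree P T) (w : List (Fin 3)) (k : ℕ) :
    Balanced P k fun ω => part (T ω) w k := by
  refine balanced_shw (σ := fun ω => states (T ω)) (fun k => ?_) w k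
  simp only [cfgOf_states]
  exact balanced_code hT k

theorem root_part_ne (T : LimitTree) (w : List (Fin 3)) (k : ℕ) : root k (part T w k) ≠ 7 := by
  rw [root_part]
  exact (consistent_states T).ne_seven w

end Law

/-! ### Almost sure convergence of the lengths -/

/-- A perturbed linear recursion with factor in `[0,1]` and summable errors converges. -/
theorem exists_tendsto_of_recursion {r : ℝ} (hr0 : 0 ≤ r) (hr1 : r ≤ 1) {y d : ℕ → ℝ}
    (hy : ∀ k, y (k + 1) = r * y k + d k) (hd : Summable fun k => |d k|) :
    ∃ l, Tendsto y atTop (𝓝 l) := by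
  rcases hr1.eq_or_lt with rfl | hr1
  · have h : ∀ n, y n = y 0 + ∑ k ∈ Finset.range n, d k := by
      intro n
      induction n with
      | zero => simp
      | succ n ih => rw [hy, ih, Finset.sum_range_succ]; ring
    have h2 := (hd.of_abs.hasSum.tendsto_sum_nat).const_add (y 0)
    exact ⟨_, h2.congr fun n => (h n).symm⟩
  · refine ⟨0, ?_⟩
    -- For $r<1$, summing $|y_{k+1}|\le r|y_k|+|d_k|$ shows that $\sum|y_k|$ is finite.
    have hS : ∀ n, (1 - r) * ∑ k ∈ Finset.range n, |y k| ≤ |y 0| + ∑' k, |d k| := by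
      intro n
      have h1 : ∑ k ∈ Finset.range (n + 1), |y k| ≤
          |y 0| + (r * ∑ k ∈ Finset.range n, |y k| + ∑ k ∈ Finset.range n, |d k|) := by
        rw [Finset.sum_range_succ', add_comm, Finset.mul_sum, ← Finset.sum_add_distrib]
        refine add_le_add le_rfl (Finset.sum_le_sum fun k _ => ?_)
        rw [hy]
        refine (abs_add_le _ _).trans ?_
        rw [abs_mul, abs_of_nonneg hr0]
      have h2 := hd.sum_le_tsum (Finset.range n) fun k _ => abs_nonneg _
      have h3 : ∑ k ∈ Finset.range n, |y k| ≤ ∑ k ∈ Finset.range (n + 1), |y k| := by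
        rw [Finset.sum_range_succ]
        linarith [abs_nonneg (y n)]
      linarith
    have hsum : Summable fun k => |y k| := by
      refine summable_of_sum_range_le (c := (|y 0| + ∑' k, |d k|) / (1 - r))
        (fun _ => abs_nonneg _) fun n => ?_
      rw [le_div_iff₀ (by linarith), mul_comm]
      exact hS n
    exact (hsum.of_abs).tendsto_atTop_zero

section AlmostSure

variable {Ω : Type*} [MeasurableSpace Ω] {P : Measure Ω} [IsProbabilityMeasure P]
  {T : Ω → LimitTree}

theorem part_consistent (T : LimitTree) (w : List (Fin 3)) : Consistent (shw w (states T)) :=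
  (consistent_states T).shw w

theorem tr_part (T : LimitTree) (w : List (Fin 3)) (k : ℕ) : tr k (part T w (k + 1)) = part T w k :=
  tr_cfgOf k (part_consistent T w)

-- Functionals are meaningful only when the corners are connected. Setting them to zero otherwise
-- gives a function to which the bounds for all roots apply.
open Classical in
theorem avg_ite_conn (k : ℕ) {s : St} {a b : Fin 3} (hs : s ≠ 7) (hab : a ≠ b) {F : Cfg k → ℝ} {B : ℝ}
    (hB : 0 ≤ B) (h : Valid s a b → avg k s F ≤ B) :
    avg k s (fun c => if conn (root k c) a b then F c else 0) ≤ B := by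
  by_cases hc : conn s a b
  · rw [avg_congr (g := F)]
    · exact h ⟨hs, hab, hc⟩
    · intro c h; rw [h, if_pos hc]
  · rw [avg_congr (g := fun _ => 0), avg_const k hs]
    · exact hB
    · intro c h; rw [h, if_neg hc]

/-- The rescaled functional satisfies a linear recursion with factor $r/\bar\alpha\le1$. Its errors
have standard deviations $O((\sqrt3/\bar\alpha)^k)$ and are almost surely summable. -/
theorem ae_exists_tendsto_addf (hT : IsUniformLimitTree P T) {r : ℝ} {v : Fin 3 → ℝ}
    (hv : IsEigen r v) (hr0 : 0 ≤ r) (hr : r ≤ alpha) (w : List (Fin 3)) {a b : Fin 3} (hab : a ≠ b) :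
    ∀ᵐ ω ∂P, conn (states (T ω) w) a b → ∃ l, Tendsto
      (fun k => addf (onCls v) k (part (T ω) w k) a b / alpha ^ k) atTop (𝓝 l) := by
  classical
  obtain ⟨C, hC0, hC⟩ := avg_defect_sq_le hv
  have h5 := five_le_alpha_sq
  have hα := alpha_pos
  -- A number strictly between $3$ and $\bar\alpha^2$: the squared errors over $\beta^k$ are
  -- summable, and the factor $(4/5)^k$ remains to bound the errors themselves.
  set β : ℝ := alpha ^ 2 * (4 / 5) with hβ
  have hβ0 : 0 < β := by positivity
  have hsum := Balanced.ae_summable (P := P) (e := fun k => k + 1)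
    (ρ := fun k ω => part (T ω) w (k + 1)) (fun k => balanced_part hT w (k + 1))
    (fun k ω => root_part_ne (T ω) w (k + 1))
    (f := fun k c => if conn (root (k + 1) c) a b then
      (β ^ k)⁻¹ * defect r (onCls v) k c a b ^ 2 else 0)
    (fun k c => by split_ifs <;> positivity) (C := C) (r := 3 / β) (by positivity)
    ((div_lt_one hβ0).2 (by linarith)) (fun k s hs => by
      refine avg_ite_conn (k + 1) hs hab (by positivity) fun h => ?_
      rw [avg_const_mul, div_pow]
      calc (β ^ k)⁻¹ * _ ≤ (β ^ k)⁻¹ * (C * 3 ^ k) :=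
            mul_le_mul_of_nonneg_left (hC k s a b h) (by positivity)
        _ = C * (3 ^ k / β ^ k) := by ring)
  filter_upwards [hsum] with ω hω hc
  have hω : Summable fun k => (β ^ k)⁻¹ * defect r (onCls v) k (part (T ω) w (k + 1)) a b ^ 2 := by
    refine hω.congr fun k => ?_
    rw [root_part, if_pos hc]
  refine exists_tendsto_of_recursion (r := r / alpha)
    (d := fun k => defect r (onCls v) k (part (T ω) w (k + 1)) a b / alpha ^ (k + 1))
    (by positivity) ((div_le_one hα).2 hr) (fun k => ?_) ?_
  · rw [defect, tr_part, pow_succ]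
    field_simp
    ring
  · refine Summable.of_nonneg_of_le (fun _ => abs_nonneg _) (fun k => ?_) ((hω.add
      (summable_geometric_of_lt_one (r := (4 / 5 : ℝ)) (by norm_num) (by norm_num))).mul_left
        (alpha⁻¹))
    set D := defect r (onCls v) k (part (T ω) w (k + 1)) a b
    have e : |D / alpha ^ (k + 1)| = alpha⁻¹ * |D / alpha ^ k| := by
      rw [pow_succ, abs_div, abs_div, abs_mul, abs_of_pos hα]
      field_simp
    rw [e]
    -- The rescaled error squared is a product $pq$ with both sequences summable, and
    -- $pq\le(p+q)^2$.
    refine mul_le_mul_of_nonneg_left (abs_le_of_sq_le_sq ?_ (by positivity)) (by positivity)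
    have e2 : (D / alpha ^ k) ^ 2 = ((β ^ k)⁻¹ * D ^ 2) * (4 / 5) ^ k := by
      rw [hβ, mul_pow, ← pow_mul, mul_comm 2 k, pow_mul, div_pow]
      field_simp
    rw [e2]
    have p1 : 0 ≤ (β ^ k)⁻¹ * D ^ 2 := by positivity
    have p2 : (0 : ℝ) ≤ (4 / 5) ^ k := by positivity
    nlinarith

theorem ae_exists_tendsto_lenf (hT : IsUniformLimitTree P T) (w : List (Fin 3)) {a b : Fin 3}
    (hab : a ≠ b) : ∀ᵐ ω ∂P, conn (states (T ω) w) a b → ∃ l, Tendsto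
      (fun k => lenf k (part (T ω) w k) a b / alpha ^ k) atTop (𝓝 l) := by
  obtain ⟨c₀, c₁, c₂, hc⟩ := clsLen_eq
  have hα := alpha_bounds
  have hα₂ := alpha₂_bounds
  filter_upwards [ae_exists_tendsto_addf hT isEigen_ker le_rfl alpha_pos.le w hab,
    ae_exists_tendsto_addf hT isEigen_alpha alpha_pos.le le_rfl w hab,
    ae_exists_tendsto_addf hT isEigen_alpha₂ hα₂.1 (by linarith) w hab] with ω h0 h1 h2 hcon
  obtain ⟨l0, h0⟩ := h0 hcon
  obtain ⟨l1, h1⟩ := h1 hcon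
  obtain ⟨l2, h2⟩ := h2 hcon
  refine ⟨_, ((h0.const_mul c₀).add ((h1.const_mul c₁).add (h2.const_mul c₂))).congr fun k => ?_⟩
  have e : onCls clsLen = fun s a b => c₀ * onCls ker s a b +
      (c₁ * onCls (eig alpha) s a b + c₂ * onCls (eig alpha₂) s a b) := by
    funext s a b; exact hc _
  rw [lenf, e, addf_add, addf_mul, addf_add, addf_mul, addf_mul]
  ring

/-- A zero limit would make the paths, for every `j`, eventually as short as if `j` levels were
missing. This has probability at most $\theta^{2^j}$, and `j` is arbitrary. -/
theorem ae_not_tendsto_zero (hT : IsUniformLimitTree P T) (w : List (Fin 3)) {a b : Fin 3}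
    (hab : a ≠ b) : ∀ᵐ ω ∂P, conn (states (T ω) w) a b → ¬ Tendsto
      (fun k => lenf k (part (T ω) w k) a b / alpha ^ k) atTop (𝓝 0) := by
  classical
  obtain ⟨ε, θ, hε, hθ0, hθ1, h⟩ := exists_avg_very_small_le
  set A : ℕ → ℕ → Set Ω := fun j k => {ω | conn (states (T ω) w) a b ∧
    lenf (k + j) (part (T ω) w (k + j)) a b ≤ ε * alpha ^ k} with hA
  have hPA : ∀ j k, P (A j k) ≤ ENNReal.ofReal (θ ^ 2 ^ j) := by
    intro j k
    have hb := (balanced_part hT w (k + j)).lintegral_le (fun ω => root_part_ne (T ω) w (k + j))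
      (f := fun c => if conn (root (k + j) c) a b then
        (if lenf (k + j) c a b ≤ ε * alpha ^ k then 1 else 0) else 0)
      (fun c => by split_ifs <;> norm_num) (B := θ ^ 2 ^ j)
      (fun s hs => avg_ite_conn (k + j) hs hab (by positivity) fun hv => h j k s a b hv)
    refine le_trans ?_ hb
    refine (meas_ge_le_lintegral_div (μ := P) (f := fun ω => ENNReal.ofReal
      ((fun c => if conn (root (k + j) c) a b then
        (if lenf (k + j) c a b ≤ ε * alpha ^ k then (1 : ℝ) else 0) else 0) (part (T ω) w (k + j))))
      (((balanced_part hT w (k + j)).measurable fun c => ENNReal.ofReal (if conn (root (k + j) c) a b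
        then (if lenf (k + j) c a b ≤ ε * alpha ^ k then (1 : ℝ) else 0) else 0)).aemeasurable)
      one_ne_zero ENNReal.one_ne_top).trans' ?_ |>.trans (by rw [div_one])
    refine measure_mono fun ω hω => ?_
    rw [Set.mem_ofPred_eq]
    simp only
    rw [root_part, if_pos hω.1, if_pos hω.2, ENNReal.ofReal_one]
  have hPlim : ∀ j, P (⋃ K, ⋂ k ≥ K, A j k) ≤ ENNReal.ofReal (θ ^ 2 ^ j) := by
    intro j
    have hmono : Monotone fun K => ⋂ k ≥ K, A j k := fun K K' hK =>
      Set.biInter_mono (fun k hk => le_trans hK hk) fun _ _ => le_rfl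
    rw [hmono.measure_iUnion]
    exact iSup_le fun K => (measure_mono (Set.biInter_subset_of_mem (le_refl K))).trans (hPA j K)
  rw [ae_iff]
  have hsub : ∀ j, {ω | ¬ (conn (states (T ω) w) a b → ¬ Tendsto
      (fun k => lenf k (part (T ω) w k) a b / alpha ^ k) atTop (𝓝 0))} ⊆ ⋃ K, ⋂ k ≥ K, A j k := by
    intro j ω hω
    rw [Set.mem_ofPred_eq, Classical.not_imp, not_not] at hω
    obtain ⟨hc, hlim⟩ := hω
    have hpos : 0 < ε / alpha ^ j := div_pos hε (pow_pos alpha_pos j)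
    have hev := ((tendsto_add_atTop_iff_nat j).2 hlim).eventually (gt_mem_nhds hpos)
    obtain ⟨K, hK⟩ := eventually_atTop.1 hev
    refine Set.mem_iUnion.2 ⟨K, Set.mem_iInter₂.2 fun k hk => ⟨hc, ?_⟩⟩
    have h1 := hK k hk
    rw [div_lt_iff₀ (pow_pos alpha_pos _), pow_add] at h1
    refine h1.le.trans (le_of_eq ?_)
    have := (pow_pos alpha_pos j).ne'
    field_simp
  refine le_antisymm (ge_of_tendsto' (x := atTop) (f := fun j : ℕ => ENNReal.ofReal (θ ^ 2 ^ j)) ?_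
    fun j => (measure_mono (hsub j)).trans (hPlim j)) bot_le
  have ht := (tendsto_pow_atTop_nhds_zero_of_lt_one hθ0 hθ1).comp
    (tendsto_pow_atTop_atTop_of_one_lt (one_lt_two : (1 : ℕ) < 2))
  simpa using ENNReal.tendsto_ofReal ht

/-- The probabilities are at most $4\cdot2^{-k}$, so the indicators are almost surely summable and
cannot all be 1. -/
theorem ae_not_hitsThird (hT : IsUniformLimitTree P T) (w : List (Fin 3)) {a b : Fin 3}
    (hab : a ≠ b) : ∀ᵐ ω ∂P, conn (states (T ω) w) a b → ∃ k, ¬ HitsThird k (part (T ω) w k) a b := by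
  classical
  have hsum := Balanced.ae_summable (P := P) (e := fun k => k) (ρ := fun k ω => part (T ω) w k)
    (fun k => balanced_part hT w k) (fun k ω => root_part_ne (T ω) w k)
    (f := fun k c => if conn (root k c) a b then (if HitsThird k c a b then 1 else 0) else 0)
    (fun k c => by split_ifs <;> norm_num) (C := 4) (r := 1 / 2) (by norm_num) (by norm_num)
    (fun k s hs => by
      refine avg_ite_conn k hs hab (by positivity) fun h => (avg_hitsThird_le k h).trans ?_
      have : (wt (cls s a b) : ℝ) ≤ 4 := by unfold wt; split_ifs <;> norm_num
      gcongr)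
  filter_upwards [hsum] with ω hω hc
  by_contra! hall
  have h1 := hω.tendsto_atTop_zero
  have h2 : (fun k => if conn (root k (part (T ω) w k)) a b then
      (if HitsThird k (part (T ω) w k) a b then (1 : ℝ) else 0) else 0) = fun _ => 1 := by
    funext k
    rw [root_part, if_pos hc, if_pos (hall k)]
  rw [h2] at h1
  exact one_ne_zero (tendsto_nhds_unique tendsto_const_nhds h1)

open Classical in
/-- A bound for the squares of all limiting durations at level `n`. -/
noncomputable def sqBound (T : LimitTree) (n : ℕ) : ℝ≥0∞ :=
  ∑ x : (Fin n → Fin 3) × Fin 3 × Fin 3, liminf (fun k => ENNReal.ofReal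
    (if x.2.1 ≠ x.2.2 ∧ conn (root k (part T (List.ofFn x.1) k)) x.2.1 x.2.2 then
      (lenf k (part T (List.ofFn x.1) k) x.2.1 x.2.2 / alpha ^ k / alpha ^ n) ^ 2 else 0)) atTop

/-- By Fatou each summand has mean $O(\bar\alpha^{-2n})$, and there are $9\cdot3^n$ of them. Since
$3<\bar\alpha^2$ the means are summable over `n`. Lower limits avoid measurability questions about
limits that exist only almost surely. -/
theorem ae_tendsto_sqBound (hT : IsUniformLimitTree P T) :
    ∀ᵐ ω ∂P, Tendsto (sqBound (T ω)) atTop (𝓝 0) := by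
  classical
  obtain ⟨C, hC0, hC⟩ := avg_lenf_sq_le
  have h5 := five_le_alpha_sq
  have hα := alpha_pos
  have hmeas : ∀ n (x : (Fin n → Fin 3) × Fin 3 × Fin 3) k, Measurable fun ω => ENNReal.ofReal
      (if x.2.1 ≠ x.2.2 ∧ conn (root k (part (T ω) (List.ofFn x.1) k)) x.2.1 x.2.2 then
      (lenf k (part (T ω) (List.ofFn x.1) k) x.2.1 x.2.2 / alpha ^ k / alpha ^ n) ^ 2 else 0) :=
    fun n x k => (balanced_part hT (List.ofFn x.1) k).measurable fun c => ENNReal.ofReal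
      (if x.2.1 ≠ x.2.2 ∧ conn (root k c) x.2.1 x.2.2 then
        (lenf k c x.2.1 x.2.2 / alpha ^ k / alpha ^ n) ^ 2 else 0)
  have hbound : ∀ n (x : (Fin n → Fin 3) × Fin 3 × Fin 3) k, ∫⁻ ω, ENNReal.ofReal
      (if x.2.1 ≠ x.2.2 ∧ conn (root k (part (T ω) (List.ofFn x.1) k)) x.2.1 x.2.2 then
      (lenf k (part (T ω) (List.ofFn x.1) k) x.2.1 x.2.2 / alpha ^ k / alpha ^ n) ^ 2 else 0) ∂P ≤
      ENNReal.ofReal (C / (alpha ^ 2) ^ n) := by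
    intro n x k
    refine (balanced_part hT (List.ofFn x.1) k).lintegral_le
      (fun ω => root_part_ne (T ω) (List.ofFn x.1) k)
      (f := fun c => if x.2.1 ≠ x.2.2 ∧ conn (root k c) x.2.1 x.2.2 then
        (lenf k c x.2.1 x.2.2 / alpha ^ k / alpha ^ n) ^ 2 else 0)
      (fun c => by split_ifs <;> positivity) (fun s hs => ?_)
    by_cases hab : x.2.1 ≠ x.2.2
    · simp only [hab, true_and, ne_eq, not_false_eq_true]
      refine avg_ite_conn k hs hab (by positivity) fun hv => ?_
      have e : (fun c => (lenf k c x.2.1 x.2.2 / alpha ^ k / alpha ^ n) ^ 2) = fun c =>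
          ((alpha ^ 2) ^ k * (alpha ^ 2) ^ n)⁻¹ * lenf k c x.2.1 x.2.2 ^ 2 := by
        funext c
        rw [← pow_mul, ← pow_mul, mul_comm 2 k, mul_comm 2 n, pow_mul, pow_mul]
        field_simp
      rw [e, avg_const_mul]
      calc _ ≤ ((alpha ^ 2) ^ k * (alpha ^ 2) ^ n)⁻¹ * (C * (alpha ^ 2) ^ k) :=
            mul_le_mul_of_nonneg_left (hC k s _ _ hv) (by positivity)
        _ = C / (alpha ^ 2) ^ n := by field_simp
    · simp only [hab, false_and, if_false]
      rw [avg_const k hs]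
      positivity
  have hY : ∀ n, ∫⁻ ω, sqBound (T ω) n ∂P ≤ ENNReal.ofReal (9 * C * (3 / alpha ^ 2) ^ n) := by
    intro n
    unfold sqBound
    rw [lintegral_finsetSum _ fun x _ => Measurable.liminf (hmeas n x)]
    refine (Finset.sum_le_card_nsmul _ _ (ENNReal.ofReal (C / (alpha ^ 2) ^ n)) fun x _ => ?_).trans ?_
    · refine (lintegral_liminf_le (hmeas n x)).trans ?_
      refine (liminf_le_liminf (Eventually.of_forall (hbound n x))).trans ?_
      rw [liminf_const]
    · rw [nsmul_eq_mul, ← ENNReal.ofReal_natCast, ← ENNReal.ofReal_mul (by positivity)]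
      refine ENNReal.ofReal_le_ofReal (le_of_eq ?_)
      simp only [Finset.card_univ, Fintype.card_prod, Fintype.card_fun, Fintype.card_fin]
      push_cast
      rw [div_pow]
      ring
  have hmY : ∀ n, Measurable fun ω => sqBound (T ω) n := fun n =>
    Finset.measurable_fun_sum _ fun x _ => Measurable.liminf (hmeas n x)
  have hfin : ∫⁻ ω, ∑' n, sqBound (T ω) n ∂P ≠ ∞ := by
    rw [lintegral_tsum fun n => (hmY n).aemeasurable]
    have hs : Summable fun n => 9 * C * (3 / alpha ^ 2) ^ n :=
      (summable_geometric_of_lt_one (by positivity)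
        ((div_lt_one (by positivity)).2 (by linarith))).mul_left _
    exact ne_top_of_le_ne_top hs.tsum_ofReal_ne_top (ENNReal.tsum_le_tsum hY)
  filter_upwards [ae_lt_top' (AEMeasurable.tsum fun n => (hmY n).aemeasurable) hfin] with ω hω
  exact ENNReal.tendsto_atTop_zero_of_tsum_ne_top hω.ne

end AlmostSure

/-! ### The good event has full probability -/

theorem partDuration_eq_lenf (T : LimitTree) {n k j : ℕ} (hj : j < num T n) :
    partDuration (j + 1) n (X T (k + n)) =
      ENNReal.ofReal (lenf k (part T (crossing T n j).1 k) (crossing T n j).2.1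
        (crossing T n j).2.2 / alpha ^ k / alpha ^ n) := by
  obtain ⟨-, h2, h3⟩ := crossing_spec T hj
  have hv : Valid (shw (crossing T n j).1 (states T) []) (crossing T n j).2.1
      (crossing T n j).2.2 := by
    rw [shw, List.append_nil]
    exact ⟨(consistent_states T).ne_seven _, h2, h3⟩
  rw [partDuration_X T hj, dur, part, ← len_eq_lenf k (part_consistent T _) hv, div_div, ← pow_add,
    ENNReal.ofReal_div_of_pos (pow_pos alpha_pos _), ENNReal.ofReal_natCast, scale]

theorem exists_ofFn_eq {n : ℕ} {w : List (Fin 3)} (hw : w.length = n) :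
    ∃ f : Fin n → Fin 3, List.ofFn f = w := by
  subst hw
  exact ⟨w.get, List.ofFn_get w⟩

theorem GoodEvent.of_tendsto {T : LimitTree}
    (h1 : ∀ w a b, a ≠ b → conn (states T w) a b → ∃ l, Tendsto
      (fun k => lenf k (part T w k) a b / alpha ^ k) atTop (𝓝 l))
    (h2 : ∀ w a b, a ≠ b → conn (states T w) a b → ¬ Tendsto
      (fun k => lenf k (part T w k) a b / alpha ^ k) atTop (𝓝 0))
    (h3 : ∀ w a b, a ≠ b → conn (states T w) a b → ∃ k, ¬ HitsThird k (part T w k) a b)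
    (h4 : Tendsto (sqBound T) atTop (𝓝 0)) : GoodEvent T := by
  have key : ∀ n j, j < num T n → ∃ l : ℝ, 0 < l ∧
      Tendsto (fun k => lenf k (part T (crossing T n j).1 k) (crossing T n j).2.1
        (crossing T n j).2.2 / alpha ^ k) atTop (𝓝 l) ∧
      Tendsto (fun m => partDuration (j + 1) n (X T m)) atTop
        (𝓝 (ENNReal.ofReal (l / alpha ^ n))) := by
    intro n j hj
    obtain ⟨-, c2, c3⟩ := crossing_spec T hj
    obtain ⟨l, hl⟩ := h1 _ _ _ c2 c3
    refine ⟨l, lt_of_le_of_ne (ge_of_tendsto' hl fun k => div_nonneg (lenf_nonneg _ _ _ _)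
      (pow_pos alpha_pos k).le) ?_, hl, ?_⟩
    · rintro rfl
      exact h2 _ _ _ c2 c3 hl
    · rw [← tendsto_add_atTop_iff_nat n]
      simp only [partDuration_eq_lenf T hj]
      exact ENNReal.tendsto_ofReal (hl.div_const _)
  have hdur : DurationsConverge T := by
    intro n j hj1 hj
    rw [numParts_X_self] at hj
    obtain ⟨j, rfl⟩ := Nat.exists_eq_add_of_le' hj1
    obtain ⟨l, hl0, -, hl⟩ := key n j hj
    exact ⟨_, ENNReal.ofReal_pos.2 (div_pos hl0 (pow_pos alpha_pos n)), ENNReal.ofReal_lt_top, hl⟩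
  refine GoodEvent.of_missesThird hdur (fun n j hj => ?_) ?_
  · obtain ⟨-, c2, c3⟩ := crossing_spec T hj
    obtain ⟨k, hk⟩ := h3 _ _ _ c2 c3
    exact ⟨k, fun hmem => hk (hitsThird_of_mem k (part_consistent T _) c2 hmem)⟩
  · rw [ENNReal.tendsto_nhds_zero] at h4 ⊢
    intro ε hε
    filter_upwards [h4 (ε ^ 2) (pos_iff_ne_zero.2 (pow_ne_zero 2 hε.ne'))] with n hn
    refine iSup₂_le fun j ⟨hj1, hj⟩ => ?_
    rw [numParts_X_self] at hj
    obtain ⟨j, rfl⟩ := Nat.exists_eq_add_of_le' hj1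
    obtain ⟨l, hl0, hl, hS⟩ := key n j hj
    obtain ⟨c1, c2, c3⟩ := crossing_spec T hj
    obtain ⟨f, hf⟩ := exists_ofFn_eq c1
    -- The squared duration is the summand for this word and these corners, because there the lower
    -- limit is a limit.
    have hle : Slim T (j + 1) n ^ 2 ≤ sqBound T n := by
      classical
      refine le_trans (le_of_eq ?_) (Finset.single_le_sum (fun _ _ => bot_le)
        (Finset.mem_univ (f, (crossing T n j).2.1, (crossing T n j).2.2)))
      rw [Slim, hS.limUnder_eq, ← ENNReal.ofReal_pow (by have := alpha_pos; positivity)]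
      refine (Tendsto.liminf_eq ?_).symm
      simp only [hf, root_part, c3, c2, ne_eq, not_false_eq_true, and_self, if_true]
      exact ENNReal.tendsto_ofReal ((hl.div_const _).pow 2)
    exact (ENNReal.pow_le_pow_left_iff two_ne_zero).1 (hle.trans hn)

theorem ae_goodEvent {Ω : Type*} [MeasurableSpace Ω] {P : Measure Ω} [IsProbabilityMeasure P]
    {T : Ω → LimitTree} (hT : IsUniformLimitTree P T) : ∀ᵐ ω ∂P, GoodEvent (T ω) := by
  have all : ∀ {p : List (Fin 3) → Fin 3 → Fin 3 → Ω → Prop},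
      (∀ w a b, a ≠ b → ∀ᵐ ω ∂P, conn (states (T ω) w) a b → p w a b ω) →
      ∀ᵐ ω ∂P, ∀ w a b, a ≠ b → conn (states (T ω) w) a b → p w a b ω := by
    intro p hp
    simp only [ae_all_iff]
    exact hp
  filter_upwards [all fun w a b => ae_exists_tendsto_lenf hT w (a := a) (b := b),
    all fun w a b => ae_not_tendsto_zero hT w (a := a) (b := b),
    all fun w a b => ae_not_hitsThird hT w (a := a) (b := b), ae_tendsto_sqBound hT]
    with ω h1 h2 h3 h4
  exact GoodEvent.of_tendsto h1 h2 h3 h4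

/-! ### Existence of the uniform limit tree -/

theorem natCard_Fib (s : St) : Nat.card {t : Fin 3 → St // tau t = s} = (Fib s).card := by
  rw [Nat.card_eq_fintype_card, Fintype.card_subtype]
  rfl

theorem natCard_Fib_eq {s : St} (hs : s ≠ 7) :
    (Nat.card {t : Fin 3 → St // tau t = s} : ℝ) = 50 * (3 / 5) ^ edges s := by
  have h : (cardTable s : ℝ) * 5 ^ edges s = 50 * 3 ^ edges s := by exact_mod_cast cardTable_eq s hs
  rw [natCard_Fib, card_Fib hs, div_pow, mul_div_assoc', eq_div_iff (by positivity), h]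

/-- The number of preimages of a configuration under the trace depends on the root only. -/
theorem exists_card_fiber : ∀ n : ℕ, ∃ A : ℝ, 0 < A ∧ ∀ c : Cfg n, root n c ≠ 7 →
    (Nat.card {ρ : Cfg (n + 1) // tr n ρ = c} : ℝ) = A * (3 / 5) ^ edges (root n c) := by
  intro n
  induction n with
  | zero =>
    have h : ∀ s : St, s ≠ 7 →
        (Nat.card {t : Fin 3 → St // tau t = s} : ℝ) = 50 * (3 / 5) ^ edges s :=
      fun s hs => natCard_Fib_eq hs
    exact ⟨50, by norm_num, h⟩
  | succ n ih =>
    obtain ⟨A, hA, ih⟩ := ih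
    refine ⟨A ^ 3 * (3 / 5) ^ 3, by positivity, fun c hc => ?_⟩
    have h7 : ∀ i, root n (c i) ≠ 7 := ((tau_ne_iff fun i => root n (c i)).1 hc).1
    have h1 : Nat.card {ρ : Cfg (n + 1 + 1) // tr (n + 1) ρ = c} =
        ∏ i, Nat.card {ρ : Cfg (n + 1) // tr n ρ = c i} := by
      rw [← Nat.card_pi]
      refine Nat.card_congr (Equiv.trans ?_ (Equiv.subtypePiEquivPi (p := fun i ρ => tr n ρ = c i)))
      exact Equiv.subtypeEquivRight fun ρ => funext_iff
    have he : edges (root n (c 0)) + edges (root n (c 1)) + edges (root n (c 2)) =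
        edges (root (n + 1) c) + 3 := edges_tau (fun i => root n (c i)) hc
    rw [h1]
    push_cast
    rw [Finset.prod_congr rfl fun i _ => ih (c i) (h7 i), Fin.prod_univ_three]
    generalize edges (root n (c 0)) = e₀ at he ⊢
    generalize edges (root n (c 1)) = e₁ at he ⊢
    generalize edges (root n (c 2)) = e₂ at he ⊢
    generalize edges (root (n + 1) c) = k at he ⊢
    -- Again `edges_tau` turns the sum of the exponents of the pieces into a function of the root.
    calc _ = A ^ 3 * (3 / 5 : ℝ) ^ (e₀ + e₁ + e₂) := by rw [pow_add, pow_add]; ring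
      _ = _ := by rw [he, pow_add]; ring

/-- The trace of a spanning tree. -/
noncomputable def traceTree (n : ℕ) (s : SpanTree (n + 1)) : SpanTree n :=
  (codeEquiv n).symm ⟨tr n (code s), by rw [root_tr]; exact isTree_code s⟩

theorem traceTree_val (n : ℕ) (s : SpanTree (n + 1)) : (traceTree n s).1 = trace n s.1 := by
  have h7 := ((isTree_iff _).1 (isTree_code s)).1
  have := trace_dec n _ h7
  rw [dec_code] at this
  rw [this]
  rfl

theorem traceTree_eq_iff {n : ℕ} {s : SpanTree (n + 1)} {t : SpanTree n} :
    traceTree n s = t ↔ tr n (code s) = code t := by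
  rw [traceTree, Equiv.symm_apply_eq, Subtype.ext_iff]
  rfl

instance (n : ℕ) : Finite (SpanTree n) := Finite.of_equiv _ (codeEquiv n).symm

theorem edges_of_isTree : ∀ s : St, isTree s → edges s = 2 := by decide

/-- All fibers of the trace have the same positive cardinality. -/
theorem exists_card_fiber_traceTree (n : ℕ) : ∃ K, 0 < K ∧ ∀ t : SpanTree n,
    Nat.card {s : SpanTree (n + 1) // traceTree n s = t} = K := by
  obtain ⟨A, hA, h⟩ := exists_card_fiber n
  have key : ∀ t : SpanTree n, (Nat.card {s : SpanTree (n + 1) // traceTree n s = t} : ℝ) =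
      A * (3 / 5) ^ 2 := by
    intro t
    have ht := isTree_code t
    have h2 := h _ ((isTree_iff _).1 ht).1
    -- All tree states have two edges, which makes the fiber size the same for all trees.
    rw [edges_of_isTree _ ht] at h2
    rw [← h2]
    refine congrArg Nat.cast (Nat.card_congr (Equiv.trans (Equiv.subtypeEquiv (codeEquiv (n + 1))
      (q := fun x => tr n x.1 = code t) fun s => traceTree_eq_iff) ?_))
    refine Equiv.subtypeSubtypeEquivSubtype (p := fun ρ : Cfg (n + 1) => isTree (root (n + 1) ρ))
      (q := fun ρ : Cfg (n + 1) => tr n ρ = code t) fun {ρ} hρ => ?_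
    rw [← root_tr, hρ]
    exact ht
  by_cases hne : Nonempty (SpanTree n)
  · obtain ⟨t₀⟩ := hne
    refine ⟨_, ?_, fun t => Nat.cast_injective (R := ℝ) ((key t).trans (key t₀).symm)⟩
    have : (0 : ℝ) < Nat.card {s : SpanTree (n + 1) // traceTree n s = t₀} := by
      rw [key]; positivity
    exact_mod_cast this
  · exact ⟨1, one_pos, fun t => absurd ⟨t⟩ hne⟩

/-- Compatible enumerations of the sets of spanning trees. -/
theorem exists_enumeration : ∃ (N K : ℕ → ℕ) (e : ∀ n, Fin (N n) ≃ SpanTree n),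
    (∀ n, 0 < N n) ∧ (∀ n, N (n + 1) = N n * K n) ∧ (∀ n, 0 < K n) ∧
    ∀ n (i : Fin (N (n + 1))) (j : Fin (N n)), i.val / K n = j.val →
      traceTree n (e (n + 1) i) = e n j := by
  choose K hK0 hK using exists_card_fiber_traceTree
  have hφ : ∀ n, ∃ φ : SpanTree n × Fin (K n) ≃ SpanTree (n + 1), ∀ x, traceTree n (φ x) = x.1 := by
    intro n
    have hf : ∀ t : SpanTree n, Nonempty (Fin (K n) ≃ {s : SpanTree (n + 1) // traceTree n s = t}) :=
      fun t => ⟨((Finite.equivFinOfCardEq (hK n t))).symm⟩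
    refine ⟨((Equiv.sigmaEquivProd _ _).symm.trans
      (Equiv.sigmaCongrRight fun t => (hf t).some)).trans (Equiv.sigmaFiberEquiv (traceTree n)), ?_⟩
    rintro ⟨t, i⟩
    exact ((hf t).some i).2
  choose φ hφ using hφ
  let N : ℕ → ℕ := fun n => Nat.rec (Nat.card (SpanTree 0)) (fun n m => m * K n) n
  -- The index `i` at level `n + 1` stands for the extension numbered `i % K n` of the tree with
  -- index `i / K n`.
  let e : ∀ n, Fin (N n) ≃ SpanTree n := fun n => Nat.rec (motive := fun n => Fin (N n) ≃ SpanTree n)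
    (Finite.equivFin (SpanTree 0)).symm
    (fun n e => (finProdFinEquiv.symm.trans (e.prodCongr (Equiv.refl _))).trans (φ n)) n
  refine ⟨N, K, e, fun n => ?_, fun n => rfl, hK0, fun n i j hij => ?_⟩
  · induction n with
    | zero =>
      have : Nonempty (SpanTree 0) := ⟨(codeEquiv 0).symm ⟨(3 : St), rfl⟩⟩
      exact Nat.card_pos
    | succ n ih => exact Nat.mul_pos ih (hK0 n)
  · refine (hφ n _).trans ?_
    refine congrArg (e n) (Fin.ext ?_)
    exact hij

/-- A uniform point $\omega$ of $[0,1)$ selects the tree with index $\lfloor\omega N_n\rfloor$.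
Dividing this index at level $n+1$ by $K_n$ gives the index at level $n$, so the trees are
compatible under the trace. -/
theorem exists_uniformLimitTree : ∃ P : Measure LimitTree,
    IsProbabilityMeasure P ∧ IsUniformLimitTree P id := by
  obtain ⟨N, K, e, hN0, hN, hK0, he⟩ := exists_enumeration
  -- The fractional part only serves to define the trees for every real number; the law is
  -- concentrated on $[0,1)$.
  have hlt : ∀ n (ω : ℝ), ⌊Int.fract ω * N n⌋₊ < N n := by
    intro n ω
    have hpos : (0 : ℝ) < N n := by exact_mod_cast hN0 n
    rw [Nat.floor_lt (mul_nonneg (Int.fract_nonneg _) hpos.le)]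
    nlinarith [Int.fract_lt_one ω]
  set t : ∀ n, ℝ → SpanTree n := fun n ω => e n ⟨_, hlt n ω⟩ with ht
  have htr : ∀ n ω, trace n (t (n + 1) ω).1 = (t n ω).1 := by
    intro n ω
    rw [← traceTree_val]
    refine congrArg Subtype.val (he n _ _ ?_)
    show ⌊Int.fract ω * N (n + 1)⌋₊ / K n = ⌊Int.fract ω * N n⌋₊
    have hK : (K n : ℝ) ≠ 0 := by exact_mod_cast (hK0 n).ne'
    rw [← Nat.floor_div_natCast, hN, Nat.cast_mul, ← mul_assoc, mul_div_cancel_right₀ _ hK]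
  set T : ℝ → LimitTree := fun ω => ⟨fun n => t n ω, fun n => htr n ω⟩ with hT
  have hpre : ∀ n (s : SpanTree n), t n ⁻¹' {s} =
      {ω : ℝ | ⌊Int.fract ω * N n⌋₊ = ((e n).symm s).val} := by
    intro n s
    ext ω
    rw [Set.mem_preimage, Set.mem_singleton_iff, ht]
    simp only
    rw [← Equiv.eq_symm_apply, Fin.ext_iff]
    rfl
  have hmt : ∀ n, Measurable (t n) := by
    intro n
    refine measurable_to_countable' fun s => ?_
    rw [hpre]
    exact (Nat.measurable_floor.comp (measurable_fract.mul_const _)) (measurableSet_singleton _)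
  have hmT : Measurable T := by
    rw [measurable_iff_comap_le]
    change MeasurableSpace.comap T (⨆ n, _) ≤ _
    rw [MeasurableSpace.comap_iSup]
    refine iSup_le fun n => ?_
    rw [MeasurableSpace.comap_comp]
    exact (hmt n).comap_le
  have hprob : IsProbabilityMeasure (volume.restrict (Set.Ico (0 : ℝ) 1)) :=
    ⟨by rw [Measure.restrict_apply_univ, Real.volume_Ico]; simp⟩
  refine ⟨(volume.restrict (Set.Ico (0 : ℝ) 1)).map T, Measure.isProbabilityMeasure_map hmT.aemeasurable,
    measurable_id, fun n => ?_⟩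
  have hcomp : ((volume.restrict (Set.Ico (0 : ℝ) 1)).map T).map
      (fun ω => (id ω : LimitTree).proj n) = (volume.restrict (Set.Ico (0 : ℝ) 1)).map (t n) :=
    Measure.map_map (measurable_proj n) hmT
  rw [hcomp]
  have hms : MeasurableSingletonClass (SpanTree n) := ⟨fun _ => trivial⟩
  have hft : Fintype (SpanTree n) := Fintype.ofEquiv _ (e n)
  have hcard : Fintype.card (SpanTree n) = N n := by
    rw [Fintype.card_congr (e n).symm, Fintype.card_fin]
  have hpos : (0 : ℝ) < N n := by exact_mod_cast hN0 n
  refine Measure.ext_of_singleton fun s => ?_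
  rw [Measure.map_apply (hmt n) (measurableSet_singleton s), uniformOn_univ, Measure.count_singleton,
    hcard, Measure.restrict_apply (hmt n (measurableSet_singleton s)), hpre]
  set i := ((e n).symm s).val with hi
  have hiN : (i : ℝ) + 1 ≤ N n := by exact_mod_cast ((e n).symm s).2
  -- Each tree is selected on an interval of length $1/N_n$, which is its uniform probability.
  have hset : {ω : ℝ | ⌊Int.fract ω * N n⌋₊ = i} ∩ Set.Ico 0 1 =
      Set.Ico ((i : ℝ) / N n) ((i + 1) / N n) := by
    ext ω
    simp only [Set.mem_inter_iff, Set.mem_ofPred_eq, Set.mem_Ico, div_le_iff₀ hpos, lt_div_iff₀ hpos]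
    constructor
    · rintro ⟨h1, h2, h3⟩
      rw [Int.fract_eq_self.2 ⟨h2, h3⟩] at h1
      exact (Nat.floor_eq_iff (by positivity)).1 h1
    · rintro ⟨h1, h2⟩
      have h3 : 0 ≤ ω := by
        by_contra! hneg
        have : ω * N n < 0 := mul_neg_of_neg_of_pos hneg hpos
        linarith [(Nat.cast_nonneg i : (0 : ℝ) ≤ i)]
      have h4 : ω < 1 := by
        by_contra! hge
        nlinarith
      refine ⟨?_, h3, h4⟩
      rw [Int.fract_eq_self.2 ⟨h3, h4⟩]
      exact (Nat.floor_eq_iff (by positivity)).2 ⟨h1, h2⟩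
  rw [hset, Real.volume_Ico, ← sub_div, add_sub_cancel_left, ENNReal.ofReal_div_of_pos hpos]
  simp

end SierpinskiLERW

theorem mainTheorem2 :
    (∃ P : MeasureTheory.Measure SierpinskiLERW.LimitTree,
      MeasureTheory.IsProbabilityMeasure P ∧ SierpinskiLERW.IsUniformLimitTree P id) ∧
    ∀ {Ω : Type*} [MeasurableSpace Ω] (P : MeasureTheory.Measure Ω)
      [MeasureTheory.IsProbabilityMeasure P] (T : Ω → SierpinskiLERW.LimitTree),
      SierpinskiLERW.IsUniformLimitTree P T →
      (∀ᵐ ω ∂P, SierpinskiLERW.GoodEvent (T ω)) ∧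
      ∀ ω, SierpinskiLERW.GoodEvent (T ω) →
        -- the limit curve is a well-defined self-avoiding curve
        SierpinskiLERW.IsCurve (SierpinskiLERW.Xlim (T ω)) ∧
        TendstoUniformly (SierpinskiLERW.X (T ω)) (SierpinskiLERW.Xlim (T ω)) atTop ∧
        SierpinskiLERW.SelfAvoiding (SierpinskiLERW.Xlim (T ω)) ∧
        ∀ n,
          -- the times at which the limit curve moves on to another part are well-defined
          SierpinskiLERW.IsPartDecomp n (SierpinskiLERW.Xlim (T ω))
            (SierpinskiLERW.numParts n (SierpinskiLERW.Xlim (T ω)))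
            (fun j => SierpinskiLERW.partTime j n (SierpinskiLERW.Xlim (T ω)))
            (fun j => SierpinskiLERW.partWord j n (SierpinskiLERW.Xlim (T ω))) ∧
          SierpinskiLERW.numParts n (SierpinskiLERW.Xlim (T ω)) =
            SierpinskiLERW.numParts n (SierpinskiLERW.X (T ω) n) ∧
          ∀ j, 1 ≤ j → j ≤ SierpinskiLERW.numParts n (SierpinskiLERW.X (T ω) n) →
            Tendsto (fun m => SierpinskiLERW.partTime j n (SierpinskiLERW.X (T ω) m)) atTop
              (𝓝 (SierpinskiLERW.Tlim (T ω) j n)) ∧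
            SierpinskiLERW.Tlim (T ω) j n =
              SierpinskiLERW.partTime j n (SierpinskiLERW.Xlim (T ω)) ∧
            SierpinskiLERW.partTime j n (SierpinskiLERW.Xlim (T ω)) =
              sInf {t | SierpinskiLERW.partTime (j - 1) n (SierpinskiLERW.Xlim (T ω)) < t ∧
                SierpinskiLERW.Xlim (T ω) t ∈ SierpinskiLERW.VG n} := by
  refine ⟨SierpinskiLERW.exists_uniformLimitTree, ?_⟩
  intro Ω _ P _ T hT
  exact ⟨SierpinskiLERW.ae_goodEvent hT, fun ω h => h.conclusion⟩
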